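/- Let $N\ge 1$, $0<q<1$, and let $a=(a_1,\dots,a_N)$, $\alpha=(\alpha_1,\dots,\alpha_N)$ be real with $0\le\alpha_i<1$ and $\alpha_i<a_j$ for all $i,j$. Write $(x;q)_\infty=\prod_{n\ge0}(1-xq^n)$ and $(x;q)_m=(x;q)_\infty/(xq^m;q)_\infty$. The two-sided Gelfand–Tsetlin cone $\mathbb G_N$ is the set of integer arrays $\underline\lambda=(\lambda^{(k)}_j)_{1\le j\le k\le N}$ with $\lambda^{(k)}_1\ge\dots\ge\lambda^{(k)}_k$ and $\lambda^{(m+1)}_{l+1}\le\lambda^{(m)}_l\le\lambda^{(m+1)}_l$ for $1\le l\le m\le N-1$. For signatures (non-increasing integer sequences) $\lambda,\mu$ of lengths $n,n-1$ put $$P_{\lambda/\mu}(a)=\prod_{i=1}^n a^{\lambda_i}\prod_{i=1}^{n-1}\frac{a^{-\mu_i}(q;q)_{\lambda_i-\lambda_{i+1}}}{(q;q)_{\lambda_i-\mu_i}(q;q)_{\mu_i-\lambda_{i+1}}},$$ let $P_\lambda(z_1,\dots,z_N)=\sum\prod_{k=1}^N P_{\lambda^{(k)}/\lambda^{(k-1)}}(z_k)$,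 summed over the elements of $\mathbb G_N$ with $\lambda^{(N)}=\lambda$, let $\Pi(z;\alpha,t)=\prod_{i,j=1}^N\frac1{(\alpha_i/z_j;q)_\infty}\prod_{j=1}^N e^{z_jt}$, and $$Q_\lambda(\alpha,t)=\prod_{i=1}^{N-1}(q^{\lambda_i-\lambda_{i+1}+1};q)_\infty\int_{\mathbb T^N}\prod_{i=1}^N\frac{dz_i}{z_i}\,P_\lambda(1/z)\,\Pi(z;\alpha,t)\,\frac{\prod_{i<j}(z_i/z_j;q)_\infty(z_j/z_i;q)_\infty}{(2\pi i)^NN!},$$ where $\mathbb T$ is the unit circle. The two-sided $q$-Whittaker process is $$P_t(\underline\lambda)=\frac{\prod_{k=1}^NP_{\lambda^{(k)}/\lambda^{(k-1)}}(a_k)\;Q_{\lambda^{(N)}}(\alpha,t)}{\Pi(a;\alpha,t)},\qquad \underline\lambda\in\mathbb G_N,\ t\ge0.$$ For $\underline\mu\in\mathbb G_N$ let $m_{jk}$ be the number of indices $b>k$ (with $b\le N$) such that $\mu^{(b)}_j=\mu^{(k)}_j$, let $\underline\mu^{jk+}$ be the array obtained from $\underline\mu$ by increasing $\mu^{(k)}_j,\mu^{(k+1)}_j,\dots,\mu^{(k+m_{jk})}_j$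 by one, and let $$r_{jk}(\underline\mu)=a_k\frac{(1-q^{\mu^{(k-1)}_{j-1}-\mu^{(k)}_j})(1-q^{\mu^{(k)}_j-\mu^{(k)}_{j+1}+1})}{1-q^{\mu^{(k)}_j-\mu^{(k-1)}_j+1}},\qquad \mu^{(k)}_0=+\infty,\ \mu^{(k)}_{k+1}=-\infty,$$ $$L(\underline\mu,\underline\lambda)=\sum_{1\le j\le k\le N}r_{jk}(\underline\mu)\bigl(\delta_{\underline\lambda,\underline\mu^{jk+}}-\delta_{\underline\lambda,\underline\mu}\bigr).$$ **Theorem.** 1. $L$ is the generator of a Markov chain on $\mathbb G_N$: $L(\underline\mu,\underline\lambda)\ge0$ for $\underline\mu\ne\underline\lambda$, and $\sum_{\underline\lambda}L(\underline\mu,\underline\lambda)=0$ for every $\underline\mu$. 2. For all $t\ge0$ and $\underline\lambda\in\mathbb G_N$ the Kolmogorov forward equation holds (with a one-sided derivative at $t=0$): $$\frac{dP_t(\underline\lambda)}{dt}=\sum_{\underline\mu\in\mathbb G_N}P_t(\underline\mu)L(\underline\mu,\underline\lambda).$$ 3. The edge evolves as $N$-particle $q$-TASEP with particle-dependent rates.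 Put $X_j=\lambda^{(j)}_j-j$, so that $X_1>\dots>X_N$, and let $L^{q\mathrm{T}}$ be the generator of $q$-TASEP on strictly decreasing configurations: $X_j$ jumps to $X_j+1$ at rate $a_j(1-q^{X_{j-1}-X_j-1})$, where $X_0=+\infty$. Then the edge is autonomous under $L$: for every $\underline\mu\in\mathbb G_N$ with edge $X$ and every configuration $Y$, the sum of $L(\underline\mu,\underline\lambda)$ over all $\underline\lambda$ with edge $Y$ equals $L^{q\mathrm{T}}(X,Y)$. Moreover, for every $t\ge 0$, $\sum_{\underline\lambda\in\mathbb G_N}P_t(\underline\lambda)$ converges absolutely, and the edge marginal $p_t(X)=\sum_{\underline\lambda\text{ with edge }X}P_t(\underline\lambda)$ satisfies $$\frac{dp_t(Y)}{dt}=\sum_Xp_t(X)L^{q\mathrm{T}}(X,Y)\qquad(t\ge0)$$ for every configuration $Y$ (with a one-sided derivative at $t=0$). -/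

import Mathlib

noncomputable section

namespace QWhittaker

/-- The infinite `q`-Pochhammer symbol `(a;q)_∞ = ∏_{n ≥ 0} (1 - a qⁿ)`. -/
def qPochInf (q a : ℂ) : ℂ := ∏' n : ℕ, (1 - a * q ^ n)

/-- The `q`-Pochhammer symbol `(a;q)_m = (a;q)_∞ / (a q^m;q)_∞`, for an integer `m`.
For negative `m` the denominator of `(q;q)_m` vanishes; division by zero being zero, the usual
convention `1 / (q;q)_m = 0` holds here too. -/
def qPoch (q a : ℂ) (m : ℤ) : ℂ := qPochInf q a / qPochInf q (a * q ^ m)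

/-- The sequence `s 1, …, s n` is a signature of length `n`: `s 1 ≥ s 2 ≥ ⋯ ≥ s n`.
Rows are indexed from `1`; values of `s` at other indices are irrelevant. -/
def IsSignature (n : ℕ) (s : ℕ → ℤ) : Prop :=
  ∀ i j, 1 ≤ i → i ≤ j → j ≤ n → s j ≤ s i

/-- The two-sided Gelfand–Tsetlin cone of depth `N`: triangular arrays of integers
`entry k j` (`1 ≤ j ≤ k ≤ N`, upper index `k`, lower index `j`), whose rows are signatures and
which satisfy the interlacing condition.  Outside the triangle `entry` is set to `0`, so that two
elements are equal exactly if their triangular arrays are. -/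
@[ext]
structure GTCone (N : ℕ) where
  entry : ℕ → ℕ → ℤ
  outside : ∀ k j, ¬ (1 ≤ j ∧ j ≤ k ∧ k ≤ N) → entry k j = 0
  signature : ∀ k, 1 ≤ k → k ≤ N → IsSignature k (entry k)
  interlacing : ∀ m l, 1 ≤ l → l ≤ m → m + 1 ≤ N →
    entry (m + 1) (l + 1) ≤ entry m l ∧ entry m l ≤ entry (m + 1) l

/-- The skew `q`-Whittaker function `P_{lam/mu}(a)` of one variable, for signatures `lam` of length
`n` and `mu` of length `n - 1`. -/
def skewP (q : ℂ) (n : ℕ) (lam mu : ℕ → ℤ) (a : ℂ) : ℂ :=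
  (∏ i ∈ Finset.Icc 1 n, a ^ lam i) *
    ∏ i ∈ Finset.Icc 1 (n - 1),
      a ^ (-mu i) * qPoch q q (lam i - lam (i + 1)) /
        (qPoch q q (lam i - mu i) * qPoch q q (mu i - lam (i + 1)))

/-- `∏_{k=1}^N P_{λ^{(k)}/λ^{(k-1)}}(a_k)`; the variable `a_k` is `a ⟨k - 1, _⟩`. -/
def chainP (q : ℂ) {N : ℕ} (x : GTCone N) (a : Fin N → ℂ) : ℂ :=
  ∏ k : Fin N, skewP q (k + 1) (x.entry (k + 1)) (x.entry k) (a k)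

/-- The `q`-Whittaker function `P_lam(a_1, …, a_N)`: the (finite) sum of `chainP` over the
elements of the cone whose row `N` is `lam`. -/
def whittakerP (q : ℂ) (N : ℕ) (lam : ℕ → ℤ) (a : Fin N → ℂ) : ℂ :=
  ∑ᶠ x ∈ {x : GTCone N | ∀ i, 1 ≤ i → i ≤ N → x.entry N i = lam i}, chainP q x a

/-- `Π(z;α,t) = ∏_{i,j} 1/(α_i/z_j;q)_∞ · ∏_j e^{z_j t}`. -/
def bigPi (q : ℂ) {N : ℕ} (z : Fin N → ℂ) (α : Fin N → ℝ) (t : ℝ) : ℂ :=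
  (∏ i, ∏ j, 1 / qPochInf q ((α i : ℂ) / z j)) * ∏ j, Complex.exp (z j * (t : ℂ))

/-- The `q`-Sklyanin measure
`m_N^q(z) = (2πi)^{-N} (N!)⁻¹ ∏_{i<j} (z_i/z_j;q)_∞ (z_j/z_i;q)_∞`. -/
def sklyanin (q : ℂ) {N : ℕ} (z : Fin N → ℂ) : ℂ :=
  1 / ((2 * (Real.pi : ℂ) * Complex.I) ^ N * (N.factorial : ℂ)) *
    ∏ i : Fin N, ∏ j ∈ Finset.Ioi i, qPochInf q (z i / z j) * qPochInf q (z j / z i)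

/-- `Q_lam(α,t)`, an integral over the torus `{|z_1| = ⋯ = |z_N| = 1}`. -/
def whittakerQ (q : ℂ) (N : ℕ) (lam : ℕ → ℤ) (α : Fin N → ℝ) (t : ℝ) : ℂ :=
  (∏ i ∈ Finset.Icc 1 (N - 1), qPochInf q (q ^ (lam i - lam (i + 1) + 1))) *
    torusIntegral
      (fun z : Fin N → ℂ =>
        (∏ i, (z i)⁻¹) * whittakerP q N lam (fun i => 1 / z i) * bigPi q z α t * sklyanin q z)
      (fun _ => 0) (fun _ => 1)

/-- The two-sided `q`-Whittaker process
`P_t(x) = ∏_k P_{x^{(k)}/x^{(k-1)}}(a_k) · Q_{x^{(N)}}(α,t) / Π(a;α,t)`. -/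
def process (q : ℝ) {N : ℕ} (a α : Fin N → ℝ) (t : ℝ) (x : GTCone N) : ℂ :=
  chainP (q : ℂ) x (fun j => (a j : ℂ)) * whittakerQ (q : ℂ) N (x.entry N) α t /
    bigPi (q : ℂ) (fun j => (a j : ℂ)) α t

/-- `m_{j,k}`: the number of particles sharing the position and the lower index with the particle
`(j,k)` and having a larger upper index. -/
def shareAbove {N : ℕ} (x : GTCone N) (j k : ℕ) : ℕ :=
  ((Finset.Ioc k N).filter fun b => x.entry b j = x.entry k j).card

/-- The array obtained from `x` by moving the particles `(j,k), (j,k+1), …, (j,k+m_{j,k})` one step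
to the right.  It need not satisfy the interlacing condition. -/
def pushArray {N : ℕ} (x : GTCone N) (j k : ℕ) : ℕ → ℕ → ℤ := fun b c =>
  if k ≤ b ∧ b ≤ k + shareAbove x j k ∧ c = j then x.entry b c + 1 else x.entry b c

/-- The rate `r_{jk}` (`1 ≤ j ≤ k`), with `ak` the parameter of row `k`.  The two case distinctions
express the conventions `x^{(k-1)}_0 = ∞` and `x^{(k)}_{k+1} = x^{(k-1)}_k = -∞`, under which the
respective powers of `q` are `0`. -/
def rate (q ak : ℝ) {N : ℕ} (x : GTCone N) (j k : ℕ) : ℝ :=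
  ak *
    (if j = 1 then 1 else 1 - q ^ (x.entry (k - 1) (j - 1) - x.entry k j)) *
    (if j = k then 1 else
      (1 - q ^ (x.entry k j - x.entry k (j + 1) + 1)) /
        (1 - q ^ (x.entry k j - x.entry (k - 1) j + 1)))

open Classical in
/-- The generator
`L(x,y) = ∑_{1 ≤ j ≤ k ≤ N} r_{jk}(x) (δ_{y, x^{jk+}} - δ_{y,x})`; the summation index `k : Fin N`
stands for row `k + 1`. -/
def generator (q : ℝ) {N : ℕ} (a : Fin N → ℝ) (x y : GTCone N) : ℝ :=
  ∑ k : Fin N, ∑ j ∈ Finset.Icc 1 ((k : ℕ) + 1),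
    rate q (a k) x j (k + 1) *
      ((if y.entry = pushArray x j (k + 1) then 1 else 0) - (if y = x then 1 else 0))

/-- Configurations `X_1 > X_2 > ⋯ > X_N` of `N` exclusion particles on `ℤ`. -/
def Config (N : ℕ) : Type := {X : Fin N → ℤ // StrictAnti X}

/-- The rate of the `i`-th particle in `q`-TASEP: `a_i (1 - q^{gap})`, where `gap` is the number of
empty sites between particle `i` and particle `i - 1` ahead of it, and rate `a_1` for the first
particle. -/
def tasepRate (q : ℝ) {N : ℕ} (a : Fin N → ℝ) (X : Config N) (i : Fin N) : ℝ :=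
  a i * (if h : (i : ℕ) = 0 then 1 else
    1 - q ^ (X.1 ⟨(i : ℕ) - 1, by omega⟩ - X.1 i - 1))

open Classical in
/-- The generator of `N`-particle `q`-TASEP with rate parameters `a_1, …, a_N`: particle `i` jumps
one step to the right at rate `tasepRate`. -/
def tasepGenerator (q : ℝ) {N : ℕ} (a : Fin N → ℝ) (X Y : Config N) : ℝ :=
  ∑ i : Fin N, tasepRate q a X i *
    ((if Y.1 = Function.update X.1 i (X.1 i + 1) then 1 else 0) - (if Y = X then 1 else 0))

theorem GTCone.edge_step {N : ℕ} (x : GTCone N) {k l : ℕ} (hk : 1 ≤ k) (hl : l ≤ N) (h : k ≤ l) :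
    x.entry l l ≤ x.entry k k := by
  induction l, h using Nat.le_induction with
  | base => exact le_rfl
  | succ m hm ih =>
    exact (x.interlacing m m (hk.trans hm) le_rfl hl).1.trans (ih (by omega))

/-- The edge of the cone as a particle configuration, `X_j = x^{(j)}_j - j`. -/
def edge {N : ℕ} (x : GTCone N) : Config N :=
  ⟨fun j => x.entry (j + 1) (j + 1) - ((j : ℤ) + 1), by
    intro i j hij
    have hij' : (i : ℕ) < (j : ℕ) := hij
    have h := x.edge_step (k := i + 1) (l := j + 1) (by omega) (by omega) (by omega)
    simp only
    omega⟩

/-- The edge marginal of `P_t`: `X ↦ ∑_{x : edge x = X} P_t(x)`. -/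
def edgeMarginal (q : ℝ) {N : ℕ} (a α : Fin N → ℝ) (t : ℝ) (X : Config N) : ℂ :=
  ∑' x : {x : GTCone N // edge x = X}, process q a α t x.1

end QWhittaker

end

/-! ### q-Pochhammer symbols: recursion, zeros and uniform bounds. -/

noncomputable section
namespace QWhittaker
open Filter Topology

/-! The process is an exponential family of contour integrals on which the generator acts by
multiplication. By `process_eq`, P_t is a constant times the signed measure `coneWeight` of the
function f(z) = exp(t(∑ z_i - ∑ a_i)) on the torus. The central fact,
`hasSum_coneWeight_mul_generator`, is that L sends the measure of any continuous f to the measure of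
(∑ z_i - ∑ a_i) f. Differentiating the exponential in t produces the same factor, which is the
forward equation.

The central fact is local algebra followed by a Pieri rule. Group the moves into an array y by the
last row b that they change. Induction over rows (`raise_row`, `enterWeight_eq`) collapses the moves
of column j reaching row b into one coefficient. If b < N, the sum over j is the exit rate of row b
+ 1 minus its parameter (`sum_rateRow_mul_skewP`); these exit rates cancel the diagonal of L and
leave -∑ a_i. If b = N, the coefficients pass through the prefactor of Q and become those of the
Pieri rule for P_λ(1/z), which produces ∑ z_i. The Pieri rule itself is proved by induction on the
number of variables: the sums over subsets S of shifted indices are transfer-matrix products, and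
the two transfer matrices are intertwined by `chainState_upper_eq`.

Every array has finitely many predecessors, so this algebra meets no convergence question. The edge
marginal does: it sums over infinite fibres, and no positivity of P_t is available. The remedy is to
work in ℓ¹ of the cone. The rates are bounded, so L is a bounded operator there, and the n-th time
derivative at 0, obtained by applying L n times, has norm at most D K^n once P_0 is in ℓ¹
(`exists_bound_timeMoment`). The exponential series may then be summed over fibres and
differentiated termwise, and autonomy of the edge turns L into the q-TASEP generator
(`hasSum_lumped`).

That P_0 is in ℓ¹ (`summable_initial`) rests on two properties of the torus integral at time 0. It
vanishes unless the largest entry of the last row is nonpositive (`rowIntegral_eq_zero`). This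
follows from a q-difference operator that is diagonal on q-Whittaker functions: the effect of z_i ↦
q z_i is computed by `pw_update` and Lagrange interpolation, and is undone by moving a contour. On
arrays with nonpositive entries, moving all contours to a radius r between max α and min a gives
decay (r / min a)^(-|λ|), while the number of arrays grows only polynomially. -/

theorem summable_norm_qPoch_term {q : ℂ} (hq : ‖q‖ < 1) (a : ℂ) :
    Summable fun n : ℕ => ‖-(a * q ^ n)‖ := by
  simp only [norm_neg, norm_mul, norm_pow]
  exact (summable_geometric_of_lt_one (norm_nonneg q) hq).mul_left _

theorem qPochInf_eq_mul {q : ℂ} (hq : ‖q‖ < 1) (a : ℂ) :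
    qPochInf q a = (1 - a) * qPochInf q (a * q) := by
  have hm : Multipliable fun n : ℕ => 1 - a * q ^ (n + 1) := by
    have h := multipliable_one_add_of_summable (summable_norm_qPoch_term hq (a * q))
    refine h.congr fun n => ?_
    rw [pow_succ']
    ring
  have h := tprod_eq_zero_mul' (f := fun n : ℕ => 1 - a * q ^ n) hm
  unfold qPochInf
  rw [h, pow_zero, mul_one]
  congr 1
  refine tprod_congr fun n => ?_
  rw [pow_succ']
  ring

theorem qPochInf_ne_zero {q : ℂ} (hq : ‖q‖ < 1) {a : ℂ} (ha : ‖a‖ < 1) : qPochInf q a ≠ 0 := by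
  unfold qPochInf
  simp only [sub_eq_add_neg]
  refine tprod_one_add_ne_zero_of_summable (fun n h => ?_) (summable_norm_qPoch_term hq a)
  have h1 : a * q ^ n = 1 := by linear_combination -h
  have h2 : ‖a * q ^ n‖ < 1 := by
    rw [norm_mul, norm_pow]
    exact (mul_le_of_le_one_right (norm_nonneg a) (pow_le_one₀ (norm_nonneg q) hq.le)).trans_lt ha
  rw [h1, norm_one] at h2
  exact lt_irrefl _ h2

theorem differentiable_qPochInf {q : ℂ} (hq : ‖q‖ < 1) : Differentiable ℂ (qPochInf q) := by
  intro x
  set R : ℝ := ‖x‖ + 1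
  have hR : 0 < R := by positivity
  have hu : Summable fun n : ℕ => R * ‖q‖ ^ n :=
    (summable_geometric_of_lt_one (norm_nonneg q) hq).mul_left _
  have h := hu.hasProdLocallyUniformlyOn_nat_one_add (f := fun n a => -(a * q ^ n))
    (K := Metric.ball (0 : ℂ) R) Metric.isOpen_ball
    (Eventually.of_forall fun n a ha => by
      rw [norm_neg, norm_mul, norm_pow]
      have : ‖a‖ < R := by simpa using ha
      gcongr) (fun n => by fun_prop)
  have hd : DifferentiableOn ℂ (fun a => ∏' n : ℕ, (1 + -(a * q ^ n))) (Metric.ball (0 : ℂ) R) := by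
    refine TendstoLocallyUniformlyOn.differentiableOn
      (hasProdLocallyUniformlyOn_iff_tendstoLocallyUniformlyOn.mp h)
      (Eventually.of_forall fun s => ?_) Metric.isOpen_ball
    fun_prop
  have := hd.differentiableAt (Metric.isOpen_ball.mem_nhds (show x ∈ Metric.ball (0:ℂ) R by
    simp [R]))
  have h2 : qPochInf q = fun a => ∏' n : ℕ, (1 + -(a * q ^ n)) := by
    funext a
    simp only [sub_eq_add_neg, qPochInf]
  rwa [h2]

/-- The tail `(q^{n+1};q)_∞`. -/
def qTail (q : ℂ) (n : ℤ) : ℂ := qPochInf q (q ^ (n + 1))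

theorem qTail_eq_mul {q : ℂ} (hq0 : q ≠ 0) (hq : ‖q‖ < 1) (n : ℤ) :
    qTail q n = (1 - q ^ (n + 1)) * qTail q (n + 1) := by
  unfold qTail
  rw [qPochInf_eq_mul hq, ← zpow_add_one₀ hq0]

/-- The product contains the factor 1 - q^0. This zero makes 1/(q;q)_n vanish for n < 0, so skew
functions vanish off interlacing rows and the prefactor of Q vanishes off signatures; no case
distinction on supports is then needed. -/
theorem qTail_of_neg {q : ℂ} (hq0 : q ≠ 0) (hq : ‖q‖ < 1) {n : ℤ} (hn : n < 0) :
    qTail q n = 0 := by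
  obtain ⟨k, rfl⟩ : ∃ k : ℕ, n = -(k + 1 : ℤ) := ⟨(-n - 1).toNat, by omega⟩
  clear hn
  induction k with
  | zero => rw [qTail_eq_mul hq0 hq]; simp
  | succ k ih =>
    rw [qTail_eq_mul hq0 hq]
    have : (-((k + 1 : ℕ) + 1 : ℤ) + 1) = -(k + 1 : ℤ) := by push_cast; ring
    rw [this, ih, mul_zero]

theorem norm_zpow_lt_one {q : ℂ} (hq : ‖q‖ < 1) {n : ℤ} (hn : 0 < n) : ‖q ^ n‖ < 1 := by
  lift n to ℕ using hn.le
  rw [zpow_natCast, norm_pow]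
  exact pow_lt_one₀ (norm_nonneg _) hq (by omega)

theorem qTail_ne_zero {q : ℂ} (hq : ‖q‖ < 1) {n : ℤ} (hn : 0 ≤ n) : qTail q n ≠ 0 :=
  qPochInf_ne_zero hq (norm_zpow_lt_one hq (by omega))

theorem one_sub_zpow_ne_zero {q : ℂ} (hq : ‖q‖ < 1) {n : ℤ} (hn : 0 < n) : 1 - q ^ n ≠ 0 := by
  intro h
  have h1 := norm_zpow_lt_one hq hn
  rw [← sub_eq_zero.mp h, norm_one] at h1
  exact lt_irrefl _ h1

theorem qPoch_eq_div {q : ℂ} (hq0 : q ≠ 0) (n : ℤ) : qPoch q q n = qTail q 0 / qTail q n := by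
  unfold qPoch qTail
  rw [zero_add, zpow_one, zpow_add_one₀ hq0, mul_comm]

theorem qPoch_ne_zero {q : ℂ} (hq0 : q ≠ 0) (hq : ‖q‖ < 1) {n : ℤ} (hn : 0 ≤ n) :
    qPoch q q n ≠ 0 := by
  rw [qPoch_eq_div hq0]
  exact div_ne_zero (qTail_ne_zero hq le_rfl) (qTail_ne_zero hq hn)

theorem qPoch_of_neg {q : ℂ} (hq0 : q ≠ 0) (hq : ‖q‖ < 1) {n : ℤ} (hn : n < 0) :
    qPoch q q n = 0 := by
  rw [qPoch_eq_div hq0, qTail_of_neg hq0 hq hn, div_zero]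

/-- `1 / (q;q)_n`, which is `0` for negative `n`. -/
def qInv (q : ℂ) (n : ℤ) : ℂ := (qPoch q q n)⁻¹

theorem qInv_eq_mul {q : ℂ} (hq0 : q ≠ 0) (hq : ‖q‖ < 1) (n : ℤ) :
    qInv q n = (1 - q ^ (n + 1)) * qInv q (n + 1) := by
  unfold qInv
  rw [qPoch_eq_div hq0, qPoch_eq_div hq0, inv_div, inv_div, qTail_eq_mul hq0 hq n, mul_div_assoc]

theorem qInv_of_neg {q : ℂ} (hq0 : q ≠ 0) (hq : ‖q‖ < 1) {n : ℤ} (hn : n < 0) :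
    qInv q n = 0 := by rw [qInv, qPoch_of_neg hq0 hq hn, inv_zero]

theorem qPoch_succ {q : ℂ} (hq0 : q ≠ 0) (hq : ‖q‖ < 1) {n : ℤ} (hn : 0 ≤ n) :
    qPoch q q (n + 1) = (1 - q ^ (n + 1)) * qPoch q q n := by
  have h := qInv_eq_mul hq0 hq n
  unfold qInv at h
  have h1 := qPoch_ne_zero hq0 hq hn
  have h2 := qPoch_ne_zero hq0 hq (show 0 ≤ n + 1 by omega)
  field_simp at h
  linear_combination h

theorem exists_bound_qPochInf {q : ℂ} (hq : ‖q‖ < 1) (R : ℝ) :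
    ∃ K : ℝ, 0 < K ∧ ∀ a : ℂ, ‖a‖ ≤ R → ‖qPochInf q a‖ ≤ K := by
  obtain ⟨K, hK⟩ := (isCompact_closedBall (0 : ℂ) R).exists_bound_of_continuousOn
    (differentiable_qPochInf hq).continuous.continuousOn
  exact ⟨max K 1, by positivity, fun a ha => (hK a (by simpa using ha)).trans (le_max_left _ _)⟩

theorem exists_bound_qTail {q : ℂ} (hq0 : q ≠ 0) (hq : ‖q‖ < 1) :
    ∃ K : ℝ, 0 < K ∧ ∀ n : ℤ, ‖qTail q n‖ ≤ K := by
  obtain ⟨K, hK, h⟩ := exists_bound_qPochInf hq 1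
  refine ⟨K, hK, fun n => ?_⟩
  rcases lt_or_ge n 0 with hn | hn
  · rw [qTail_of_neg hq0 hq hn, norm_zero]; exact hK.le
  · exact h _ (norm_zpow_lt_one hq (by omega)).le

theorem exists_bound_qInv {q : ℂ} (hq0 : q ≠ 0) (hq : ‖q‖ < 1) :
    ∃ K : ℝ, 1 ≤ K ∧ ∀ n : ℤ, ‖qInv q n‖ ≤ K := by
  obtain ⟨K, hK, h⟩ := exists_bound_qTail hq0 hq
  refine ⟨max (K / ‖qTail q 0‖) 1, le_max_right _ _, fun n => le_max_of_le_left ?_⟩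
  rw [qInv, qPoch_eq_div hq0, inv_div, norm_div]
  gcongr
  exact h n

/-- For n ≥ 0 the denominator is evaluated at q^(n+1), in the closed disc of radius |q|, where
(·;q)_∞ has no zero. -/
theorem exists_bound_qPoch {q : ℂ} (hq0 : q ≠ 0) (hq : ‖q‖ < 1) :
    ∃ K : ℝ, 1 ≤ K ∧ ∀ n : ℤ, ‖qPoch q q n‖ ≤ K := by
  have hne : ∀ a ∈ Metric.closedBall (0 : ℂ) ‖q‖, qPochInf q a ≠ 0 := fun a ha =>
    qPochInf_ne_zero hq (lt_of_le_of_lt (by simpa using ha) hq)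
  obtain ⟨K, hK⟩ := (isCompact_closedBall (0 : ℂ) ‖q‖).exists_bound_of_continuousOn
    (ContinuousOn.inv₀ (differentiable_qPochInf hq).continuous.continuousOn hne)
  refine ⟨max (‖qTail q 0‖ * max K 0) 1, le_max_right _ _, fun n => ?_⟩
  rcases lt_or_ge n 0 with hn | hn
  · rw [qPoch_of_neg hq0 hq hn, norm_zero]; positivity
  · refine le_max_of_le_left ?_
    rw [qPoch_eq_div hq0, div_eq_mul_inv, norm_mul]
    gcongr
    refine le_max_of_le_left (hK _ ?_)
    rw [mem_closedBall_zero_iff]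
    lift n to ℕ using hn
    rw [show ((n : ℤ) + 1) = ((n + 1 : ℕ) : ℤ) by simp, zpow_natCast, norm_pow]
    exact pow_le_of_le_one (norm_nonneg _) hq.le (by omega)

end QWhittaker
end
-- Transfer-matrix sums over subsets, one-bond identities, rows and branching.
noncomputable section
namespace QWhittaker
open Finset

/-- Transfer-matrix partial sums: `chainState s g n e` is the sum, over all `ε₁, …, ε_{n+1}` in
`{false, true}` with `ε_{n+1} = e`, of `s ^ #{i : ε_i} ∏_{i ≤ n} g i ε_i ε_{i+1}`. -/
def chainState (s : ℂ) (g : ℕ → Bool → Bool → ℂ) : ℕ → Bool → ℂ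
  | 0, e => if e then s else 1
  | n + 1, e => (if e then s else 1) *
      (chainState s g n false * g (n + 1) false e + chainState s g n true * g (n + 1) true e)

theorem chainState_succ (s : ℂ) (g : ℕ → Bool → Bool → ℂ) (n : ℕ) (e : Bool) :
    chainState s g (n + 1) e = (if e then s else 1) *
      (chainState s g n false * g (n + 1) false e + chainState s g n true * g (n + 1) true e) :=
  rfl

/-- The weight of a subset in the transfer-matrix sum. -/
def chainWeight (s : ℂ) (g : ℕ → Bool → Bool → ℂ) (n : ℕ) (S : Finset ℕ) : ℂ :=
  s ^ #S * ∏ i ∈ Icc 1 n, g i (decide (i ∈ S)) (decide (i + 1 ∈ S))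

theorem notMem_of_mem_powerset_Icc {n m : ℕ} (h : n < m) {S : Finset ℕ}
    (hS : S ∈ (Icc 1 n).powerset) : m ∉ S := fun hm => by
  have := mem_Icc.mp (mem_powerset.mp hS hm)
  omega

theorem sum_powerset_Icc_succ {M : Type*} [AddCommMonoid M] (n : ℕ) (F : Finset ℕ → M) :
    ∑ S ∈ (Icc 1 (n + 1)).powerset, F S =
      ∑ S ∈ (Icc 1 n).powerset, F S + ∑ S ∈ (Icc 1 n).powerset, F (insert (n + 1) S) := by
  rw [← Finset.insert_Icc_right_eq_Icc_add_one (by omega), sum_powerset_insert (by simp)]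

theorem chainWeight_succ (s : ℂ) (g : ℕ → Bool → Bool → ℂ) (n : ℕ) {S : Finset ℕ}
    (hS : n + 2 ∉ S) :
    chainWeight s g (n + 1) S = chainWeight s g n S * g (n + 1) (decide (n + 1 ∈ S)) false := by
  rw [chainWeight, chainWeight, prod_Icc_succ_top (by omega)]
  simp [hS, mul_assoc]

theorem chainWeight_succ_insert (s : ℂ) (g : ℕ → Bool → Bool → ℂ) (n : ℕ) {S : Finset ℕ}
    (hS : n + 2 ∉ S) :
    chainWeight s g (n + 1) (insert (n + 2) S) =
      s * (chainWeight s g n S * g (n + 1) (decide (n + 1 ∈ S)) true) := by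
  rw [chainWeight, chainWeight, prod_Icc_succ_top (by omega), card_insert_of_notMem hS]
  have : ∀ i ∈ Icc 1 n, g i (decide (i ∈ insert (n + 2) S)) (decide (i + 1 ∈ insert (n + 2) S)) =
      g i (decide (i ∈ S)) (decide (i + 1 ∈ S)) := by
    intro i hi
    have := mem_Icc.mp hi
    simp only [mem_insert, show i ≠ n + 2 by omega, show i + 1 ≠ n + 2 by omega, false_or]
  rw [prod_congr rfl this]
  simp only [mem_insert, show n + 1 ≠ n + 2 by omega, false_or, true_or, decide_true]
  ring

/-- Induction on n, splitting subsets by their top index: the only information the next bond needs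
is whether n + 1 belongs to S. -/
theorem sum_chainWeight (s : ℂ) (g : ℕ → Bool → Bool → ℂ) (n : ℕ) :
    ∑ S ∈ (Icc 1 n).powerset, chainWeight s g n S = chainState s g n false ∧
      ∑ S ∈ (Icc 1 n).powerset, chainWeight s g n (insert (n + 1) S) =
        chainState s g n true := by
  induction n with
  | zero => simp [chainWeight, chainState]
  | succ n ih =>
    have key : ∀ e : Bool, ∑ S ∈ (Icc 1 (n + 1)).powerset,
        chainWeight s g n S * g (n + 1) (decide (n + 1 ∈ S)) e =
        chainState s g n false * g (n + 1) false e + chainState s g n true * g (n + 1) true e := by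
      intro e
      rw [sum_powerset_Icc_succ, ← ih.1, ← ih.2, sum_mul, sum_mul]
      congr 1
      · refine sum_congr rfl fun S hS => ?_
        simp [notMem_of_mem_powerset_Icc (show n < n + 1 by omega) hS]
      · refine sum_congr rfl fun S hS => ?_
        simp
    constructor
    · rw [chainState, ← key]
      simp only [Bool.false_eq_true, if_false, one_mul]
      exact sum_congr rfl fun S hS =>
        chainWeight_succ s g n (notMem_of_mem_powerset_Icc (by omega) hS)
    · rw [chainState, ← key, if_pos rfl, mul_sum]
      exact sum_congr rfl fun S hS =>
        chainWeight_succ_insert s g n (notMem_of_mem_powerset_Icc (by omega) hS)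

/-- Transfer matrix for lowering the upper row. -/
def upperBond (q : ℂ) (A b : ℕ → ℂ) (i : ℕ) : Bool → Bool → ℂ
  | false, false => 1 - q * b i
  | true, false => (1 - A i) * (1 - q * b i)
  | false, true => 1 - q * (A i * b i)
  | true, true => 1 - A i

/-- Site weights for raising the lower row. -/
def lowerSite (q : ℂ) (A b : ℕ → ℂ) (i : ℕ) : Bool → ℂ
  | false => 1 - q * b i
  | true => 1 - A i

/-- Transfer matrix for raising the lower row. -/
def lowerBond (q : ℂ) (A b : ℕ → ℂ) (i : ℕ) (e e' : Bool) : ℂ :=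
  lowerSite q A b i e * if e = true ∧ e' = false then 1 - q * (b i * A (i + 1)) else 1

/-- The compatibility of the Pieri rule with branching. Added together, the two identities give both
lower sums the same coefficient 1 + s, the new factor of the Pieri product when s = u / z_n. The
first identity alone is what the q-shift of a variable needs. -/
theorem chainState_upper_eq (q s : ℂ) (A b : ℕ → ℂ) (n : ℕ) :
    chainState s (upperBond q A b) (n + 1) false =
      chainState s (lowerBond q A b) n false * lowerSite q A b (n + 1) false +
        (1 - q * b (n + 1)) *
          (chainState s (lowerBond q A b) n true * lowerSite q A b (n + 1) true) ∧
    chainState s (upperBond q A b) (n + 1) true =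
      s * (chainState s (lowerBond q A b) n false * lowerSite q A b (n + 1) false) +
        (s + q * b (n + 1)) *
          (chainState s (lowerBond q A b) n true * lowerSite q A b (n + 1) true) := by
  induction n with
  | zero => simp [chainState, upperBond, lowerSite]; constructor <;> ring
  | succ n ih =>
    rw [chainState_succ _ _ (n + 1), chainState_succ _ _ (n + 1), ih.1, ih.2,
      chainState_succ _ _ n, chainState_succ _ _ n]
    simp only [upperBond, lowerBond, lowerSite, Bool.false_eq_true, reduceCtorEq, and_true,
      and_false, and_self, if_true, if_false]
    constructor <;> ring

/-- At s = -1 the two states are opposite and the transfer matrix reduces to multiplication by A(1 -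
qb). This value encodes the scaling of the last variable by q. -/
theorem chainState_upper_neg_one (q : ℂ) (A b : ℕ → ℂ) (n : ℕ) :
    chainState (-1) (upperBond q A b) n false = ∏ i ∈ Icc 1 n, (A i * (1 - q * b i)) ∧
    chainState (-1) (upperBond q A b) n true = -∏ i ∈ Icc 1 n, (A i * (1 - q * b i)) := by
  induction n with
  | zero => simp [chainState]
  | succ n ih =>
    rw [chainState, chainState, ih.1, ih.2, prod_Icc_succ_top (by omega)]
    simp only [upperBond, Bool.false_eq_true, if_true, if_false]
    constructor <;> ring

/-- The contribution of one bond to a skew `q`-Whittaker function. -/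
def bond (q : ℂ) (x y m : ℤ) : ℂ := qPoch q q (x - y) * qInv q (x - m) * qInv q (m - y)

/-- The common factor of the neighbouring bonds in the Pieri relations. -/
def bondPref (q : ℂ) (x y m : ℤ) : ℂ := qPoch q q (x - y) * qInv q (x - m) * qInv q (m - y + 1)

section bonds
variable {q : ℂ} (hq0 : q ≠ 0) (hq : ‖q‖ < 1)
include hq0 hq

theorem bond_eq_pref (x y m : ℤ) : bond q x y m = bondPref q x y m * (1 - q * q ^ (m - y)) := by
  rw [bond, bondPref, qInv_eq_mul hq0 hq (m - y), zpow_add_one₀ hq0]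
  ring

/-- The factor 1 - q^(x-y), supplied later by the Pieri coefficient, covers x = y. There the right
side is a multiple of 1/(q;q)_{y-1-m} · 1/(q;q)_{m-y}, and one of the two indices is negative. -/
theorem bond_sub_one_left {x y : ℤ} (hxy : y ≤ x) (m : ℤ) :
    (1 - q ^ (x - y)) * bond q (x - 1) y m =
      bondPref q x y m * ((1 - q ^ (x - m)) * (1 - q * q ^ (m - y))) := by
  have h1 : qInv q (x - 1 - m) = (1 - q ^ (x - m)) * qInv q (x - m) := by
    rw [qInv_eq_mul hq0 hq, show x - 1 - m + 1 = x - m by ring]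
  have h2 : qInv q (m - y) = (1 - q * q ^ (m - y)) * qInv q (m - y + 1) := by
    rw [qInv_eq_mul hq0 hq, zpow_add_one₀ hq0, mul_comm q]
  rcases hxy.eq_or_lt with rfl | hlt
  · have h3 : qInv q (y - 1 - m) * qInv q (m - y) = 0 := by
      rcases lt_or_ge (m - y) 0 with h | h
      · rw [qInv_of_neg hq0 hq h, mul_zero]
      · rw [qInv_of_neg hq0 hq (show y - 1 - m < 0 by omega), zero_mul]
    rw [h1, h2] at h3
    simp only [sub_self, zpow_zero, zero_mul, bondPref]
    linear_combination -(qPoch q q 0) * h3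
  · have h3 : qPoch q q (x - y) = (1 - q ^ (x - y)) * qPoch q q (x - 1 - y) := by
      have := qPoch_succ hq0 hq (n := x - 1 - y) (by omega)
      rwa [show x - 1 - y + 1 = x - y by ring] at this
    rw [bond, bondPref, h1, h2, h3]
    ring

theorem bond_sub_one_right {x y : ℤ} (hxy : y ≤ x) (m : ℤ) :
    bond q x (y - 1) m = bondPref q x y m * (1 - q * (q ^ (x - m) * q ^ (m - y))) := by
  have h := qPoch_succ hq0 hq (n := x - y) (by omega)
  rw [← zpow_add₀ hq0, show x - m + (m - y) = x - y by ring, bond, bondPref,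
    show x - (y - 1) = x - y + 1 by ring, show m - (y - 1) = m - y + 1 by ring, h,
    zpow_add_one₀ hq0]
  ring

theorem bond_sub_one_both (x y m : ℤ) :
    bond q (x - 1) (y - 1) m = bondPref q x y m * (1 - q ^ (x - m)) := by
  have h1 : qInv q (x - 1 - m) = (1 - q ^ (x - m)) * qInv q (x - m) := by
    rw [qInv_eq_mul hq0 hq, show x - 1 - m + 1 = x - m by ring]
  rw [bond, bondPref, h1, show x - 1 - (y - 1) = x - y by ring,
    show m - (y - 1) = m - y + 1 by ring]
  ring

/-- A bond depends only on differences, so raising the middle entry equals lowering both ends. -/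
theorem bond_add_one (x y m : ℤ) :
    bond q x y (m + 1) = bondPref q x y m * (1 - q ^ (x - m)) := by
  rw [← bond_sub_one_both hq0 hq, bond, bond, show x - 1 - (y - 1) = x - y by ring,
    show x - (m + 1) = x - 1 - m by ring, show m + 1 - y = m - (y - 1) by ring]

theorem bond_ne_zero {x y m : ℤ} (h : bond q x y m ≠ 0) : y ≤ m ∧ m ≤ x := by
  constructor
  · by_contra hc
    exact h (by rw [bond, qInv_of_neg hq0 hq (show m - y < 0 by omega), mul_zero])
  · by_contra hc
    exact h (by rw [bond, qInv_of_neg hq0 hq (show x - m < 0 by omega), mul_zero, zero_mul])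

end bonds

/-- The indicator row of a set of indices. -/
def ind (S : Finset ℕ) (i : ℕ) : ℤ := if i ∈ S then 1 else 0

/-- A row vanishes outside `1, …, n`. -/
def RowSupp (n : ℕ) (s : ℕ → ℤ) : Prop := ∀ i, ¬ (1 ≤ i ∧ i ≤ n) → s i = 0

/-- The size of a row of length `n`. -/
def rowSum (n : ℕ) (s : ℕ → ℤ) : ℤ := ∑ i ∈ Icc 1 n, s i

theorem rowSum_ind {n : ℕ} {S : Finset ℕ} (hS : S ∈ (Icc 1 n).powerset) :
    rowSum n (ind S) = #S := by
  unfold rowSum ind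
  rw [sum_ite_mem, inter_eq_right.mpr (mem_powerset.mp hS)]
  simp

theorem rowSum_sub (n : ℕ) (s t : ℕ → ℤ) : rowSum n (s - t) = rowSum n s - rowSum n t := by
  simp [rowSum]

theorem rowSum_add (n : ℕ) (s t : ℕ → ℤ) : rowSum n (s + t) = rowSum n s + rowSum n t := by
  simp [rowSum, sum_add_distrib]

theorem rowSupp_ind {n : ℕ} {S : Finset ℕ} (hS : S ∈ (Icc 1 n).powerset) : RowSupp n (ind S) := by
  intro i hi
  rw [ind, if_neg]
  exact fun h => hi (mem_Icc.mp (mem_powerset.mp hS h))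

theorem rowSupp_add_ind {n : ℕ} {S : Finset ℕ} (hS : S ∈ (Icc 1 n).powerset) (s : ℕ → ℤ) :
    RowSupp n (s + ind S) ↔ RowSupp n s := by
  have h := rowSupp_ind hS
  constructor <;> intro h' i hi
  · simpa [h i hi] using h' i hi
  · simp [h i hi, h' i hi]

theorem skewP_eq (q : ℂ) (n : ℕ) (lam mu : ℕ → ℤ) {a : ℂ} (ha : a ≠ 0) :
    skewP q n lam mu a = a ^ (rowSum n lam - rowSum (n - 1) mu) *
      ∏ i ∈ Icc 1 (n - 1), bond q (lam i) (lam (i + 1)) (mu i) := by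
  have h : ∀ (s : Finset ℕ) (f : ℕ → ℤ), ∏ i ∈ s, a ^ f i = a ^ ∑ i ∈ s, f i := by
    intro s f
    classical
    induction s using Finset.induction_on with
    | empty => simp
    | insert i s hi ih => rw [prod_insert hi, sum_insert hi, ih, zpow_add₀ ha]
  have h2 : ∀ i, a ^ (-mu i) * qPoch q q (lam i - lam (i + 1)) /
        (qPoch q q (lam i - mu i) * qPoch q q (mu i - lam (i + 1))) =
      a ^ (-mu i) * bond q (lam i) (lam (i + 1)) (mu i) := by
    intro i
    rw [bond, qInv, qInv, div_eq_mul_inv, mul_inv]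
    ring
  unfold skewP rowSum
  simp only [h2]
  rw [prod_mul_distrib, h, h, sub_eq_add_neg, ← sum_neg_distrib, zpow_add₀ ha]
  ring

/-- The branching coefficient, as a function of lower rows supported in `1, …, n`. -/
def branch (q : ℂ) (n : ℕ) (lam mu : ℕ → ℤ) (a : ℂ) : ℂ :=
  open Classical in if RowSupp n mu then skewP q (n + 1) lam mu a else 0

/-- The `q`-Whittaker function in `n` variables `z 0, …, z (n - 1)`, by branching. -/
def pw (q : ℂ) : ℕ → (ℕ → ℤ) → (ℕ → ℂ) → ℂ
  | 0, _, _ => 1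
  | n + 1, lam, z => ∑ᶠ mu : ℕ → ℤ, branch q n lam mu (z n) * pw q n mu z

/-- Extension of a finite row to a row indexed from `1`. -/
def extRow {n : ℕ} (r : Fin n → ℤ) (i : ℕ) : ℤ :=
  if h : 1 ≤ i ∧ i ≤ n then r ⟨i - 1, by omega⟩ else 0

/-- The rows interlacing with `lam`. -/
def rowBox (n : ℕ) (lam : ℕ → ℤ) : Finset (ℕ → ℤ) :=
  open Classical in
  (Fintype.piFinset fun i : Fin n => Icc (lam (i + 2)) (lam (i + 1))).image extRow

theorem mem_rowBox {n : ℕ} {lam mu : ℕ → ℤ} : mu ∈ rowBox n lam ↔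
    RowSupp n mu ∧ ∀ i, 1 ≤ i → i ≤ n → lam (i + 1) ≤ mu i ∧ mu i ≤ lam i := by
  classical
  simp only [rowBox, mem_image, Fintype.mem_piFinset, mem_Icc]
  constructor
  · rintro ⟨r, hr, rfl⟩
    refine ⟨fun i hi => by simp [extRow, hi], fun i h1 h2 => ?_⟩
    have := hr ⟨i - 1, by omega⟩
    simp only [extRow, h1, h2, and_self, dif_pos]
    simpa only [show i - 1 + 2 = i + 1 by omega, show i - 1 + 1 = i by omega] using this
  · rintro ⟨h0, h⟩
    refine ⟨fun i => mu (i + 1), fun i => h (i + 1) (by omega) (by omega), ?_⟩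
    funext i
    by_cases hi : 1 ≤ i ∧ i ≤ n
    · simp only [extRow, hi, and_self, dif_pos]
      congr 1
      omega
    · simp [extRow, hi, h0 i hi]

end QWhittaker
end
-- Branching coefficients of shifted rows as transfer-matrix weights.
noncomputable section
namespace QWhittaker
open Finset

/-- The coefficients `∏ (1 - q^{μ_i - μ_{i+1}})` over `i ∈ S`, `i + 1 ∉ S`, of the Pieri rule. -/
def psi (q : ℂ) (n : ℕ) (S : Finset ℕ) (mu : ℕ → ℤ) : ℂ :=
  ∏ i ∈ Icc 1 (n - 1), if i ∈ S ∧ i + 1 ∉ S then 1 - q ^ (mu i - mu (i + 1)) else 1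

/-- The common factor of the branching coefficients in the Pieri relations. -/
def branchPref (q : ℂ) (n : ℕ) (lam mu : ℕ → ℤ) (a : ℂ) : ℂ :=
  open Classical in if RowSupp n mu then
    a ^ (rowSum (n + 1) lam - rowSum n mu) *
      ∏ i ∈ Icc 1 n, bondPref q (lam i) (lam (i + 1)) (mu i) else 0

theorem IsSignature.succ_le {n : ℕ} {s : ℕ → ℤ} (h : IsSignature n s) {i : ℕ} (h1 : 1 ≤ i)
    (h2 : i + 1 ≤ n) : s (i + 1) ≤ s i := h i (i + 1) h1 (by omega) h2

theorem isSignature_of_succ_le {n : ℕ} {s : ℕ → ℤ}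
    (h : ∀ i, 1 ≤ i → i + 1 ≤ n → s (i + 1) ≤ s i) : IsSignature n s := by
  intro i j hi hij
  induction j, hij using Nat.le_induction with
  | base => exact fun _ => le_rfl
  | succ j hj ih => exact fun hn => (h j (by omega) hn).trans (ih (by omega))

theorem IsSignature.of_mem_rowBox {n : ℕ} {lam mu : ℕ → ℤ} (h : mu ∈ rowBox n lam) :
    IsSignature n mu := by
  obtain ⟨-, h⟩ := mem_rowBox.mp h
  exact isSignature_of_succ_le fun i h1 h2 =>
    (h (i + 1) (by omega) h2).2.trans (h i h1 (by omega)).1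

section pieri
variable {q : ℂ} (hq0 : q ≠ 0) (hq : ‖q‖ < 1)
include hq0 hq

theorem mem_rowBox_of_branch_ne_zero {n : ℕ} {lam mu : ℕ → ℤ} {a : ℂ} (ha : a ≠ 0)
    (h : branch q n lam mu a ≠ 0) : mu ∈ rowBox n lam := by
  unfold branch at h
  split_ifs at h with hs
  · rw [skewP_eq q _ _ _ ha] at h
    refine mem_rowBox.mpr ⟨hs, fun i h1 h2 => bond_ne_zero hq0 hq ?_⟩
    exact prod_ne_zero_iff.mp (right_ne_zero_of_mul h) i (mem_Icc.mpr ⟨h1, h2⟩)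
  · exact absurd rfl h

theorem finite_support_branch_mul (n : ℕ) (lam : ℕ → ℤ) {a : ℂ} (ha : a ≠ 0)
    (f : (ℕ → ℤ) → ℂ) : (Function.support fun mu => branch q n lam mu a * f mu).Finite :=
  (rowBox n lam).finite_toSet.subset fun _ h =>
    mem_rowBox_of_branch_ne_zero hq0 hq ha (left_ne_zero_of_mul h)

theorem pw_succ_eq_sum (n : ℕ) (lam : ℕ → ℤ) (z : ℕ → ℂ) (hz : z n ≠ 0) :
    pw q (n + 1) lam z = ∑ mu ∈ rowBox n lam, branch q n lam mu (z n) * pw q n mu z :=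
  finsum_eq_sum_of_support_subset _ fun _ h =>
    mem_rowBox_of_branch_ne_zero hq0 hq hz (left_ne_zero_of_mul h)

/-- The substitution μ ↦ μ + 1_S for each S separately; supports are finite, so all exchanges are
legitimate. -/
theorem sum_branch_shift (n : ℕ) (lam : ℕ → ℤ) {a : ℂ} (ha : a ≠ 0) (T : Finset (Finset ℕ))
    (d : Finset ℕ → (ℕ → ℤ) → ℂ) (f : (ℕ → ℤ) → ℂ) :
    ∑ᶠ mu, branch q n lam mu a * ∑ S ∈ T, d S mu * f (mu - ind S) =
      ∑ᶠ mu, (∑ S ∈ T, d S (mu + ind S) * branch q n lam (mu + ind S) a) * f mu := by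
  have h1 : ∀ S ∈ T, (Function.support fun mu =>
      branch q n lam mu a * (d S mu * f (mu - ind S))).Finite :=
    fun S _ => finite_support_branch_mul hq0 hq n lam ha _
  have h2 : ∀ S ∈ T, (Function.support fun mu =>
      d S (mu + ind S) * branch q n lam (mu + ind S) a * f mu).Finite := by
    intro S hS
    have h := (h1 S hS).preimage (f := fun mu : ℕ → ℤ => mu + ind S)
      (add_left_injective _).injOn
    refine h.subset fun mu hmu => ?_
    simp only [Set.mem_preimage, Function.mem_support, add_sub_cancel_right] at hmu ⊢
    convert hmu using 1
    ring
  simp only [mul_sum, sum_mul]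
  rw [finsum_sum_comm _ _ h1, finsum_sum_comm _ _ h2]
  refine sum_congr rfl fun S _ => ?_
  rw [← finsum_comp_equiv (Equiv.addRight (ind S))]
  refine finsum_congr fun mu => ?_
  simp only [Equiv.coe_addRight, add_sub_cancel_right]
  ring

/-- Bond i feels only whether i and i + 1 lie in S, so the product is a transfer-matrix weight. The
Pieri factor occurs exactly in the case i ∈ S, i + 1 ∉ S, where `bond_sub_one_left` requires it. The
degree drops by #S, which turns u into u / a. -/
theorem psi_mul_branch_sub (n : ℕ) {lam : ℕ → ℤ} (hlam : IsSignature (n + 1) lam) (mu : ℕ → ℤ)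
    {a : ℂ} (ha : a ≠ 0) (u : ℂ) {S : Finset ℕ} (hS : S ∈ (Icc 1 (n + 1)).powerset) :
    u ^ #S * psi q (n + 1) S lam * branch q n (lam - ind S) mu a =
      branchPref q n lam mu a * chainWeight (u / a)
        (upperBond q (fun i => q ^ (lam i - mu i)) (fun i => q ^ (mu i - lam (i + 1)))) n S := by
  unfold branch branchPref
  split_ifs with h
  swap
  · simp
  rw [skewP_eq q _ _ _ ha, rowSum_sub, rowSum_ind hS, chainWeight, psi]
  simp only [Nat.add_sub_cancel]
  have hprod : (∏ i ∈ Icc 1 n, if i ∈ S ∧ i + 1 ∉ S then 1 - q ^ (lam i - lam (i + 1)) else 1) *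
      (∏ i ∈ Icc 1 n, bond q ((lam - ind S) i) ((lam - ind S) (i + 1)) (mu i)) =
      (∏ i ∈ Icc 1 n, bondPref q (lam i) (lam (i + 1)) (mu i)) *
      ∏ i ∈ Icc 1 n, upperBond q (fun i => q ^ (lam i - mu i)) (fun i => q ^ (mu i - lam (i + 1)))
        i (decide (i ∈ S)) (decide (i + 1 ∈ S)) := by
    rw [← prod_mul_distrib, ← prod_mul_distrib]
    refine prod_congr rfl fun i hi => ?_
    have hi' := mem_Icc.mp hi
    have hle := hlam.succ_le hi'.1 (by omega)
    by_cases h1 : i ∈ S <;> by_cases h2 : i + 1 ∈ S <;>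
      simp only [Pi.sub_apply, ind, h1, h2, not_true_eq_false, not_false_eq_true, and_true,
        and_false, if_true, if_false, sub_zero, one_mul, decide_true, decide_false, upperBond]
    · exact bond_sub_one_both hq0 hq _ _ _
    · exact bond_sub_one_left hq0 hq hle _
    · exact bond_sub_one_right hq0 hq hle _
    · exact bond_eq_pref hq0 hq _ _ _
  have hpow : u ^ #S * a ^ (rowSum (n + 1) lam - #S - rowSum n mu) =
      a ^ (rowSum (n + 1) lam - rowSum n mu) * (u / a) ^ #S := by
    rw [show rowSum (n + 1) lam - #S - rowSum n mu = rowSum (n + 1) lam - rowSum n mu - #S by ring,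
      zpow_sub₀ ha _ (#S : ℤ), zpow_natCast, div_pow]
    ring
  linear_combination
    (∏ i ∈ Icc 1 n, bond q ((lam - ind S) i) ((lam - ind S) (i + 1)) (mu i)) *
      (∏ i ∈ Icc 1 n, if i ∈ S ∧ i + 1 ∉ S then 1 - q ^ (lam i - lam (i + 1)) else 1) * hpow +
      a ^ (rowSum (n + 1) lam - rowSum n mu) * (u / a) ^ #S * hprod

/-- Here a bond feels only whether i ∈ S, and the coupling of i with i + 1 comes from the Pieri
coefficient of the raised row: its exponent 1 + μ_i - μ_{i+1} is split at λ_{i+1}. The site n + 1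
carries no coupling, hence the separate last factor. -/
theorem psi_mul_branch_add (n : ℕ) (lam mu : ℕ → ℤ)
    {a : ℂ} (ha : a ≠ 0) (u : ℂ) {S : Finset ℕ} (hS : S ∈ (Icc 1 (n + 1)).powerset) :
    u ^ #S * psi q (n + 1) S (mu + ind S) * branch q (n + 1) lam (mu + ind S) a =
      branchPref q (n + 1) lam mu a * (chainWeight (u / a)
        (lowerBond q (fun i => q ^ (lam i - mu i)) (fun i => q ^ (mu i - lam (i + 1)))) n S *
        lowerSite q (fun i => q ^ (lam i - mu i)) (fun i => q ^ (mu i - lam (i + 1))) (n + 1)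
          (decide (n + 1 ∈ S))) := by
  unfold branch branchPref
  by_cases h : RowSupp (n + 1) mu
  swap
  · rw [if_neg h, if_neg (mt (rowSupp_add_ind hS mu).mp h), mul_zero, zero_mul]
  rw [if_pos h, if_pos ((rowSupp_add_ind hS mu).mpr h)]
  rw [skewP_eq q _ _ _ ha, show n + 1 + 1 - 1 = n + 1 from rfl, rowSum_add, rowSum_ind hS,
    chainWeight, psi, show n + 1 - 1 = n from rfl]
  have hsite : ∏ i ∈ Icc 1 (n + 1), bond q (lam i) (lam (i + 1)) ((mu + ind S) i) =
      (∏ i ∈ Icc 1 (n + 1), bondPref q (lam i) (lam (i + 1)) (mu i)) *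
      ∏ i ∈ Icc 1 (n + 1), lowerSite q (fun i => q ^ (lam i - mu i))
        (fun i => q ^ (mu i - lam (i + 1))) i (decide (i ∈ S)) := by
    rw [← prod_mul_distrib]
    refine prod_congr rfl fun i _ => ?_
    by_cases h1 : i ∈ S <;>
      simp only [Pi.add_apply, ind, h1, if_true, if_false, add_zero, decide_true, decide_false,
        lowerSite]
    · exact bond_add_one hq0 hq _ _ _
    · exact bond_eq_pref hq0 hq _ _ _
  have hpsi : ∏ i ∈ Icc 1 n, lowerBond q (fun i => q ^ (lam i - mu i))
        (fun i => q ^ (mu i - lam (i + 1))) i (decide (i ∈ S)) (decide (i + 1 ∈ S)) =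
      (∏ i ∈ Icc 1 n, lowerSite q (fun i => q ^ (lam i - mu i))
        (fun i => q ^ (mu i - lam (i + 1))) i (decide (i ∈ S))) *
      ∏ i ∈ Icc 1 n, if i ∈ S ∧ i + 1 ∉ S then
        1 - q ^ ((mu + ind S) i - (mu + ind S) (i + 1)) else 1 := by
    rw [← prod_mul_distrib]
    refine prod_congr rfl fun i _ => ?_
    by_cases h1 : i ∈ S <;> by_cases h2 : i + 1 ∈ S <;>
      simp only [Pi.add_apply, ind, h1, h2, not_true_eq_false, not_false_eq_true, and_true,
        and_false, if_true, if_false, add_zero, decide_true, decide_false, lowerBond,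
        mul_one, and_self, Bool.false_eq_true, Bool.true_eq_false]
    rw [← zpow_add₀ hq0, ← zpow_one_add₀ hq0]
    ring_nf
  have hpow : u ^ #S * a ^ (rowSum (n + 1 + 1) lam - (rowSum (n + 1) mu + #S)) =
      a ^ (rowSum (n + 1 + 1) lam - rowSum (n + 1) mu) * (u / a) ^ #S := by
    rw [← sub_sub, zpow_sub₀ ha _ (#S : ℤ), zpow_natCast, div_pow]
    ring
  rw [hsite, hpsi, prod_Icc_succ_top (by omega) (fun i => lowerSite q _ _ i _)]
  linear_combination (∏ i ∈ Icc 1 (n + 1), bondPref q (lam i) (lam (i + 1)) (mu i)) *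
    ((∏ i ∈ Icc 1 n, lowerSite q (fun i => q ^ (lam i - mu i))
        (fun i => q ^ (mu i - lam (i + 1))) i (decide (i ∈ S))) * lowerSite q
        (fun i => q ^ (lam i - mu i)) (fun i => q ^ (mu i - lam (i + 1))) (n + 1)
          (decide (n + 1 ∈ S))) *
      (∏ i ∈ Icc 1 n, if i ∈ S ∧ i + 1 ∉ S then
        1 - q ^ ((mu + ind S) i - (mu + ind S) (i + 1)) else 1) * hpow

end pieri
end QWhittaker
end
-- The Pieri rule for all elementary symmetric functions of the inverse variables.
noncomputable section
namespace QWhittaker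
open Finset

theorem mem_powerset_Icc_succ {n : ℕ} {S : Finset ℕ} (hS : S ∈ (Icc 1 n).powerset) :
    S ∈ (Icc 1 (n + 1)).powerset :=
  mem_powerset.mpr ((mem_powerset.mp hS).trans (Icc_subset_Icc_right (by omega)))

theorem insert_mem_powerset_Icc_succ {n : ℕ} {S : Finset ℕ} (hS : S ∈ (Icc 1 n).powerset) :
    insert (n + 1) S ∈ (Icc 1 (n + 1)).powerset :=
  mem_powerset.mpr (insert_subset (by simp) (mem_powerset.mp (mem_powerset_Icc_succ hS)))

theorem pw_congr_vars (q : ℂ) (n : ℕ) (lam : ℕ → ℤ) {z w : ℕ → ℂ} (h : ∀ j < n, z j = w j) :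
    pw q n lam z = pw q n lam w := by
  induction n generalizing lam with
  | zero => rfl
  | succ n ih =>
    unfold pw
    refine finsum_congr fun mu => ?_
    rw [h n (by omega), ih mu fun j hj => h j (by omega)]

section pieri
variable {q : ℂ} (hq0 : q ≠ 0) (hq : ‖q‖ < 1)

/-- `q^{λ_i - μ_i}`. -/
def expA (q : ℂ) (lam mu : ℕ → ℤ) (i : ℕ) : ℂ := q ^ (lam i - mu i)

/-- `q^{μ_i - λ_{i+1}}`. -/
def expB (q : ℂ) (lam mu : ℕ → ℤ) (i : ℕ) : ℂ := q ^ (mu i - lam (i + 1))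

/-- The two partial sums over lowerings of the upper row. -/
def upState (q : ℂ) (lam mu : ℕ → ℤ) (s : ℂ) (n : ℕ) (e : Bool) : ℂ :=
  chainState s (upperBond q (expA q lam mu) (expB q lam mu)) n e

/-- The two partial sums over raisings of the lower row. -/
def lowState (q : ℂ) (lam mu : ℕ → ℤ) (s : ℂ) (n : ℕ) (e : Bool) : ℂ :=
  chainState s (lowerBond q (expA q lam mu) (expB q lam mu)) n e *
    lowerSite q (expA q lam mu) (expB q lam mu) (n + 1) e

include hq0 hq

theorem sum_upper_false (n : ℕ) {lam : ℕ → ℤ} (hlam : IsSignature (n + 1) lam) (mu : ℕ → ℤ)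
    {a : ℂ} (ha : a ≠ 0) (u : ℂ) :
    ∑ S ∈ (Icc 1 n).powerset, u ^ #S * psi q (n + 1) S lam * branch q n (lam - ind S) mu a =
      branchPref q n lam mu a * upState q lam mu (u / a) n false := by
  rw [upState, ← (sum_chainWeight _ _ n).1, mul_sum]
  exact sum_congr rfl fun S hS =>
    psi_mul_branch_sub hq0 hq n hlam mu ha u (mem_powerset_Icc_succ hS)

theorem sum_upper (n : ℕ) {lam : ℕ → ℤ} (hlam : IsSignature (n + 1) lam) (mu : ℕ → ℤ)
    {a : ℂ} (ha : a ≠ 0) (u : ℂ) :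
    ∑ S ∈ (Icc 1 (n + 1)).powerset,
        u ^ #S * psi q (n + 1) S lam * branch q n (lam - ind S) mu a =
      branchPref q n lam mu a *
        (upState q lam mu (u / a) n false + upState q lam mu (u / a) n true) := by
  rw [sum_powerset_Icc_succ, sum_upper_false hq0 hq n hlam mu ha, mul_add]
  congr 1
  rw [upState, ← (sum_chainWeight _ _ n).2, mul_sum]
  exact sum_congr rfl fun S hS =>
    psi_mul_branch_sub hq0 hq n hlam mu ha u (insert_mem_powerset_Icc_succ hS)

theorem sum_lower_false (n : ℕ) (lam mu : ℕ → ℤ) {a : ℂ} (ha : a ≠ 0) (u : ℂ) :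
    ∑ S ∈ (Icc 1 n).powerset,
        u ^ #S * psi q (n + 1) S (mu + ind S) * branch q (n + 1) lam (mu + ind S) a =
      branchPref q (n + 1) lam mu a * lowState q lam mu (u / a) n false := by
  rw [lowState, ← (sum_chainWeight _ _ n).1, sum_mul, mul_sum]
  refine sum_congr rfl fun S hS => ?_
  rw [psi_mul_branch_add hq0 hq n lam mu ha u (mem_powerset_Icc_succ hS)]
  simp only [notMem_of_mem_powerset_Icc (show n < n + 1 by omega) hS, decide_false]
  rfl

theorem sum_lower_true (n : ℕ) (lam mu : ℕ → ℤ) {a : ℂ} (ha : a ≠ 0) (u : ℂ) :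
    ∑ S ∈ (Icc 1 n).powerset, u ^ #(insert (n + 1) S) *
        psi q (n + 1) (insert (n + 1) S) (mu + ind (insert (n + 1) S)) *
        branch q (n + 1) lam (mu + ind (insert (n + 1) S)) a =
      branchPref q (n + 1) lam mu a * lowState q lam mu (u / a) n true := by
  rw [lowState, ← (sum_chainWeight _ _ n).2, sum_mul, mul_sum]
  refine sum_congr rfl fun S hS => ?_
  rw [psi_mul_branch_add hq0 hq n lam mu ha u (insert_mem_powerset_Icc_succ hS)]
  simp only [mem_insert_self, decide_true]
  rfl

omit hq0 hq in
theorem upState_succ (lam mu : ℕ → ℤ) (s : ℂ) (n : ℕ) :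
    upState q lam mu s (n + 1) false =
      lowState q lam mu s n false + (1 - q * expB q lam mu (n + 1)) * lowState q lam mu s n true ∧
    upState q lam mu s (n + 1) true =
      s * lowState q lam mu s n false +
        (s + q * expB q lam mu (n + 1)) * lowState q lam mu s n true :=
  chainState_upper_eq q s _ _ n

/-- Branching a sum over lowered top rows. -/
theorem sum_pw_sub (n : ℕ) (lam : ℕ → ℤ) (z : ℕ → ℂ) (hz : z n ≠ 0) (T : Finset (Finset ℕ))
    (d : Finset ℕ → ℂ) :
    ∑ S ∈ T, d S * pw q (n + 1) (lam - ind S) z =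
      ∑ᶠ mu, (∑ S ∈ T, d S * branch q n (lam - ind S) mu (z n)) * pw q n mu z := by
  have h : ∀ S ∈ T, (Function.support fun mu =>
      d S * (branch q n (lam - ind S) mu (z n) * pw q n mu z)).Finite := fun S _ =>
    (finite_support_branch_mul hq0 hq n (lam - ind S) hz (fun mu => pw q n mu z)).subset
      (Function.support_const_smul_subset (d S) _)
  simp only [sum_mul, mul_assoc]
  rw [finsum_sum_comm _ _ h]
  exact sum_congr rfl fun S _ => by rw [pw, mul_finsum]

/-- Induction on the number of variables. After branching off the last one, both sides are
combinations of functions of the lower row, and coefficients agree because the two lines of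
`upState_succ` add up to 1 + u / z_n times the sum of the lower states. -/
theorem pw_pieri (n : ℕ) {lam : ℕ → ℤ} (hlam : IsSignature n lam) {z : ℕ → ℂ}
    (hz : ∀ j, z j ≠ 0) (u : ℂ) :
    (∏ j ∈ range n, (1 + u / z j)) * pw q n lam z =
      ∑ S ∈ (Icc 1 n).powerset, u ^ #S * psi q n S lam * pw q n (lam - ind S) z := by
  induction n generalizing lam with
  | zero => simp [pw, psi]
  | succ n ih =>
    rw [sum_pw_sub hq0 hq n lam z (hz n)]
    simp only [sum_upper hq0 hq n hlam _ (hz n)]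
    have h1 : (∏ j ∈ range (n + 1), (1 + u / z j)) * pw q (n + 1) lam z =
        (1 + u / z n) * ∑ᶠ mu, branch q n lam mu (z n) *
          ∑ S ∈ (Icc 1 n).powerset, u ^ #S * psi q n S mu * pw q n (mu - ind S) z := by
      rw [prod_range_succ, pw, mul_comm (∏ j ∈ range n, _), mul_assoc, mul_finsum]
      congr 1
      refine finsum_congr fun mu => ?_
      by_cases hb : branch q n lam mu (z n) = 0
      · simp [hb]
      · rw [← ih (IsSignature.of_mem_rowBox (mem_rowBox_of_branch_ne_zero hq0 hq (hz n) hb))]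
        ring
    rw [h1, sum_branch_shift hq0 hq n lam (hz n) _ (fun S mu => u ^ #S * psi q n S mu)
      (fun mu => pw q n mu z), mul_finsum]
    refine finsum_congr fun mu => ?_
    rw [← mul_assoc]
    congr 1
    -- With an empty lower row only S = ∅ occurs below, and the identity is checked directly.
    rcases n with _ | n
    · simp only [upState, chainState]
      by_cases hm : RowSupp 0 mu
      · have h0 : ind ∅ = 0 := by funext i; simp [ind]
        simp [psi, h0, branch, branchPref, hm, skewP_eq q _ _ _ (hz 0)]
        ring
      · have h0 : ind ∅ = 0 := by funext i; simp [ind]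
        simp [psi, h0, branch, branchPref, hm]
    · rw [sum_powerset_Icc_succ, sum_lower_false hq0 hq n lam mu (hz _),
        sum_lower_true hq0 hq n lam mu (hz _), (upState_succ lam mu _ n).1,
        (upState_succ lam mu _ n).2]
      ring

end pieri
end QWhittaker
end
-- The effect of scaling one variable by q.
noncomputable section
namespace QWhittaker
open Finset

section shift
variable {q : ℂ} (hq0 : q ≠ 0) (hq : ‖q‖ < 1)
include hq0 hq

theorem finite_support_branch_shift (n : ℕ) (lam : ℕ → ℤ) {a : ℂ} (ha : a ≠ 0)
    (T : Finset (Finset ℕ)) (d : Finset ℕ → (ℕ → ℤ) → ℂ) (f : (ℕ → ℤ) → ℂ) :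
    (Function.support fun mu =>
      (∑ S ∈ T, d S (mu + ind S) * branch q n lam (mu + ind S) a) * f mu).Finite := by
  have h : ∀ S ∈ T, ((fun mu : ℕ → ℤ => mu + ind S) ⁻¹' (rowBox n lam : Set (ℕ → ℤ))).Finite :=
    fun S _ => (rowBox n lam).finite_toSet.preimage (add_left_injective _).injOn
  refine (T.finite_toSet.biUnion h).subset fun mu hmu => ?_
  obtain ⟨S, hS, hne⟩ := exists_ne_zero_of_sum_ne_zero (left_ne_zero_of_mul hmu)
  exact Set.mem_biUnion hS (mem_rowBox_of_branch_ne_zero hq0 hq ha (right_ne_zero_of_mul hne))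

theorem finite_support_lowState (n : ℕ) (lam : ℕ → ℤ) {a : ℂ} (ha : a ≠ 0) (u : ℂ) (e : Bool)
    (f : (ℕ → ℤ) → ℂ) : (Function.support fun mu =>
      branchPref q (n + 1) lam mu a * lowState q lam mu (u / a) n e * f mu).Finite := by
  rcases e with _ | _
  · have := finite_support_branch_shift hq0 hq (n + 1) lam ha (Icc 1 n).powerset
      (fun S mu => u ^ #S * psi q (n + 1) S mu) f
    simpa only [sum_lower_false hq0 hq n lam _ ha] using this
  · have := finite_support_branch_shift hq0 hq (n + 1) lam ha
      ((Icc 1 n).powerset.image (insert (n + 1))) (fun S mu => u ^ #S * psi q (n + 1) S mu) f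
    have hinj : Set.InjOn (insert (n + 1) : Finset ℕ → Finset ℕ) (Icc 1 n).powerset := by
      intro S hS T hT h
      have h' := congrArg (fun U => U.erase (n + 1)) h
      simpa only [erase_insert (notMem_of_mem_powerset_Icc n.lt_succ_self hS),
        erase_insert (notMem_of_mem_powerset_Icc n.lt_succ_self hT)] using h'
    simpa only [sum_image hinj, sum_lower_true hq0 hq n lam _ ha] using this

/-- The power of q gained is |λ| - |μ| = λ_{n+1} + ∑ (λ_i - μ_i), and the factors q^(λ_i - μ_i) are
those of the upper sum at s = -1. -/
theorem branch_scale (n : ℕ) (lam mu : ℕ → ℤ) {a : ℂ} (ha : a ≠ 0) :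
    branch q n lam mu (q * a) =
      q ^ lam (n + 1) * (branchPref q n lam mu a * upState q lam mu (-1) n false) := by
  rw [upState, (chainState_upper_neg_one q _ _ n).1]
  unfold branch branchPref
  split_ifs with h
  swap
  · simp
  rw [skewP_eq q _ _ _ (mul_ne_zero hq0 ha), show n + 1 - 1 = n from rfl,
    prod_congr rfl fun i _ => bond_eq_pref hq0 hq (lam i) (lam (i + 1)) (mu i),
    prod_mul_distrib, prod_mul_distrib, mul_zpow]
  have h1 : q ^ (rowSum (n + 1) lam - rowSum n mu) =
      q ^ lam (n + 1) * ∏ i ∈ Icc 1 n, expA q lam mu i := by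
    have : rowSum (n + 1) lam - rowSum n mu = lam (n + 1) + ∑ i ∈ Icc 1 n, (lam i - mu i) := by
      rw [rowSum, rowSum, sum_Icc_succ_top (by omega), sum_sub_distrib]
      ring
    have h2 : ∀ s : Finset ℕ, q ^ (∑ i ∈ s, (lam i - mu i)) = ∏ i ∈ s, expA q lam mu i := by
      intro s
      induction s using Finset.induction_on with
      | empty => simp
      | insert i s hi ih => rw [prod_insert hi, sum_insert hi, zpow_add₀ hq0, ih, expA]
    rw [this, zpow_add₀ hq0, h2]
  rw [h1]
  simp only [expB]
  ring

/-- Scaling one variable by `q`. -/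
theorem pw_update (n : ℕ) {lam : ℕ → ℤ} (hlam : IsSignature (n + 1) lam) {z : ℕ → ℂ}
    (hz : ∀ j, z j ≠ 0) {i : ℕ} (hi : i ≤ n) :
    pw q (n + 1) lam (Function.update z i (q * z i)) =
      q ^ lam (n + 1) * ∑ S ∈ (Icc 1 n).powerset,
        (-z i) ^ #S * psi q (n + 1) S lam * pw q (n + 1) (lam - ind S) z := by
  induction n generalizing lam with
  | zero =>
    obtain rfl : i = 0 := by omega
    rw [sum_pw_sub hq0 hq 0 lam z (hz 0)]
    simp only [sum_upper_false hq0 hq 0 hlam _ (hz 0)]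
    rw [pw, mul_finsum]
    refine finsum_congr fun mu => ?_
    rw [Function.update_self, branch_scale hq0 hq 0 lam mu (hz 0), neg_div, div_self (hz 0)]
    simp only [pw]
    ring
  | succ k ih =>
    rw [sum_pw_sub hq0 hq (k + 1) lam z (hz _)]
    simp only [sum_upper_false hq0 hq (k + 1) hlam _ (hz _)]
    rw [pw, mul_finsum]
    rcases hi.eq_or_lt with rfl | hlt
    · refine finsum_congr fun mu => ?_
      rw [Function.update_self, branch_scale hq0 hq _ lam mu (hz _), neg_div, div_self (hz _),
        pw_congr_vars q (k + 1) mu (w := z) fun j hj => Function.update_of_ne hj.ne _ _]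
      ring
    · have hne : z (k + 1) ≠ 0 := hz _
      set s : ℂ := -z i / z (k + 1)
      -- Since i ≤ k, the choice u = -z_i kills one factor of the Pieri product in the first k + 1
      -- variables.
      have hvan : ∀ mu : ℕ → ℤ, IsSignature (k + 1) mu → ∑ S ∈ (Icc 1 (k + 1)).powerset,
          (-z i) ^ #S * psi q (k + 1) S mu * pw q (k + 1) (mu - ind S) z = 0 := by
        intro mu hmu
        rw [← pw_pieri hq0 hq (k + 1) hmu hz, prod_eq_zero (mem_range.mpr hlt), zero_mul]
        rw [neg_div, div_self (hz i)]
        ring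
      have hsig : ∀ {mu : ℕ → ℤ}, branch q (k + 1) lam mu (z (k + 1)) ≠ 0 →
          IsSignature (k + 1) mu := fun hb =>
        IsSignature.of_mem_rowBox (mem_rowBox_of_branch_ne_zero hq0 hq hne hb)
      have hV1 : ∑ᶠ mu, (branchPref q (k + 1) lam mu (z (k + 1)) * lowState q lam mu s k false *
            pw q (k + 1) mu z +
          branchPref q (k + 1) lam mu (z (k + 1)) * lowState q lam mu s k true *
            pw q (k + 1) mu z) = 0 := by
        have h := sum_branch_shift hq0 hq (k + 1) lam hne (Icc 1 (k + 1)).powerset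
          (fun S mu => (-z i) ^ #S * psi q (k + 1) S mu) (fun mu => pw q (k + 1) mu z)
        rw [finsum_congr fun mu => ?_, finsum_zero] at h
        · rw [h]
          refine finsum_congr fun mu => ?_
          rw [sum_powerset_Icc_succ, sum_lower_false hq0 hq k lam mu hne,
            sum_lower_true hq0 hq k lam mu hne]
          ring
        · by_cases hb : branch q (k + 1) lam mu (z (k + 1)) = 0
          · rw [hb, zero_mul]
          · rw [hvan mu (hsig hb), mul_zero]
      -- The same vanishing sum with the extra weight q^(μ_{k+1}); sets containing k + 1 raise that
      -- entry and collect a further factor q.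
      have hV2 : ∑ᶠ mu : ℕ → ℤ, (branchPref q (k + 1) lam mu (z (k + 1)) *
            lowState q lam mu s k false * (q ^ mu (k + 1) * pw q (k + 1) mu z) +
          branchPref q (k + 1) lam mu (z (k + 1)) * lowState q lam mu s k true *
            (q * q ^ mu (k + 1) * pw q (k + 1) mu z)) = 0 := by
        have h := sum_branch_shift hq0 hq (k + 1) lam hne (Icc 1 (k + 1)).powerset
          (fun S mu => q ^ mu (k + 1) * ((-z i) ^ #S * psi q (k + 1) S mu))
          (fun mu => pw q (k + 1) mu z)
        rw [finsum_congr fun mu => ?_, finsum_zero] at h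
        · rw [h]
          refine finsum_congr fun mu => ?_
          rw [sum_powerset_Icc_succ, add_mul]
          congr 1
          · rw [← sum_lower_false hq0 hq k lam mu hne, sum_mul, sum_mul]
            refine sum_congr rfl fun S hS => ?_
            have : ind S (k + 1) = 0 := by
              simp [ind, notMem_of_mem_powerset_Icc (show k < k + 1 by omega) hS]
            rw [Pi.add_apply, this, add_zero]
            ring
          · rw [← sum_lower_true hq0 hq k lam mu hne, sum_mul, sum_mul]
            refine sum_congr rfl fun S hS => ?_
            have : ind (insert (k + 1) S) (k + 1) = 1 := by simp [ind]
            rw [Pi.add_apply, this, zpow_add_one₀ hq0]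
            ring
        · by_cases hb : branch q (k + 1) lam mu (z (k + 1)) = 0
          · rw [hb, zero_mul]
          · simp only [mul_assoc]
            rw [← mul_sum]
            simp only [← mul_assoc]
            rw [hvan mu (hsig hb), mul_zero]
      -- The induction hypothesis sums over subsets of 1, …, k, so only the state in which k + 1 is
      -- absent appears.
      have hL : ∑ᶠ mu : ℕ → ℤ, branch q (k + 1) lam mu
          (Function.update z i (q * z i) (k + 1)) * pw q (k + 1) mu
            (Function.update z i (q * z i)) =
          ∑ᶠ mu : ℕ → ℤ, branchPref q (k + 1) lam mu (z (k + 1)) *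
            lowState q lam mu s k false * (q ^ mu (k + 1) * pw q (k + 1) mu z) := by
        have h := sum_branch_shift hq0 hq (k + 1) lam hne (Icc 1 k).powerset
          (fun S mu => q ^ mu (k + 1) * ((-z i) ^ #S * psi q (k + 1) S mu))
          (fun mu => pw q (k + 1) mu z)
        rw [Function.update_of_ne (by omega)]
        refine Eq.trans ?_ (h.trans ?_)
        swap
        · refine finsum_congr fun mu => ?_
          rw [← sum_lower_false hq0 hq k lam mu hne, sum_mul, sum_mul]
          refine sum_congr rfl fun S hS => ?_
          have : ind S (k + 1) = 0 := by
            simp [ind, notMem_of_mem_powerset_Icc (show k < k + 1 by omega) hS]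
          rw [Pi.add_apply, this, add_zero]
          ring
        · refine finsum_congr fun mu => ?_
          by_cases hb : branch q (k + 1) lam mu (z (k + 1)) = 0
          · rw [hb, zero_mul, zero_mul]
          · rw [ih (hsig hb) (by omega), mul_sum]
            congr 1
            refine sum_congr rfl fun S _ => ?_
            ring
      have hfin := finite_support_lowState hq0 hq k lam hne (-z i)
      have hfin' : (Function.support fun mu => q ^ lam (k + 1 + 1) *
          (branchPref q (k + 1) lam mu (z (k + 1)) * lowState q lam mu s k false *
            pw q (k + 1) mu z +
          branchPref q (k + 1) lam mu (z (k + 1)) * lowState q lam mu s k true *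
            pw q (k + 1) mu z)).Finite :=
        (((hfin false _).union (hfin true _)).subset (Function.support_add _ _)).subset
          fun _ h => right_ne_zero_of_mul h
      have hfin'' : (Function.support fun mu : ℕ → ℤ => branchPref q (k + 1) lam mu (z (k + 1)) *
            lowState q lam mu s k false * (q ^ mu (k + 1) * pw q (k + 1) mu z) +
          branchPref q (k + 1) lam mu (z (k + 1)) * lowState q lam mu s k true *
            (q * q ^ mu (k + 1) * pw q (k + 1) mu z)).Finite :=
        ((hfin false _).union (hfin true _)).subset (Function.support_add _ _)
      -- Adding q^(λ_{k+2}) times the first vanishing sum and subtracting the second makes the two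
      -- sides agree term by term, because q^(λ_{k+2}) q^(μ_{k+1} - λ_{k+2}) = q^(μ_{k+1}).
      rw [hL, ← add_zero (∑ᶠ mu : ℕ → ℤ, _), ← mul_zero (q ^ lam (k + 1 + 1)), ← hV1, mul_finsum,
        ← finsum_add_distrib (hfin false _) hfin', ← sub_zero (∑ᶠ mu : ℕ → ℤ, _), ← hV2,
        ← finsum_sub_distrib ((hfin false _).union hfin' |>.subset (Function.support_add _ _)) hfin'']
      refine finsum_congr fun mu => ?_
      · rw [(upState_succ lam mu s k).1]
        have : q ^ lam (k + 1 + 1) * expB q lam mu (k + 1) = q ^ mu (k + 1) := by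
          rw [expB, ← zpow_add₀ hq0]
          congr 1
          ring
        linear_combination (branchPref q (k + 1) lam mu (z (k + 1)) *
          lowState q lam mu s k true * pw q (k + 1) mu z * q) * this

end shift
end QWhittaker
end
-- Translation and reflection of rows; the Pieri rule of first order.
noncomputable section
namespace QWhittaker
open Finset

theorem skewP_congr (q : ℂ) (n : ℕ) {lam lam' mu mu' : ℕ → ℤ} (a : ℂ)
    (h : ∀ i, 1 ≤ i → i ≤ n → lam i = lam' i) (h' : ∀ i, 1 ≤ i → i ≤ n - 1 → mu i = mu' i) :
    skewP q n lam mu a = skewP q n lam' mu' a := by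
  unfold skewP
  congr 1
  · refine prod_congr rfl fun i hi => ?_
    have := mem_Icc.mp hi
    rw [h i this.1 this.2]
  · refine prod_congr rfl fun i hi => ?_
    have := mem_Icc.mp hi
    rw [h i this.1 (by omega), h (i + 1) (by omega) (by omega), h' i this.1 this.2]

theorem ind_Icc {n i : ℕ} (h1 : 1 ≤ i) (h2 : i ≤ n) : ind (Icc 1 n) i = 1 := by
  simp [ind, h1, h2]

/-- Bonds see only differences, so a translation of all rows changes nothing but the degree in each
variable. -/
theorem pw_sub_one (q : ℂ) (n : ℕ) (lam : ℕ → ℤ) {z : ℕ → ℂ} (hz : ∀ j, z j ≠ 0) :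
    pw q n (lam - ind (Icc 1 n)) z = (∏ j ∈ range n, z j)⁻¹ * pw q n lam z := by
  induction n generalizing lam with
  | zero => simp [pw]
  | succ n ih =>
    rw [pw, pw, mul_finsum, ← finsum_comp_equiv (Equiv.subRight (ind (Icc 1 n)))]
    refine finsum_congr fun mu => ?_
    rw [Equiv.subRight_apply, ih, prod_range_succ, mul_inv]
    have hs : RowSupp n (mu - ind (Icc 1 n)) ↔ RowSupp n mu := by
      rw [← rowSupp_add_ind (mem_powerset_self _) (mu - ind (Icc 1 n)), sub_add_cancel]
    have hb : branch q n (lam - ind (Icc 1 (n + 1))) (mu - ind (Icc 1 n)) (z n) =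
        (z n)⁻¹ * branch q n lam mu (z n) := by
      unfold branch
      by_cases h : RowSupp n mu
      swap
      · rw [if_neg h, if_neg (mt hs.mp h), mul_zero]
      rw [if_pos h, if_pos (hs.mpr h), skewP_eq q _ _ _ (hz n), skewP_eq q _ _ _ (hz n),
        rowSum_sub, rowSum_sub, show n + 1 - 1 = n from rfl, rowSum_ind (mem_powerset_self _),
        rowSum_ind (mem_powerset_self _), ← mul_assoc, ← zpow_neg_one, ← zpow_add₀ (hz n)]
      congr 1
      · congr 1
        simp only [Nat.card_Icc]
        push_cast
        ring
      · refine prod_congr rfl fun i hi => ?_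
        have := mem_Icc.mp hi
        simp only [Pi.sub_apply]
        rw [ind_Icc this.1 (show i ≤ n + 1 by omega), ind_Icc (show 1 ≤ i + 1 by omega)
          (show i + 1 ≤ n + 1 by omega), ind_Icc this.1 this.2]
        unfold bond
        rw [sub_sub_sub_cancel_right, sub_sub_sub_cancel_right, sub_sub_sub_cancel_right]
    rw [hb]
    ring

/-- Reversal and negation of the first `n` entries of a row. -/
def refl (n : ℕ) (s : ℕ → ℤ) (i : ℕ) : ℤ := if 1 ≤ i ∧ i ≤ n then -s (n + 1 - i) else s i

theorem refl_apply {n i : ℕ} (s : ℕ → ℤ) (h1 : 1 ≤ i) (h2 : i ≤ n) :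
    refl n s i = -s (n + 1 - i) := if_pos ⟨h1, h2⟩

theorem refl_refl (n : ℕ) : Function.Involutive (refl n) := by
  intro s
  funext i
  by_cases h : 1 ≤ i ∧ i ≤ n
  · rw [refl_apply _ h.1 h.2, refl_apply _ (by omega) (by omega), neg_neg]
    congr 1
    omega
  · rw [refl, if_neg h, refl, if_neg h]

theorem rowSupp_refl {n : ℕ} {s : ℕ → ℤ} : RowSupp n (refl n s) ↔ RowSupp n s := by
  refine forall_congr' fun i => ?_
  by_cases h : 1 ≤ i ∧ i ≤ n
  · simp [h]
  · rw [refl, if_neg h]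

theorem prod_Icc_reflect {M : Type*} [CommMonoid M] (n : ℕ) (f : ℕ → M) :
    ∏ i ∈ Icc 1 n, f (n + 1 - i) = ∏ i ∈ Icc 1 n, f i := by
  refine prod_nbij' (fun i => n + 1 - i) (fun i => n + 1 - i) ?_ ?_ ?_ ?_ ?_ <;>
    intro i hi <;> have := mem_Icc.mp hi
  · exact mem_Icc.mpr (by omega)
  · exact mem_Icc.mpr (by omega)
  · omega
  · omega
  · rfl

theorem sum_Icc_reflect {M : Type*} [AddCommMonoid M] (n : ℕ) (f : ℕ → M) :
    ∑ i ∈ Icc 1 n, f (n + 1 - i) = ∑ i ∈ Icc 1 n, f i :=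
  prod_Icc_reflect (M := Multiplicative M) n f

theorem rowSum_refl (n : ℕ) (s : ℕ → ℤ) : rowSum n (refl n s) = -rowSum n s := by
  rw [rowSum, rowSum, ← sum_Icc_reflect, ← sum_neg_distrib]
  refine sum_congr rfl fun i hi => ?_
  have := mem_Icc.mp hi
  rw [refl_apply _ (by omega) (by omega)]
  congr 2
  omega

theorem IsSignature.refl {n : ℕ} {s : ℕ → ℤ} (h : IsSignature n s) : IsSignature n (refl n s) := by
  intro i j h1 hij hj
  rw [refl_apply _ h1 (by omega), refl_apply _ (by omega) hj]
  exact neg_le_neg (h _ _ (by omega) (by omega) (by omega))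

/-- Reversing and negating all rows permutes the bonds, exchanges the two inverse factors in each,
and changes the sign of every degree. -/
theorem pw_refl (q : ℂ) (n : ℕ) (lam : ℕ → ℤ) {z : ℕ → ℂ} (hz : ∀ j, z j ≠ 0) :
    pw q n (refl n lam) z = pw q n lam fun j => (z j)⁻¹ := by
  induction n generalizing lam with
  | zero => rfl
  | succ n ih =>
    rw [pw, pw, ← finsum_comp_equiv (refl_refl n).toPerm]
    refine finsum_congr fun mu => ?_
    simp only [Function.Involutive.coe_toPerm]
    rw [ih]
    congr 1
    unfold branch
    by_cases h : RowSupp n mu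
    swap
    · rw [if_neg h, if_neg (mt rowSupp_refl.mp h)]
    rw [if_pos h, if_pos (rowSupp_refl.mpr h), skewP_eq q _ _ _ (hz n),
      skewP_eq q _ _ _ (inv_ne_zero (hz n)), show n + 1 - 1 = n from rfl, rowSum_refl,
      rowSum_refl, inv_zpow', ← prod_Icc_reflect]
    congr 1
    · congr 1
      ring
    · refine prod_congr rfl fun i hi => ?_
      have := mem_Icc.mp hi
      rw [refl_apply _ (by omega) (by omega), refl_apply _ (by omega) (by omega),
        refl_apply _ (by omega) (by omega), show n + 1 + 1 - (n + 1 - i) = i + 1 by omega,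
        show n + 1 + 1 - (n + 1 - i + 1) = i by omega, show n + 1 - (n + 1 - i) = i by omega]
      unfold bond
      rw [show -lam (i + 1) - -lam i = lam i - lam (i + 1) by ring,
        show -lam (i + 1) - -mu i = mu i - lam (i + 1) by ring,
        show -mu i - -lam i = lam i - mu i by ring]
      ring

/-- The Pieri rule for the sum of the inverse variables. -/
theorem pw_pieri_one {q : ℂ} (hq0 : q ≠ 0) (hq : ‖q‖ < 1) (n : ℕ) {lam : ℕ → ℤ}
    (hlam : IsSignature n lam) {z : ℕ → ℂ} (hz : ∀ j, z j ≠ 0) :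
    (∑ j ∈ range n, (z j)⁻¹) * pw q n lam z =
      ∑ i ∈ Icc 1 n, (if i = n then 1 else 1 - q ^ (lam i - lam (i + 1))) *
        pw q n (lam - ind {i}) z := by
  -- The coefficient of u in `pw_pieri` is extracted by differentiating at u = 0; only singletons
  -- survive.
  have hl : HasDerivAt (fun u : ℂ => (∏ j ∈ range n, (1 + u / z j)) * pw q n lam z)
      ((∑ j ∈ range n, (z j)⁻¹) * pw q n lam z) 0 := by
    refine HasDerivAt.mul_const ?_ _
    have h : ∀ j ∈ range n, HasDerivAt (fun u : ℂ => 1 + u / z j) ((z j)⁻¹) 0 := fun j _ => by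
      simpa using ((hasDerivAt_id (0 : ℂ)).div_const (z j)).const_add 1
    convert HasDerivAt.fun_finsetProd h using 1
    refine sum_congr rfl fun j _ => ?_
    simp
  have hr : HasDerivAt (fun u : ℂ => ∑ S ∈ (Icc 1 n).powerset,
      u ^ #S * psi q n S lam * pw q n (lam - ind S) z)
      (∑ S ∈ (Icc 1 n).powerset, (#S * (0 : ℂ) ^ (#S - 1)) * psi q n S lam *
        pw q n (lam - ind S) z) 0 :=
    HasDerivAt.fun_sum fun S _ => ((hasDerivAt_pow _ _).mul_const _).mul_const _
  simp only [pw_pieri hq0 hq n hlam hz] at hl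
  rw [hl.unique hr, ← sum_subset (s₁ := (Icc 1 n).image fun i => ({i} : Finset ℕ))]
  · rw [sum_image (by intro i _ j _ h; simpa using h)]
    refine sum_congr rfl fun i hi => ?_
    have hi' := mem_Icc.mp hi
    simp only [card_singleton, Nat.cast_one, Nat.sub_self, pow_zero, mul_one, one_mul]
    congr 1
    unfold psi
    have : ∀ k, (k ∈ ({i} : Finset ℕ) ∧ k + 1 ∉ ({i} : Finset ℕ)) ↔ i = k := by
      intro k
      simp only [mem_singleton]
      omega
    simp only [this]
    rw [prod_ite_eq]
    by_cases h : i = n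
    · rw [if_pos h, if_neg]
      simp only [mem_Icc]
      omega
    · rw [if_neg h, if_pos]
      simp only [mem_Icc]
      omega
  · intro S hS
    obtain ⟨i, hi, rfl⟩ := mem_image.mp hS
    simpa using hi
  · intro S hS hne
    have : #S ≠ 1 := fun h => by
      obtain ⟨i, rfl⟩ := card_eq_one.mp h
      refine hne (mem_image.mpr ⟨i, ?_, rfl⟩)
      exact mem_powerset.mp hS (mem_singleton_self i)
    rcases Nat.eq_zero_or_pos #S with h0 | h0
    · rw [h0]; simp
    · rw [zero_pow (by omega)]; simp

end QWhittaker
end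
-- Gelfand–Tsetlin arrays: counting, and the branching recursion as a sum over arrays.
noncomputable section
namespace QWhittaker
open Finset

theorem GTCone.entry_rowSupp {N : ℕ} (x : GTCone N) (k : ℕ) : RowSupp k (x.entry k) :=
  fun j hj => x.outside k j fun h => hj ⟨h.1, h.2.1⟩

theorem GTCone.mem_rowBox {N : ℕ} (x : GTCone N) {k : ℕ} (hk : k + 1 ≤ N) :
    x.entry k ∈ rowBox k (x.entry (k + 1)) :=
  QWhittaker.mem_rowBox.mpr ⟨x.entry_rowSupp k, fun i h1 h2 => x.interlacing k i h1 h2 hk⟩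

/-- Truncation of an array by its last row. -/
def GTCone.trunc {N : ℕ} (x : GTCone (N + 1)) : GTCone N where
  entry k j := if 1 ≤ j ∧ j ≤ k ∧ k ≤ N then x.entry k j else 0
  outside k j h := if_neg h
  signature k h1 h2 i j hi hij hj := by
    beta_reduce
    rw [if_pos ⟨hi.trans hij, hj, h2⟩, if_pos ⟨hi, hij.trans hj, h2⟩]
    exact x.signature k h1 (by omega) i j hi hij hj
  interlacing m l h1 h2 h3 := by
    rw [if_pos ⟨by omega, by omega, h3⟩, if_pos ⟨by omega, by omega, by omega⟩,
      if_pos ⟨by omega, by omega, h3⟩]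
    exact x.interlacing m l h1 h2 (by omega)

theorem GTCone.trunc_entry {N : ℕ} (x : GTCone (N + 1)) {k : ℕ} (hk : k ≤ N) :
    x.trunc.entry k = x.entry k := by
  funext j
  by_cases h : 1 ≤ j ∧ j ≤ k
  · exact if_pos ⟨h.1, h.2, hk⟩
  · rw [x.outside k j fun h' => h ⟨h'.1, h'.2.1⟩]
    exact if_neg fun h' => h ⟨h'.1, h'.2.1⟩

/-- Extension of an array by a new last row. -/
def GTCone.extend {N : ℕ} (y : GTCone N) (lam : ℕ → ℤ) (hlam : IsSignature (N + 1) lam)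
    (hy : y.entry N ∈ rowBox N lam) : GTCone (N + 1) where
  entry k j := if k = N + 1 then (if 1 ≤ j ∧ j ≤ N + 1 then lam j else 0) else y.entry k j
  outside k j h := by
    split_ifs with h1 h2
    · omega
    · rfl
    · exact y.outside k j fun h' => h ⟨h'.1, h'.2.1, by omega⟩
  signature k h1 h2 i j hi hij hj := by
    by_cases h : k = N + 1
    · subst h
      simp only [if_true, if_pos (show 1 ≤ j ∧ j ≤ N + 1 by omega),
        if_pos (show 1 ≤ i ∧ i ≤ N + 1 by omega)]
      exact hlam i j hi hij hj
    · simp only [if_neg h]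
      exact y.signature k h1 (by omega) i j hi hij hj
  interlacing m l h1 h2 h3 := by
    have hm : m ≠ N + 1 := by omega
    simp only [if_neg hm]
    by_cases h : m = N
    · subst h
      simp only [if_true, if_pos (show 1 ≤ l + 1 ∧ l + 1 ≤ m + 1 by omega),
        if_pos (show 1 ≤ l ∧ l ≤ m + 1 by omega)]
      exact (QWhittaker.mem_rowBox.mp hy).2 l h1 h2
    · simp only [if_neg (show m + 1 ≠ N + 1 by omega)]
      exact y.interlacing m l h1 h2 (by omega)

theorem GTCone.le_entry_succ {N : ℕ} (x : GTCone N) {k l j : ℕ} (hj : 1 ≤ j) (hjk : j ≤ k)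
    (hkl : k ≤ l) (hl : l ≤ N) : x.entry k j ≤ x.entry l j := by
  induction l, hkl using Nat.le_induction with
  | base => exact le_rfl
  | succ m hm ih => exact (ih (by omega)).trans (x.interlacing m j hj (by omega) hl).2

theorem GTCone.entry_le {N : ℕ} (x : GTCone N) {k j : ℕ} (hj : 1 ≤ j) (hjk : j ≤ k) (hk : k ≤ N) :
    x.entry k j ≤ x.entry N 1 :=
  (x.le_entry_succ hj hjk hk le_rfl).trans
    (x.signature N (by omega) le_rfl 1 j le_rfl hj (by omega))

theorem GTCone.le_entry {N : ℕ} (x : GTCone N) {k j : ℕ} (hj : 1 ≤ j) (hjk : j ≤ k) (hk : k ≤ N) :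
    x.entry N N ≤ x.entry k j :=
  (x.edge_step (by omega) le_rfl hk).trans
    (x.signature k (by omega) hk j k hj hjk le_rfl)

/-- The triangular part of an array, as a function on a finite type. -/
def GTCone.toSquare {N : ℕ} (c : ℤ) (x : GTCone N) (p : Fin N × Fin N) : ℤ :=
  if p.2 ≤ p.1 then x.entry (p.1 + 1) (p.2 + 1) else c

theorem GTCone.toSquare_injective {N : ℕ} (c : ℤ) :
    Function.Injective (GTCone.toSquare (N := N) c) := by
  intro x y h
  ext k j
  by_cases hk : 1 ≤ j ∧ j ≤ k ∧ k ≤ N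
  · have := congrFun h (⟨k - 1, by omega⟩, ⟨j - 1, by omega⟩)
    simp only [GTCone.toSquare, Fin.mk_le_mk] at this
    rw [if_pos (by omega), if_pos (by omega), show k - 1 + 1 = k by omega,
      show j - 1 + 1 = j by omega] at this
    exact this
  · rw [x.outside k j hk, y.outside k j hk]

theorem GTCone.mapsTo_toSquare {N : ℕ} {lo hi : ℤ} (h : lo ≤ hi) {x : GTCone N}
    (hx : 1 ≤ N → lo ≤ x.entry N N ∧ x.entry N 1 ≤ hi) :
    x.toSquare lo ∈ Fintype.piFinset fun _ : Fin N × Fin N => Icc lo hi := by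
  refine Fintype.mem_piFinset.mpr fun p => mem_Icc.mpr ?_
  have hN : 1 ≤ N := by have := p.1.2; omega
  have hp := p.1.2
  unfold GTCone.toSquare
  split_ifs with hle
  · have hle' : (p.2 : ℕ) ≤ p.1 := hle
    exact ⟨(hx hN).1.trans (x.le_entry (by omega) (by omega) (by omega)),
      (x.entry_le (by omega) (by omega) (by omega)).trans (hx hN).2⟩
  · exact ⟨le_rfl, h⟩

/-- All entries lie between the two extreme entries of the last row. The exponent N * N is crude,
since positions off the triangle are filled by a constant, but a polynomial bound is all that the
exponential decay needs. -/
theorem GTCone.card_le {N : ℕ} {lo hi : ℤ} (h : lo ≤ hi) (s : Finset (GTCone N))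
    (hs : ∀ x ∈ s, 1 ≤ N → lo ≤ x.entry N N ∧ x.entry N 1 ≤ hi) :
    (#s : ℝ) ≤ (hi - lo + 1) ^ (N * N) := by
  have h1 := card_le_card_of_injOn (GTCone.toSquare lo)
    (fun x hx => GTCone.mapsTo_toSquare h (hs x hx)) (GTCone.toSquare_injective lo).injOn
  rw [Fintype.card_piFinset, prod_const, card_univ, Fintype.card_prod, Fintype.card_fin,
    Int.card_Icc] at h1
  have h2 : (((hi + 1 - lo).toNat : ℕ) : ℝ) = hi - lo + 1 := by
    rw [← Int.cast_natCast, Int.toNat_of_nonneg (by omega)]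
    push_cast
    ring
  calc (#s : ℝ) ≤ (((hi + 1 - lo).toNat ^ (N * N) : ℕ) : ℝ) := by exact_mod_cast h1
    _ = _ := by rw [Nat.cast_pow, h2]

theorem GTCone.finite_of_bounds {N : ℕ} {lo hi : ℤ} (h : lo ≤ hi) :
    {x : GTCone N | 1 ≤ N → lo ≤ x.entry N N ∧ x.entry N 1 ≤ hi}.Finite :=
  Set.Finite.of_injOn (fun _ hx => GTCone.mapsTo_toSquare h hx)
    (GTCone.toSquare_injective lo).injOn (finite_toSet _)

theorem GTCone.finite_top {N : ℕ} (lam : ℕ → ℤ) : {x : GTCone N | x.entry N = lam}.Finite := by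
  refine (GTCone.finite_of_bounds (N := N) (lo := min (lam N) (lam 1)) (hi := lam 1)
    (min_le_right _ _)).subset ?_
  rintro x rfl h
  exact ⟨min_le_left _ _, le_rfl⟩

/-- The weight of an array as a product over `ℕ`-indexed variables. -/
def chainArr (q : ℂ) (n : ℕ) (A : ℕ → ℕ → ℤ) (z : ℕ → ℂ) : ℂ :=
  ∏ k ∈ range n, skewP q (k + 1) (A (k + 1)) (A k) (z k)

/-- Extension of a finite family of variables by `1`. -/
def zext {N : ℕ} (z : Fin N → ℂ) (k : ℕ) : ℂ := if h : k < N then z ⟨k, h⟩ else 1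

theorem zext_apply {N : ℕ} (z : Fin N → ℂ) (k : Fin N) : zext z k = z k := by simp [zext]

theorem zext_ne_zero {N : ℕ} {z : Fin N → ℂ} (hz : ∀ k, z k ≠ 0) (k : ℕ) : zext z k ≠ 0 := by
  unfold zext
  split_ifs
  · exact hz _
  · exact one_ne_zero

theorem chainP_eq_chainArr (q : ℂ) {N : ℕ} (x : GTCone N) (z : Fin N → ℂ) :
    chainP q x z = chainArr q N x.entry (zext z) := by
  rw [chainP, chainArr, ← Fin.prod_univ_eq_prod_range]
  exact prod_congr rfl fun k _ => by rw [zext_apply]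

theorem finsum_fiberwise {α β : Type*} (F : α → ℂ) (hF : (Function.support F).Finite)
    (f : α → β) : ∑ᶠ x, F x = ∑ᶠ b, ∑ᶠ x ∈ {x | f x = b}, F x := by
  classical
  rw [finsum_eq_sum_of_support_subset (s := hF.toFinset) F (by simp),
    ← finsum_sum_filter f hF.toFinset F]
  refine finsum_congr fun b => ?_
  rw [finsum_mem_eq_sum_of_inter_support_eq]
  ext x
  simp [and_comm]

/-- Deleting the last row is a bijection onto shorter arrays whose last row interlaces with `lam`;
the branching coefficient vanishes on all others, so the constraint can be dropped and the sum
regrouped by the new last row. -/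
theorem pw_eq_finsum {q : ℂ} (hq0 : q ≠ 0) (hq : ‖q‖ < 1) (N : ℕ) {lam : ℕ → ℤ}
    (hlam : IsSignature N lam) {z : ℕ → ℂ} (hz : ∀ j, z j ≠ 0) :
    ∑ᶠ x ∈ {x : GTCone N | ∀ i, 1 ≤ i → i ≤ N → x.entry N i = lam i}, chainArr q N x.entry z =
      pw q N lam z := by
  induction N generalizing lam with
  | zero =>
    have hx : ∀ x : GTCone 0, x = ⟨fun _ _ => 0, fun _ _ _ => rfl, fun _ _ _ => by omega,
        fun _ _ _ _ => by omega⟩ := by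
      intro x
      ext k j
      exact x.outside k j (by omega)
    have : {x : GTCone 0 | ∀ i, 1 ≤ i → i ≤ 0 → x.entry 0 i = lam i} =
        {⟨fun _ _ => 0, fun _ _ _ => rfl, fun _ _ _ => by omega,
        fun _ _ _ _ => by omega⟩} := by
      ext x
      simp only [Set.mem_ofPred_eq, Set.mem_singleton_iff]
      exact ⟨fun _ => hx x, fun _ i h1 h2 => by omega⟩
    rw [this, finsum_mem_singleton]
    simp [chainArr, pw]
  | succ N ih =>
    set F : GTCone N → ℂ := fun y => branch q N lam (y.entry N) (z N) * chainArr q N y.entry z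
    have hbox : ∀ y, F y ≠ 0 → y.entry N ∈ rowBox N lam := fun y hy =>
      mem_rowBox_of_branch_ne_zero hq0 hq (hz N) (left_ne_zero_of_mul hy)
    have hfin : (Function.support F).Finite := by
      refine ((rowBox N lam).finite_toSet.biUnion fun mu _ =>
        GTCone.finite_top (N := N) mu).subset fun y hy => ?_
      exact Set.mem_biUnion (hbox y hy) rfl
    have h1 : ∑ᶠ x ∈ {x : GTCone (N + 1) | ∀ i, 1 ≤ i → i ≤ N + 1 → x.entry (N + 1) i = lam i},
        chainArr q (N + 1) x.entry z = ∑ᶠ y ∈ {y : GTCone N | y.entry N ∈ rowBox N lam}, F y := by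
      refine finsum_mem_eq_of_bijOn GTCone.trunc ⟨?_, ?_, ?_⟩ ?_
      · intro x hx
        have h := x.mem_rowBox (k := N) le_rfl
        rw [Set.mem_ofPred_eq, x.trunc_entry le_rfl]
        refine mem_rowBox.mpr ⟨(mem_rowBox.mp h).1, fun i hi1 hi2 => ?_⟩
        rw [← hx i hi1 (by omega), ← hx (i + 1) (by omega) (by omega)]
        exact (mem_rowBox.mp h).2 i hi1 hi2
      · intro x hx x' hx' h
        ext k j
        by_cases hk : 1 ≤ j ∧ j ≤ k ∧ k ≤ N + 1
        · rcases Nat.lt_or_ge N k with hlt | hle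
          · obtain rfl : k = N + 1 := by omega
            rw [hx j hk.1 hk.2.1, hx' j hk.1 hk.2.1]
          · rw [← x.trunc_entry hle, ← x'.trunc_entry hle, h]
        · rw [x.outside k j hk, x'.outside k j hk]
      · intro y hy
        refine ⟨y.extend lam hlam hy, fun i h1 h2 => ?_, ?_⟩
        · simp [GTCone.extend, h1, h2]
        · ext k j
          by_cases hk : k ≤ N
          · rw [GTCone.trunc_entry _ hk]
            simp [GTCone.extend, show k ≠ N + 1 by omega]
          · rw [GTCone.outside _ _ _ (by omega), GTCone.outside _ _ _ (by omega)]
      · intro x hx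
        have hsupp : RowSupp N (x.entry N) := x.entry_rowSupp N
        have hb : branch q N lam (x.trunc.entry N) (z N) =
            skewP q (N + 1) lam (x.entry N) (z N) := by
          rw [x.trunc_entry le_rfl, branch, if_pos hsupp]
        simp only [F, hb, chainArr]
        rw [prod_range_succ, mul_comm]
        congr 1
        · exact skewP_congr q _ _ hx fun _ _ _ => rfl
        · refine prod_congr rfl fun k hk => ?_
          have := mem_range.mp hk
          rw [x.trunc_entry (show k + 1 ≤ N by omega), x.trunc_entry (show k ≤ N by omega)]
    have h2 : ∑ᶠ y ∈ {y : GTCone N | y.entry N ∈ rowBox N lam}, F y = ∑ᶠ y, F y := by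
      rw [finsum_mem_def]
      refine finsum_congr fun y => ?_
      by_cases hy : F y = 0
      · rw [hy]
        exact Set.indicator_apply_eq_zero.mpr fun _ => hy
      · exact Set.indicator_of_mem (s := {y : GTCone N | y.entry N ∈ rowBox N lam}) (hbox y hy) F
    rw [h1, h2, finsum_fiberwise F hfin fun y => y.entry N, pw]
    refine finsum_congr fun mu => ?_
    by_cases hb : branch q N lam mu (z N) = 0
    · rw [hb, zero_mul]
      refine finsum_mem_eq_zero_of_forall_eq_zero fun y hy => ?_
      have hy' : y.entry N = mu := hy
      simp only [F, hy', hb, zero_mul]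
    · have hm := mem_rowBox_of_branch_ne_zero hq0 hq (hz N) hb
      rw [← ih (IsSignature.of_mem_rowBox hm)]
      have hset : {y : GTCone N | ∀ i, 1 ≤ i → i ≤ N → y.entry N i = mu i} =
          {y | y.entry N = mu} := by
        ext y
        refine ⟨fun h => ?_, fun h i _ _ => congrFun h i⟩
        funext i
        by_cases hi : 1 ≤ i ∧ i ≤ N
        · exact h i hi.1 hi.2
        · rw [y.entry_rowSupp N i hi, (mem_rowBox.mp hm).1 i hi]
      rw [hset, mul_finsum_mem]
      refine finsum_mem_congr rfl fun y hy => ?_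
      have hy' : y.entry N = mu := hy
      simp only [F, hy']

/-- The `q`-Whittaker function at inverted variables, in terms of the branching recursion. -/
theorem whittakerP_inv {q : ℂ} (hq0 : q ≠ 0) (hq : ‖q‖ < 1) (N : ℕ) {lam : ℕ → ℤ}
    (hlam : IsSignature N lam) {z : Fin N → ℂ} (hz : ∀ j, z j ≠ 0) :
    whittakerP q N lam (fun i => 1 / z i) = pw q N lam fun j => (zext z j)⁻¹ := by
  rw [← pw_eq_finsum hq0 hq N hlam fun j => inv_ne_zero (zext_ne_zero hz j), whittakerP]
  refine finsum_mem_congr rfl fun x _ => ?_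
  rw [chainP_eq_chainArr]
  congr 1
  funext j
  unfold zext
  split_ifs <;> simp

end QWhittaker
end
-- Torus integrals: independence of the radii and negligible collisions.
noncomputable section
namespace QWhittaker
open Finset MeasureTheory

/-- The polyannulus `c_j < |z_j|`. -/
def polyExterior {N : ℕ} (c : Fin N → ℝ) : Set (Fin N → ℂ) := {z | ∀ j, c j < ‖z j‖}

/-- The integral of `G` over a torus with radii `R`, in angular coordinates. -/
def torusAvg {N : ℕ} (R : Fin N → ℝ) (G : (Fin N → ℂ) → ℂ) : ℂ :=
  ∫ θ in Set.Icc (0 : Fin N → ℝ) (fun _ => 2 * Real.pi), G (torusMap 0 R θ)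

theorem norm_torusMap {N : ℕ} {R : Fin N → ℝ} (hR : ∀ j, 0 ≤ R j) (θ : Fin N → ℝ) (j : Fin N) :
    ‖torusMap 0 R θ j‖ = R j := by
  simp [torusMap, Complex.norm_exp_ofReal_mul_I, abs_of_nonneg (hR j)]

theorem torusMap_mem_polyExterior {N : ℕ} {c R : Fin N → ℝ} (hc : ∀ j, 0 ≤ c j)
    (hR : ∀ j, c j < R j) (θ : Fin N → ℝ) : torusMap 0 R θ ∈ polyExterior c := fun j => by
  rw [norm_torusMap fun j => (hc j).trans (hR j).le]
  exact hR j

theorem continuous_torusMap {N : ℕ} (R : Fin N → ℝ) : Continuous (torusMap (0 : Fin N → ℂ) R) := by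
  unfold torusMap
  fun_prop

theorem continuous_comp_torusMap {N : ℕ} {c R : Fin N → ℝ} (hc : ∀ j, 0 ≤ c j)
    (hR : ∀ j, c j < R j) {G : (Fin N → ℂ) → ℂ} (hG : ContinuousOn G (polyExterior c)) :
    Continuous fun θ => G (torusMap 0 R θ) :=
  hG.comp_continuous (continuous_torusMap R) (torusMap_mem_polyExterior hc hR)

theorem integrableOn_comp_torusMap {N : ℕ} {c R : Fin N → ℝ} (hc : ∀ j, 0 ≤ c j)
    (hR : ∀ j, c j < R j) {G : (Fin N → ℂ) → ℂ} (hG : ContinuousOn G (polyExterior c)) :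
    IntegrableOn (fun θ => G (torusMap 0 R θ))
      (Set.Icc (0 : Fin N → ℝ) (fun _ => 2 * Real.pi)) :=
  (continuous_comp_torusMap hc hR hG).continuousOn.integrableOn_compact isCompact_Icc

/-- On a circle dz/z is i dθ, so this is Cauchy's theorem on an annulus for f(z)/z. -/
theorem integral_circle_eq {c r₁ r₂ : ℝ} (hc : 0 ≤ c) (h₁ : c < r₁) (h₂ : c < r₂) {f : ℂ → ℂ}
    (hf : DifferentiableOn ℂ f {x | c < ‖x‖}) :
    ∫ θ in Set.Icc 0 (2 * Real.pi), f (r₁ * Complex.exp (θ * Complex.I)) =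
      ∫ θ in Set.Icc 0 (2 * Real.pi), f (r₂ * Complex.exp (θ * Complex.I)) := by
  wlog hle : r₁ ≤ r₂ generalizing r₁ r₂
  · exact (this h₂ h₁ (le_of_not_ge hle)).symm
  have hopen : IsOpen {x : ℂ | c < ‖x‖} := isOpen_lt continuous_const continuous_norm
  have key := Complex.circleIntegral_sub_center_inv_smul_eq_of_differentiable_on_annulus_off_countable
    (c := 0) (r := r₁) (R := r₂) (hc.trans_lt h₁) hle (f := f) (s := ∅) Set.countable_empty
    (hf.continuousOn.mono fun x hx => h₁.trans_le (by simpa using hx.2))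
    (fun x hx => hf.differentiableAt (hopen.mem_nhds (h₁.trans (by simpa using hx.1.2))))
  have conv : ∀ r : ℝ, 0 < r → (∮ z in C(0, r), (z - 0)⁻¹ • f z) =
      Complex.I * ∫ θ in Set.Icc 0 (2 * Real.pi), f (r * Complex.exp (θ * Complex.I)) := by
    intro r hr
    rw [circleIntegral_def_Icc, ← integral_const_mul]
    refine setIntegral_congr_fun measurableSet_Icc fun θ _ => ?_
    have hr' : (r : ℂ) ≠ 0 := by exact_mod_cast hr.ne'
    have hne : (r : ℂ) * Complex.exp (θ * Complex.I) ≠ 0 :=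
      mul_ne_zero hr' (Complex.exp_ne_zero _)
    simp only [deriv_circleMap, circleMap, zero_add, sub_zero, smul_eq_mul]
    field_simp
  rw [conv r₁ (hc.trans_lt h₁), conv r₂ (hc.trans_lt h₂)] at key
  exact (mul_left_cancel₀ Complex.I_ne_zero key).symm

/-- Fubini isolates the angle of coordinate i, and the one-variable statement applies to the inner
integral. -/
theorem torusAvg_update {n : ℕ} {c R : Fin (n + 1) → ℝ} (hc : ∀ j, 0 ≤ c j)
    (hR : ∀ j, c j < R j) {G : (Fin (n + 1) → ℂ) → ℂ} (hG : DifferentiableOn ℂ G (polyExterior c))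
    (i : Fin (n + 1)) {r : ℝ} (hr : c i < r) :
    torusAvg R G = torusAvg (Function.update R i r) G := by
  have main : ∀ R : Fin (n + 1) → ℝ, (∀ j, c j < R j) → torusAvg R G =
      ∫ Θ in Set.Icc (0 : Fin n → ℝ) (fun _ => 2 * Real.pi),
        ∫ t in Set.Icc (0 : ℝ) (2 * Real.pi),
          G (i.insertNth ((R i : ℂ) * Complex.exp (t * Complex.I))
            (torusMap 0 (R ∘ i.succAbove) Θ)) := by
    intro R hR
    have hint := integrableOn_comp_torusMap hc hR hG.continuousOn
    set e : ℝ × (Fin n → ℝ) ≃ᵐ (Fin (n + 1) → ℝ) :=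
      (MeasurableEquiv.piFinSuccAbove (fun _ => ℝ) i).symm
    have hem : MeasurePreserving e :=
      (volume_preserving_piFinSuccAbove (fun _ : Fin (n + 1) => ℝ) i).symm _
    have heπ : (e ⁻¹' Set.Icc 0 fun _ => 2 * Real.pi) =
        Set.Icc 0 (2 * Real.pi) ×ˢ Set.Icc (0 : Fin n → ℝ) fun _ => 2 * Real.pi :=
      ((Fin.insertNthOrderIso (fun _ => ℝ) i).preimage_Icc _ _).trans (Set.Icc_prod_eq _ _)
    have hcomp : ∀ p : ℝ × (Fin n → ℝ), torusMap 0 R (e p) =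
        i.insertNth ((R i : ℂ) * Complex.exp (p.1 * Complex.I))
            (torusMap 0 (R ∘ i.succAbove) p.2) := by
      intro p
      have he : e p = i.insertNth p.1 p.2 := rfl
      rw [he]
      funext j
      refine Fin.succAboveCases i ?_ (fun k => ?_) j
      · simp [torusMap]
      · simp [torusMap]
    rw [torusAvg, ← hem.map_eq, setIntegral_map_equiv, heπ, Measure.volume_eq_prod,
      ← setIntegral_prod_swap, setIntegral_prod]
    · simp only [Prod.swap, hcomp]
    · rw [← hem.integrableOn_comp_preimage e.measurableEmbedding, heπ,
        Measure.volume_eq_prod] at hint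
      exact hint.swap
  have hR' : ∀ j, c j < Function.update R i r j := by
    intro j
    rcases eq_or_ne j i with rfl | hj
    · simpa using hr
    · simpa [hj] using hR j
  rw [main R hR, main _ hR']
  have hsucc : Function.update R i r ∘ i.succAbove = R ∘ i.succAbove := by
    funext j; simp
  rw [hsucc, Function.update_self]
  refine setIntegral_congr_fun measurableSet_Icc fun Θ _ => ?_
  have hmaps : ∀ x : ℂ, c i < ‖x‖ →
      (i.insertNth x (torusMap 0 (R ∘ i.succAbove) Θ) : Fin (n + 1) → ℂ) ∈ polyExterior c := by
    intro x hx j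
    refine Fin.succAboveCases i ?_ (fun k => ?_) j
    · simpa using hx
    · rw [Fin.insertNth_apply_succAbove, norm_torusMap (R := R ∘ i.succAbove) fun j => (hc _).trans (hR _).le]
      exact hR _
  refine integral_circle_eq (f := fun x => G (i.insertNth x (torusMap 0 (R ∘ i.succAbove) Θ)))
    (hc i) (hR i) hr ?_
  refine DifferentiableOn.comp (t := polyExterior c) hG ?_ fun x hx => hmaps x hx
  rw [differentiableOn_pi]
  intro j
  refine Fin.succAboveCases i ?_ (fun k => ?_) j
  · simp only [Fin.insertNth_apply_same]
    exact differentiableOn_id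
  · simp

/-- The torus integral of a holomorphic function does not depend on the radii. -/
theorem torusAvg_eq {N : ℕ} {c R R' : Fin N → ℝ} (hc : ∀ j, 0 ≤ c j)
    (hR : ∀ j, c j < R j) (hR' : ∀ j, c j < R' j) {G : (Fin N → ℂ) → ℂ}
    (hG : DifferentiableOn ℂ G (polyExterior c)) : torusAvg R G = torusAvg R' G := by
  rcases N with _ | n
  · rw [Subsingleton.elim R R']
  have h : ∀ s : Finset (Fin (n + 1)),
      torusAvg R G = torusAvg (fun j => if j ∈ s then R' j else R j) G := by
    intro s
    induction s using Finset.induction_on with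
    | empty => simp
    | insert i s hi ih =>
      rw [ih, torusAvg_update hc ?_ hG i (hR' i)]
      · congr 1
        funext j
        rcases eq_or_ne j i with rfl | hj
        · simp
        · simp [hj]
      · intro j
        split_ifs
        · exact hR' j
        · exact hR j
  simpa using h univ

theorem volume_collision_eq_zero {N : ℕ} {i j : Fin N} (hij : i ≠ j) :
    volume {θ : Fin N → ℝ | torusMap 0 (fun _ => 1) θ i = torusMap 0 (fun _ => 1) θ j} = 0 := by
  have hsub : {θ : Fin N → ℝ | torusMap 0 (fun _ => 1) θ i = torusMap 0 (fun _ => 1) θ j} ⊆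
      ⋃ n : ℤ, {θ : Fin N → ℝ | θ i - θ j = n * (2 * Real.pi)} := by
    intro θ hθ
    simp only [torusMap, Pi.zero_apply, zero_add, Complex.ofReal_one, one_mul,
      Set.mem_ofPred_eq] at hθ
    obtain ⟨n, hn⟩ := Complex.exp_eq_exp_iff_exists_int.mp hθ
    refine Set.mem_iUnion.mpr ⟨n, ?_⟩
    have h2 : ((θ i - θ j : ℝ) : ℂ) * Complex.I = ((n * (2 * Real.pi) : ℝ) : ℂ) * Complex.I := by
      push_cast
      linear_combination hn
    exact_mod_cast mul_right_cancel₀ Complex.I_ne_zero h2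
  refine measure_mono_null hsub (measure_iUnion_null fun n => ?_)
  let L : (Fin N → ℝ) →ₗ[ℝ] ℝ := (LinearMap.proj i : (Fin N → ℝ) →ₗ[ℝ] ℝ) - LinearMap.proj j
  have hL : ∀ θ, L θ = θ i - θ j := fun θ => rfl
  let s : AffineSubspace ℝ (Fin N → ℝ) :=
    (AffineSubspace.mk' ((n : ℝ) * (2 * Real.pi)) (⊥ : Submodule ℝ ℝ)).comap L.toAffineMap
  have hs : {θ : Fin N → ℝ | θ i - θ j = n * (2 * Real.pi)} = (s : Set (Fin N → ℝ)) := by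
    ext θ
    simp [s, AffineSubspace.mem_mk', hL, sub_eq_zero]
  rw [hs]
  refine Measure.addHaar_affineSubspace _ s fun htop => ?_
  have h0 : (0 : Fin N → ℝ) ∈ s := htop ▸ AffineSubspace.mem_top _ _ _
  have h1 : (Pi.single i 1 : Fin N → ℝ) ∈ s := htop ▸ AffineSubspace.mem_top _ _ _
  rw [← SetLike.mem_coe, ← hs] at h0 h1
  simp only [Set.mem_ofPred_eq, Pi.zero_apply, Pi.single_eq_same, Pi.single_eq_of_ne hij.symm,
    sub_zero] at h0 h1
  linarith

/-- Collisions lie in countably many hyperplanes θ_i - θ_j = 2πn. The interpolation identities need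
distinct nodes, and therefore hold almost everywhere on the torus. -/
theorem ae_injective_torusMap (N : ℕ) :
    ∀ᵐ θ : Fin N → ℝ, Function.Injective (torusMap 0 (fun _ => 1) θ) := by
  have h : ∀ i j : Fin N, i ≠ j →
      ∀ᵐ θ : Fin N → ℝ, torusMap 0 (fun _ => 1) θ i ≠ torusMap 0 (fun _ => 1) θ j := by
    intro i j hij
    rw [ae_iff]
    simpa using volume_collision_eq_zero hij
  have h' : ∀ᵐ θ : Fin N → ℝ, ∀ i j : Fin N, i ≠ j →
      torusMap 0 (fun _ => 1) θ i ≠ torusMap 0 (fun _ => 1) θ j := by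
    simp only [eventually_countable_forall]
    exact h
  filter_upwards [h'] with θ hθ i j hij
  by_contra hne
  exact hθ i j hne hij

end QWhittaker
end
-- Lagrange interpolation identities.
noncomputable section
namespace QWhittaker
open Finset MeasureTheory

section lagrange
variable {ι : Type*} [Fintype ι] [DecidableEq ι]

theorem eval_basis_zero {v : ι → ℂ} (hinj : Function.Injective v) (hv : ∀ i, v i ≠ 0) (i : ι) :
    (Lagrange.basis univ v i).eval 0 = ∏ j ∈ {i}ᶜ, (1 - v i / v j)⁻¹ := by
  rw [Lagrange.basis, Polynomial.eval_prod]
  refine prod_congr (by ext j; simp) fun j hj => ?_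
  have hij : v i - v j ≠ 0 := sub_ne_zero.mpr fun h => by
    have := hinj h
    simp_all
  have hvj := hv j
  have h2 : 1 - v i / v j ≠ 0 := by
    rw [show 1 - v i / v j = -((v i - v j) / v j) by field_simp; ring]
    exact neg_ne_zero.mpr (div_ne_zero hij hvj)
  rw [Lagrange.basisDivisor, Polynomial.eval_mul, Polynomial.eval_C, Polynomial.eval_sub,
    Polynomial.eval_X, Polynomial.eval_C, ← mul_right_inj' h2,
    mul_inv_cancel₀ h2]
  field_simp
  ring

/-- The weights are the values at 0 of the Lagrange basis polynomials. -/
theorem sum_eval_mul_prod {v : ι → ℂ} (hinj : Function.Injective v) (hv : ∀ i, v i ≠ 0)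
    {f : Polynomial ℂ} (hf : f.degree < Fintype.card ι) :
    ∑ i, f.eval (v i) * ∏ j ∈ {i}ᶜ, (1 - v i / v j)⁻¹ = f.eval 0 := by
  conv_rhs => rw [Lagrange.eq_interpolate (s := univ) (f := f) hinj.injOn (by simpa using hf)]
  rw [Lagrange.interpolate_apply, Polynomial.eval_finsetSum]
  exact sum_congr rfl fun i _ => by
    rw [Polynomial.eval_mul, Polynomial.eval_C, eval_basis_zero hinj hv]

theorem sum_pow_mul_prod {v : ι → ℂ} (hinj : Function.Injective v) (hv : ∀ i, v i ≠ 0)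
    {m : ℕ} (hm : m < Fintype.card ι) :
    ∑ i, v i ^ m * ∏ j ∈ {i}ᶜ, (1 - v i / v j)⁻¹ = if m = 0 then 1 else 0 := by
  have h := sum_eval_mul_prod hinj hv (f := Polynomial.X ^ m)
    (lt_of_le_of_lt (Polynomial.degree_X_pow_le m) (by exact_mod_cast hm))
  simpa [zero_pow_eq] using h

/-- ∏ (1 - β_k X) has degree one too large for interpolation. Subtracting ∏ (-β_k) ∏ (X - v_k)
cancels the top coefficient and leaves the values at the nodes unchanged; its value at 0 is the
correction term. -/
theorem sum_prod_one_sub_mul_prod {v : ι → ℂ} (hinj : Function.Injective v)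
    (hv : ∀ i, v i ≠ 0) (β : ι → ℂ) :
    ∑ i, (∏ k, (1 - β k * v i)) * ∏ j ∈ {i}ᶜ, (1 - v i / v j)⁻¹ =
      1 - (∏ k, β k) * ∏ k, v k := by
  set f : Polynomial ℂ := ∏ k, (Polynomial.C 1 - Polynomial.C (β k) * Polynomial.X) -
    Polynomial.C (∏ k, -β k) * ∏ k, (Polynomial.X - Polynomial.C (v k))
  have h1 : ∀ k ∈ (univ : Finset ι), (Polynomial.C 1 - Polynomial.C (β k) * Polynomial.X).natDegree
      ≤ 1 := fun k _ => by compute_degree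
  have h2 : ∀ k ∈ (univ : Finset ι), (Polynomial.X - Polynomial.C (v k)).natDegree ≤ 1 :=
    fun k _ => by compute_degree
  have hf : f.degree < Fintype.card ι := by
    rw [Polynomial.degree_lt_iff_coeff_zero]
    intro m hm
    rcases hm.eq_or_lt with rfl | hm
    · have e1 := Polynomial.coeff_prod_of_natDegree_le _ _ 1 h1
      have e2 := Polynomial.coeff_prod_of_natDegree_le _ _ 1 h2
      rw [mul_one, card_univ] at e1 e2
      rw [Polynomial.coeff_sub, Polynomial.coeff_C_mul, e1, e2]
      simp [Polynomial.coeff_C, Polynomial.coeff_one]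
    · have d1 := (Polynomial.natDegree_prod_le univ _).trans (sum_le_sum h1)
      have d2 := (Polynomial.natDegree_prod_le univ _).trans (sum_le_sum h2)
      rw [sum_const, card_univ, smul_eq_mul, mul_one] at d1 d2
      rw [Polynomial.coeff_sub, Polynomial.coeff_C_mul,
        Polynomial.coeff_eq_zero_of_natDegree_lt (d1.trans_lt hm),
        Polynomial.coeff_eq_zero_of_natDegree_lt (d2.trans_lt hm)]
      simp
  have h := sum_eval_mul_prod hinj hv hf
  have hroot : ∀ i, f.eval (v i) = ∏ k, (1 - β k * v i) := by
    intro i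
    have : ∏ k, (v i - v k) = 0 := prod_eq_zero (mem_univ i) (sub_self _)
    simp [f, Polynomial.eval_prod, this]
  have h0 : f.eval 0 = 1 - (∏ k, β k) * ∏ k, v k := by
    simp only [f, Polynomial.eval_sub, Polynomial.eval_mul, Polynomial.eval_prod,
      Polynomial.eval_C, Polynomial.eval_X, mul_zero, sub_zero, zero_sub, prod_const_one]
    rw [← prod_mul_distrib, ← prod_mul_distrib]
    simp
  rw [h0] at h
  rw [← h]
  exact sum_congr rfl fun i _ => by rw [hroot]

end lagrange

/-- The product `∏_{k,j} 1 / (d_j α_k / z_j; q)_∞`. -/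
def cauchyProd (q : ℂ) {N : ℕ} (α d z : Fin N → ℂ) : ℂ :=
  ∏ k, ∏ j, 1 / qPochInf q (d j * α k / z j)

/-- The product `∏_{l ≠ j} (d_l z_j / z_l; q)_∞`. -/
def pairProd (q : ℂ) {N : ℕ} (d z : Fin N → ℂ) : ℂ :=
  ∏ l, ∏ j ∈ {l}ᶜ, qPochInf q (d l * z j / z l)

theorem pairProd_swap (q : ℂ) {N : ℕ} (d z : Fin N → ℂ) :
    pairProd q d z = ∏ j, ∏ l ∈ {j}ᶜ, qPochInf q (d l * z j / z l) :=
  prod_comm' fun x y => by simp [eq_comm]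

theorem qPochInf_ratio {q : ℂ} (hq : ‖q‖ < 1) (a : ℂ) (ha : 1 - a ≠ 0) :
    qPochInf q (q * a) = qPochInf q a * (1 - a)⁻¹ := by
  rw [qPochInf_eq_mul hq a, mul_comm a q]
  field_simp

/-! ### Cauchy and pair products when one variable or one scale is multiplied by q. -/

section shift
variable {q : ℂ} (hq0 : q ≠ 0) (hq : ‖q‖ < 1) {N : ℕ} (α : Fin N → ℂ) {z : Fin N → ℂ}
  (hz : ∀ j, z j ≠ 0) (i : Fin N)

theorem update_scale (z : Fin N → ℂ) (i : Fin N) (q : ℂ) :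
    Function.update z i (q * z i) = fun j => Function.update (1 : Fin N → ℂ) i q j * z j := by
  funext j
  rcases eq_or_ne j i with rfl | h
  · simp
  · simp [h]

include hq0 in
theorem update_one_ne_zero (j : Fin N) : Function.update (1 : Fin N → ℂ) i q j ≠ 0 := by
  rcases eq_or_ne j i with rfl | h
  · simpa
  · simp [h]

include hq0 in
theorem cauchyProd_shift :
    cauchyProd q α (Function.update 1 i q) (Function.update z i (q * z i)) =
      cauchyProd q α 1 z := by
  rw [update_scale, cauchyProd, cauchyProd]
  refine prod_congr rfl fun k _ => prod_congr rfl fun j _ => ?_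
  rw [mul_div_mul_left _ _ (update_one_ne_zero hq0 i j), Pi.one_apply, one_mul]

include hq hz in
theorem cauchyProd_update (hα : ∀ k j, ‖α k‖ < ‖z j‖) :
    cauchyProd q α (Function.update 1 i q) z =
      cauchyProd q α 1 z * ∏ k, (1 - α k * (z i)⁻¹) := by
  rw [cauchyProd, cauchyProd, ← prod_mul_distrib]
  refine prod_congr rfl fun k _ => ?_
  rw [← mul_prod_erase univ _ (mem_univ i), ← mul_prod_erase univ
    (fun j => 1 / qPochInf q ((1 : Fin N → ℂ) j * α k / z j)) (mem_univ i)]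
  have h : ∏ j ∈ univ.erase i, 1 / qPochInf q (Function.update (1 : Fin N → ℂ) i q j * α k / z j) =
      ∏ j ∈ univ.erase i, 1 / qPochInf q ((1 : Fin N → ℂ) j * α k / z j) :=
    prod_congr rfl fun j hj => by rw [Function.update_of_ne (ne_of_mem_erase hj)]
  have hlt : ‖α k / z i‖ < 1 := by
    rw [norm_div, div_lt_one (norm_pos_iff.mpr (hz i))]
    exact hα k i
  have hne : 1 - α k / z i ≠ 0 := sub_ne_zero.mpr fun e => by rw [← e] at hlt; simp at hlt
  rw [h, Function.update_self, Pi.one_apply, one_mul, mul_div_assoc, qPochInf_ratio hq _ hne,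
    ← div_eq_mul_inv, one_div, inv_div, div_eq_mul_inv (1 - _)]
  ring

include hq0 hq hz in
-- The scale d_i = q compensates q z_i in denominators, so only the factors with numerator z_i
-- change, each by one q-step.
theorem pairProd_shift (hinj : Function.Injective z) :
    pairProd q (Function.update 1 i q) (Function.update z i (q * z i)) =
      pairProd q 1 z * ∏ l ∈ {i}ᶜ, (1 - z i / z l)⁻¹ := by
  rw [update_scale, pairProd_swap, pairProd_swap, ← mul_prod_erase univ _ (mem_univ i),
    ← mul_prod_erase univ (fun j => ∏ l ∈ {j}ᶜ, qPochInf q ((1 : Fin N → ℂ) l * z j / z l))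
    (mem_univ i), mul_right_comm,
    ← prod_mul_distrib]
  congr 1
  · refine prod_congr rfl fun l hl => ?_
    have hl' : l ≠ i := by simpa using hl
    have hne : 1 - z i / z l ≠ 0 := sub_ne_zero.mpr fun e =>
      hl' (hinj ((div_eq_one_iff_eq (hz l)).mp e.symm)).symm
    rw [mul_div_mul_left _ _ (update_one_ne_zero hq0 i l), Function.update_self, Pi.one_apply,
      one_mul, mul_div_assoc, qPochInf_ratio hq _ hne]
  · refine prod_congr rfl fun j hj => prod_congr rfl fun l hl => ?_
    rw [mul_div_mul_left _ _ (update_one_ne_zero hq0 i l),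
      Function.update_of_ne (ne_of_mem_erase hj)]
    simp

include hq hz in
theorem pairProd_update (hinj : Function.Injective z) :
    pairProd q (Function.update 1 i q) z =
      pairProd q 1 z * ∏ j ∈ {i}ᶜ, (1 - (z i)⁻¹ / (z j)⁻¹)⁻¹ := by
  rw [pairProd, pairProd, ← mul_prod_erase univ _ (mem_univ i),
    ← mul_prod_erase univ
    (fun l => ∏ j ∈ {l}ᶜ, qPochInf q ((1 : Fin N → ℂ) l * z j / z l)) (mem_univ i), mul_right_comm,
    ← prod_mul_distrib]
  congr 1
  · refine prod_congr rfl fun j hj => ?_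
    have hj' : j ≠ i := by simpa using hj
    have hne : 1 - z j / z i ≠ 0 := sub_ne_zero.mpr fun e =>
      hj' (hinj ((div_eq_one_iff_eq (hz i)).mp e.symm))
    rw [Function.update_self, Pi.one_apply, one_mul, mul_div_assoc, qPochInf_ratio hq _ hne,
      inv_div_inv]
  · refine prod_congr rfl fun l hl => prod_congr rfl fun j hj => ?_
    rw [Function.update_of_ne (ne_of_mem_erase hl)]

end shift

theorem zext_update {N : ℕ} (z : Fin N → ℂ) (i : Fin N) (x : ℂ) :
    zext (Function.update z i x) = Function.update (zext z) i x := by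
  funext k
  unfold zext
  rcases eq_or_ne k i with rfl | h
  · simp
  · rw [Function.update_of_ne h]
    split_ifs with hk
    · rw [Function.update_of_ne fun e => h (by rw [← e])]
    · rfl

/-- The integrand of the torus integral attached to the row `κ`, with column scales `d`. -/
def rowIntegrand (q : ℂ) {N : ℕ} (κ : ℕ → ℤ) (α d z : Fin N → ℂ) : ℂ :=
  pw q N κ (zext z) * cauchyProd q α d z * pairProd q d z

section identities
variable {q : ℂ} (hq0 : q ≠ 0) (hq : ‖q‖ < 1) {N : ℕ} (hN : 1 ≤ N) {α z : Fin N → ℂ}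
  {κ : ℕ → ℤ} (hz : ∀ j, z j ≠ 0) (hinj : Function.Injective z)
include hq0 hq hN hz hinj

/-- The eigenvalue relation of a q-difference operator. By `pw_update` the i-th term expands in
powers z_i^#S with #S < N, and the interpolation weights annihilate every power except the zeroth,
that is, every S ≠ ∅. -/
theorem sum_rowIntegrand_shift (hκ : IsSignature N κ) :
    ∑ i, rowIntegrand q κ α (Function.update 1 i q) (Function.update z i (q * z i)) =
      q ^ κ N * rowIntegrand q κ α 1 z := by
  obtain ⟨n, rfl⟩ : ∃ n, N = n + 1 := ⟨N - 1, by omega⟩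
  have h : ∀ i : Fin (n + 1),
      rowIntegrand q κ α (Function.update 1 i q) (Function.update z i (q * z i)) =
      q ^ κ (n + 1) * (cauchyProd q α 1 z * pairProd q 1 z * ∑ S ∈ (Icc 1 n).powerset,
        (-1) ^ #S * psi q (n + 1) S κ * pw q (n + 1) (κ - ind S) (zext z) *
          (z i ^ #S * ∏ l ∈ {i}ᶜ, (1 - z i / z l)⁻¹)) := by
    intro i
    rw [rowIntegrand, cauchyProd_shift hq0, pairProd_shift hq0 hq hz i hinj, zext_update,
      ← zext_apply z i, pw_update hq0 hq n hκ (zext_ne_zero hz) (Nat.lt_succ_iff.mp i.2)]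
    simp only [mul_sum, sum_mul]
    refine sum_congr rfl fun S _ => ?_
    rw [neg_pow]
    ring
  simp only [h]
  rw [← mul_sum, ← mul_sum, sum_comm, rowIntegrand]
  have h2 : ∀ S ∈ (Icc 1 n).powerset, ∑ i : Fin (n + 1),
      (-1) ^ #S * psi q (n + 1) S κ * pw q (n + 1) (κ - ind S) (zext z) *
          (z i ^ #S * ∏ l ∈ {i}ᶜ, (1 - z i / z l)⁻¹) =
      if S = ∅ then pw q (n + 1) κ (zext z) else 0 := by
    intro S hS
    have hc : #S < Fintype.card (Fin (n + 1)) := by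
      have := card_le_card (mem_powerset.mp hS)
      simp at this ⊢
      omega
    rw [← mul_sum, sum_pow_mul_prod hinj hz hc]
    simp only [card_eq_zero]
    split_ifs with h0
    · subst h0
      have : κ - ind ∅ = κ := by funext j; simp [ind]
      simp [psi, this]
    · rw [mul_zero]
  rw [sum_congr rfl h2, sum_ite_eq' _ ∅, if_pos (by simp)]
  ring

omit hq0 hN in
-- Without the shift of z_i, the scale contributes ∏ (1 - α_k / z_i) and interpolation weights at
-- the nodes 1 / z_i. The product of the nodes in the correction term is absorbed by lowering κ by
-- one.
theorem sum_rowIntegrand (hα : ∀ k j, ‖α k‖ < ‖z j‖) :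
    ∑ i, rowIntegrand q κ α (Function.update 1 i q) z =
      rowIntegrand q κ α 1 z -
        (∏ k, α k) * rowIntegrand q (κ - ind (Icc 1 N)) α 1 z := by
  have h : ∀ i, rowIntegrand q κ α (Function.update 1 i q) z =
      rowIntegrand q κ α 1 z * ((∏ k, (1 - α k * (z i)⁻¹)) *
        ∏ j ∈ {i}ᶜ, (1 - (z i)⁻¹ / (z j)⁻¹)⁻¹) := by
    intro i
    rw [rowIntegrand, cauchyProd_update hq α hz i hα, pairProd_update hq hz i hinj, rowIntegrand]
    ring
  simp only [h]
  rw [← mul_sum, sum_prod_one_sub_mul_prod (v := fun i => (z i)⁻¹)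
    (fun x y e => hinj (inv_injective e)) (fun i => inv_ne_zero (hz i)), rowIntegrand,
    rowIntegrand, pw_sub_one q N κ (zext_ne_zero hz), ← Fin.prod_univ_eq_prod_range]
  simp only [zext_apply, prod_inv_distrib]
  ring

end identities


theorem differentiableOn_prod {ι : Type*} {N : ℕ} {U : Set (Fin N → ℂ)} (s : Finset ι)
    {f : ι → (Fin N → ℂ) → ℂ} (h : ∀ i ∈ s, DifferentiableOn ℂ (f i) U) :
    DifferentiableOn ℂ (fun z => ∏ i ∈ s, f i z) U := by
  classical
  induction s using Finset.induction_on with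
  | empty => simp
  | insert i s hi ih =>
    simp only [prod_insert hi]
    exact (h i (mem_insert_self i s)).mul (ih fun j hj => h j (mem_insert_of_mem hj))

section analytic
variable {q : ℂ} (hq0 : q ≠ 0) (hq : ‖q‖ < 1)
include hq0 hq

theorem differentiableOn_pw (N n : ℕ) (κ : ℕ → ℤ) :
    DifferentiableOn ℂ (fun z : Fin N → ℂ => pw q n κ (zext z)) {z | ∀ j, z j ≠ 0} := by
  induction n generalizing κ with
  | zero => simp only [pw]; exact differentiableOn_const _
  | succ n ih =>
    have hext : DifferentiableOn ℂ (fun z : Fin N → ℂ => zext z n) {z | ∀ j, z j ≠ 0} := by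
      unfold zext
      split_ifs with h
      · exact (differentiable_apply (𝕜 := ℂ) (F' := fun _ : Fin N => ℂ) _).differentiableOn
      · exact differentiableOn_const _
    have h : ∀ z ∈ {z : Fin N → ℂ | ∀ j, z j ≠ 0}, pw q (n + 1) κ (zext z) =
        ∑ mu ∈ rowBox n κ, (zext z n ^ (rowSum (n + 1) κ - rowSum n mu) *
          ∏ i ∈ Icc 1 n, bond q (κ i) (κ (i + 1)) (mu i)) * pw q n mu (zext z) := by
      intro z hz
      rw [pw_succ_eq_sum hq0 hq n κ _ (zext_ne_zero hz n)]
      refine sum_congr rfl fun mu hmu => ?_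
      rw [branch, if_pos (mem_rowBox.mp hmu).1, skewP_eq q _ _ _ (zext_ne_zero hz n)]
      rfl
    refine DifferentiableOn.congr (DifferentiableOn.fun_sum fun mu _ => ?_) h
    refine DifferentiableOn.mul (DifferentiableOn.mul_const ?_ _) (ih mu)
    exact fun z hz => (hext z hz).zpow (Or.inl (zext_ne_zero hz n))

omit hq0 in
theorem differentiableOn_cauchyProd {N : ℕ} {α d : Fin N → ℂ} {c : Fin N → ℝ}
    (hc : ∀ j, 0 ≤ c j) (hd : ∀ j k, ‖d j * α k‖ ≤ c j) :
    DifferentiableOn ℂ (cauchyProd q α d) (polyExterior c) := by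
  refine differentiableOn_prod _ fun k _ => differentiableOn_prod _ fun j _ => ?_
  simp only [one_div]
  refine DifferentiableOn.inv ?_ fun z hz => ?_
  · simp only [div_eq_mul_inv]
    exact (differentiable_qPochInf hq).comp_differentiableOn
      (((differentiable_apply (𝕜 := ℂ) (F' := fun _ : Fin N => ℂ) j).differentiableOn.inv
        fun z (hz : z ∈ polyExterior c) =>
          norm_pos_iff.mp ((hc j).trans_lt (hz j))).const_mul _)
  · refine qPochInf_ne_zero hq ?_
    rw [norm_div, div_lt_one ((hc j).trans_lt (hz j))]
    exact (hd j k).trans_lt (hz j)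

omit hq0 in
theorem differentiableOn_pairProd {N : ℕ} (d : Fin N → ℂ) {c : Fin N → ℝ}
    (hc : ∀ j, 0 ≤ c j) : DifferentiableOn ℂ (pairProd q d) (polyExterior c) := by
  have hcoord : ∀ j, DifferentiableOn ℂ (fun z : Fin N → ℂ => z j) (polyExterior c) := fun j =>
    (differentiable_apply (𝕜 := ℂ) (F' := fun _ : Fin N => ℂ) j).differentiableOn
  refine differentiableOn_prod _ fun l _ => differentiableOn_prod _ fun j _ => ?_
  simp only [div_eq_mul_inv]
  exact (differentiable_qPochInf hq).comp_differentiableOn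
    (((hcoord j).const_mul _).mul
      ((hcoord l).inv fun z hz => norm_pos_iff.mp ((hc l).trans_lt (hz l))))

theorem differentiableOn_rowIntegrand {N : ℕ} (κ : ℕ → ℤ) {α d : Fin N → ℂ} {c : Fin N → ℝ}
    (hc : ∀ j, 0 ≤ c j) (hd : ∀ j k, ‖d j * α k‖ ≤ c j) :
    DifferentiableOn ℂ (rowIntegrand q κ α d) (polyExterior c) := by
  have hsub : polyExterior c ⊆ {z : Fin N → ℂ | ∀ j, z j ≠ 0} := fun z hz j =>
    norm_pos_iff.mp ((hc j).trans_lt (hz j))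
  exact (((differentiableOn_pw hq0 hq N N κ).mono hsub).mul
    (differentiableOn_cauchyProd hq hc hd)).mul (differentiableOn_pairProd hq d hc)

end analytic

theorem torusAvg_sum {N : ℕ} {ι : Type*} (s : Finset ι) {R : Fin N → ℝ}
    {G : ι → (Fin N → ℂ) → ℂ} (hG : ∀ i ∈ s, IntegrableOn (fun θ => G i (torusMap 0 R θ))
      (Set.Icc (0 : Fin N → ℝ) (fun _ => 2 * Real.pi))) :
    torusAvg R (fun z => ∑ i ∈ s, G i z) = ∑ i ∈ s, torusAvg R (G i) :=
  integral_finsetSum s hG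

theorem torusAvg_congr {N : ℕ} {G H : (Fin N → ℂ) → ℂ}
    (h : ∀ z : Fin N → ℂ, (∀ j, ‖z j‖ = 1) → Function.Injective z → G z = H z) :
    torusAvg (fun _ => 1) G = torusAvg (fun _ => 1) H := by
  refine setIntegral_congr_ae measurableSet_Icc ?_
  filter_upwards [ae_injective_torusMap N] with θ hθ _
  exact h _ (norm_torusMap (R := fun _ => 1) (by simp) θ) hθ

/-- The torus integral attached to the row `κ`. -/
def rowIntegral (q : ℂ) {N : ℕ} (κ : ℕ → ℤ) (α : Fin N → ℂ) : ℂ :=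
  torusAvg (fun _ => 1) (rowIntegrand q κ α 1)

/-! ### Vanishing of the torus integral when the last part of the row is negative. -/

section vanishing
variable {q : ℝ} (hq0 : 0 < q) (hq1 : q < 1) {N : ℕ} (hN : 1 ≤ N) {α : Fin N → ℂ}
  {c : ℝ} (hc0 : 0 ≤ c) (hc1 : c < 1) (hα : ∀ k, ‖α k‖ ≤ c)
include hq0 hq1 hN hc0 hc1 hα

/-- Integrate the two preceding sums. Term by term the integrals agree: replacing z_i by q z_i
amounts to integrating over radius q in that coordinate, and the contour can be moved back to radius
1. -/
theorem rowIntegral_relation {κ : ℕ → ℤ} (hκ : IsSignature N κ) :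
    (1 - (q : ℂ) ^ κ N) * rowIntegral q κ α =
      (∏ k, α k) * rowIntegral q (κ - ind (Icc 1 N)) α := by
  have hqc0 : (q : ℂ) ≠ 0 := by exact_mod_cast hq0.ne'
  have hqc : ‖(q : ℂ)‖ < 1 := by simpa [abs_of_pos hq0] using hq1
  have hone : ∀ κ : ℕ → ℤ, DifferentiableOn ℂ (rowIntegrand (q : ℂ) κ α 1)
      (polyExterior fun _ => c) := fun κ =>
    differentiableOn_rowIntegrand hqc0 hqc κ (fun _ => hc0) (by simpa using fun _ => hα)
  -- Scale q in column i moves its poles into |z_i| ≤ q c, so holomorphy holds for |z_i| > q c, a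
  -- region containing both circles of radii q and 1.
  set cc : Fin N → Fin N → ℝ := fun i => Function.update (fun _ => c) i (q * c)
  set RR : Fin N → Fin N → ℝ := fun i => Function.update (fun _ => 1) i q
  have hcc0 : ∀ i j, 0 ≤ cc i j := by
    intro i j
    rcases eq_or_ne j i with rfl | h
    · simpa [cc] using mul_nonneg hq0.le hc0
    · simpa [cc, h] using hc0
  have hccR : ∀ i j, cc i j < RR i j := by
    intro i j
    rcases eq_or_ne j i with rfl | h
    · simpa [cc, RR] using mul_lt_of_lt_one_right hq0 hc1
    · simpa [cc, RR, h] using hc1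
  have hcc1 : ∀ i j, cc i j < 1 := by
    intro i j
    rcases eq_or_ne j i with rfl | h
    · simpa [cc] using (mul_le_of_le_one_left hc0 hq1.le).trans_lt hc1
    · simpa [cc, h] using hc1
  have hH : ∀ i, DifferentiableOn ℂ (rowIntegrand (q : ℂ) κ α (Function.update 1 i (q : ℂ)))
      (polyExterior (cc i)) := fun i => by
    refine differentiableOn_rowIntegrand hqc0 hqc κ (hcc0 i) fun j k => ?_
    rcases eq_or_ne j i with rfl | h
    · simpa [cc, abs_of_pos hq0] using mul_le_mul_of_nonneg_left (hα k) hq0.le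
    · simpa [cc, h] using hα k
  have hshift : ∀ (i : Fin N) (θ : Fin N → ℝ), torusMap 0 (RR i) θ =
      Function.update (torusMap 0 (fun _ => 1) θ) i ((q : ℂ) * torusMap 0 (fun _ => 1) θ i) := by
    intro i θ
    funext j
    rcases eq_or_ne j i with rfl | h
    · simp [torusMap, RR]
    · simp [torusMap, RR, h]
  have hnz : ∀ z : Fin N → ℂ, (∀ j, ‖z j‖ = 1) → ∀ j, z j ≠ 0 := fun z hz j =>
    norm_pos_iff.mp (by rw [hz j]; exact one_pos)
  have e1 : torusAvg (fun _ => 1) (fun z => ∑ i, rowIntegrand (q : ℂ) κ α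
      (Function.update 1 i (q : ℂ)) (Function.update z i ((q : ℂ) * z i))) =
      (q : ℂ) ^ κ N * rowIntegral q κ α := by
    rw [rowIntegral, torusAvg, torusAvg, ← integral_const_mul]
    exact torusAvg_congr (H := fun z => (q : ℂ) ^ κ N * rowIntegrand (q : ℂ) κ α 1 z)
      fun z hz hinj => sum_rowIntegrand_shift hqc0 hqc hN (hnz z hz) hinj hκ
  have e2 : torusAvg (fun _ => 1) (fun z => ∑ i, rowIntegrand (q : ℂ) κ α
      (Function.update 1 i (q : ℂ)) z) =
      rowIntegral q κ α - (∏ k, α k) * rowIntegral q (κ - ind (Icc 1 N)) α := by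
    rw [rowIntegral, rowIntegral, torusAvg, torusAvg, torusAvg, ← integral_const_mul,
      ← integral_sub (integrableOn_comp_torusMap (fun _ => hc0) (fun _ => hc1)
        (hone κ).continuousOn) ((integrableOn_comp_torusMap (fun _ => hc0) (fun _ => hc1)
        (hone _).continuousOn).const_mul _)]
    exact torusAvg_congr (H := fun z => rowIntegrand (q : ℂ) κ α 1 z -
        (∏ k, α k) * rowIntegrand (q : ℂ) (κ - ind (Icc 1 N)) α 1 z)
      fun z hz hinj => sum_rowIntegrand hqc (hnz z hz) hinj fun k j => by
        rw [hz j]; exact (hα k).trans_lt hc1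
  have e3 : ∀ i, torusAvg (fun _ => 1) (fun z => rowIntegrand (q : ℂ) κ α
      (Function.update 1 i (q : ℂ)) (Function.update z i ((q : ℂ) * z i))) =
      torusAvg (fun _ => 1) (rowIntegrand (q : ℂ) κ α (Function.update 1 i (q : ℂ))) := by
    intro i
    rw [← torusAvg_eq (hcc0 i) (hccR i) (hcc1 i) (hH i), torusAvg, torusAvg]
    simp only [hshift]
  rw [torusAvg_sum] at e1 e2
  · simp only [e3] at e1
    linear_combination e1 - e2
  · exact fun i _ => integrableOn_comp_torusMap (hcc0 i) (hcc1 i) (hH i).continuousOn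
  · intro i _
    have := integrableOn_comp_torusMap (hcc0 i) (hccR i) (hH i).continuousOn
    simpa only [hshift] using this

/-- If ∏ α_k = 0, the relation reads (1 - q^(κ_N)) I(κ) = 0. Otherwise κ_N = 0 gives the vanishing
of I(κ - 1), and the relation propagates it to all lower translates. -/
theorem rowIntegral_eq_zero {κ : ℕ → ℤ} (hκ : IsSignature N κ) (hneg : κ N < 0) :
    rowIntegral q κ α = 0 := by
  have hrel := @rowIntegral_relation q hq0 hq1 N hN α c hc0 hc1 hα
  have hq' : ∀ m : ℤ, m ≠ 0 → 1 - (q : ℂ) ^ m ≠ 0 := fun m hm h => by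
    have h1 : q ^ m = 1 := by exact_mod_cast (sub_eq_zero.mp h).symm
    exact hm ((zpow_eq_one_iff_right₀ hq0.le hq1.ne).mp h1)
  by_cases hprod : ∏ k, α k = 0
  · have h := hrel hκ
    rw [hprod, zero_mul] at h
    exact (mul_eq_zero.mp h).resolve_left (hq' _ hneg.ne)
  · obtain ⟨m, hm⟩ : ∃ m : ℕ, κ N = -(m + 1 : ℕ) := ⟨(-κ N - 1).toNat, by omega⟩
    clear hneg
    induction m generalizing κ with
    | zero =>
      have hs : IsSignature N (κ + ind (Icc 1 N)) := fun i j h1 h2 h3 => by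
        simp only [Pi.add_apply, ind_Icc h1 (h2.trans h3), ind_Icc (h1.trans h2) h3]
        linarith [hκ i j h1 h2 h3]
      have h := hrel hs
      have h0 : (κ + ind (Icc 1 N)) N = 0 := by
        rw [Pi.add_apply, ind_Icc hN le_rfl, hm]; simp
      rw [h0, zpow_zero, sub_self, zero_mul, add_sub_cancel_right] at h
      exact (mul_eq_zero.mp h.symm).resolve_left hprod
    | succ m ih =>
      have hs : IsSignature N (κ + ind (Icc 1 N)) := fun i j h1 h2 h3 => by
        simp only [Pi.add_apply, ind_Icc h1 (h2.trans h3), ind_Icc (h1.trans h2) h3]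
        linarith [hκ i j h1 h2 h3]
      have h := hrel hs
      rw [ih hs (by rw [Pi.add_apply, ind_Icc hN le_rfl, hm]; push_cast; ring), mul_zero,
        add_sub_cancel_right] at h
      exact (mul_eq_zero.mp h.symm).resolve_left hprod

end vanishing

end QWhittaker
end
-- Exponential bounds and summability at time 0.
noncomputable section
namespace QWhittaker
open Finset MeasureTheory

section bounds
variable {q : ℂ} (hq0 : q ≠ 0) (hq : ‖q‖ < 1)
include hq0 hq

theorem exists_bound_bond : ∃ K : ℝ, 1 ≤ K ∧ ∀ x y m : ℤ, ‖bond q x y m‖ ≤ K := by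
  obtain ⟨K₁, h₁, hb₁⟩ := exists_bound_qPoch hq0 hq
  obtain ⟨K₂, h₂, hb₂⟩ := exists_bound_qInv hq0 hq
  refine ⟨K₁ * K₂ * K₂, one_le_mul_of_one_le_of_one_le (one_le_mul_of_one_le_of_one_le h₁ h₂) h₂,
    fun x y m => ?_⟩
  rw [bond, norm_mul, norm_mul]
  gcongr
  · exact hb₁ _
  · exact hb₂ _
  · exact hb₂ _

theorem exists_bound_chainArr (n : ℕ) : ∃ K : ℝ, 0 < K ∧ ∀ (A : ℕ → ℕ → ℤ) (z : ℕ → ℂ),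
    (∀ k, z k ≠ 0) → ‖chainArr q n A z‖ ≤
      K * ∏ k ∈ range n, ‖z k‖ ^ (rowSum (k + 1) (A (k + 1)) - rowSum k (A k)) := by
  obtain ⟨K, hK, hb⟩ := exists_bound_bond hq0 hq
  have hK0 : 0 < K := one_pos.trans_le hK
  refine ⟨∏ k ∈ range n, K ^ k, prod_pos fun _ _ => pow_pos hK0 _, fun A z hz => ?_⟩
  rw [chainArr, norm_prod, ← prod_mul_distrib]
  refine prod_le_prod (fun _ _ => norm_nonneg _) fun k _ => ?_
  rw [skewP_eq q _ _ _ (hz k), norm_mul, norm_zpow, mul_comm, norm_prod]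
  refine mul_le_mul_of_nonneg_right ?_ (zpow_nonneg (norm_nonneg _) _)
  calc _ ≤ ∏ i ∈ Icc 1 (k + 1 - 1), K :=
        prod_le_prod (fun _ _ => norm_nonneg _) fun _ _ => hb _ _ _
    _ = K ^ k := by simp

end bounds

theorem prod_zpow_rowSum_sub {s : ℝ} (hs : s ≠ 0) (n : ℕ) (A : ℕ → ℕ → ℤ) :
    ∏ k ∈ range n, s ^ (rowSum (k + 1) (A (k + 1)) - rowSum k (A k)) = s ^ rowSum n (A n) := by
  induction n with
  | zero => simp [rowSum]
  | succ n ih => rw [prod_range_succ, ih, ← zpow_add₀ hs]; congr 1; ring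

section bounds
variable {q : ℂ} (hq0 : q ≠ 0) (hq : ‖q‖ < 1)
include hq0 hq

/-- When all variables have modulus r, the degrees of the successive rows telescope to r^|κ| in
every array; the number of arrays is polynomial in κ_1 - κ_N. -/
theorem exists_bound_pw (N : ℕ) : ∃ K : ℝ, 0 < K ∧ ∀ (κ : ℕ → ℤ) (z : Fin N → ℂ) (r : ℝ),
    IsSignature N κ → κ N ≤ κ 1 → 0 < r → (∀ j, ‖z j‖ = r) →
      ‖pw q N κ (zext z)‖ ≤ K * r ^ rowSum N κ * (κ 1 - κ N + 1) ^ (N * N) := by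
  classical
  obtain ⟨K, hK, hb⟩ := exists_bound_chainArr hq0 hq N
  refine ⟨K, hK, fun κ z r hκ hle hr hz => ?_⟩
  have hz0 : ∀ j, z j ≠ 0 := fun j => norm_pos_iff.mp (by rw [hz j]; exact hr)
  rw [← pw_eq_finsum hq0 hq N hκ (zext_ne_zero hz0)]
  set S : Set (GTCone N) := {x : GTCone N | ∀ i, 1 ≤ i → i ≤ N → x.entry N i = κ i}
  have hS : S.Finite := (GTCone.finite_of_bounds hle).subset fun x hx hN =>
    ⟨(hx N hN le_rfl).ge, (hx 1 le_rfl hN).le⟩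
  rw [finsum_mem_eq_finite_toFinset_sum _ hS]
  have hterm : ∀ x ∈ hS.toFinset, ‖chainArr q N x.entry (zext z)‖ ≤ K * r ^ rowSum N κ := by
    intro x hx
    refine (hb _ _ (zext_ne_zero hz0)).trans_eq ?_
    have e : rowSum N (x.entry N) = rowSum N κ := sum_congr rfl fun i hi =>
      (hS.mem_toFinset.mp hx) i (mem_Icc.mp hi).1 (mem_Icc.mp hi).2
    rw [← e, ← prod_zpow_rowSum_sub hr.ne']
    congr 1
    refine prod_congr rfl fun k hk => ?_
    rw [← hz ⟨k, mem_range.mp hk⟩, zext, dif_pos (mem_range.mp hk)]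
  have hcard : (#hS.toFinset : ℝ) ≤ (κ 1 - κ N + 1) ^ (N * N) :=
    GTCone.card_le hle _ fun x hx hN =>
      ⟨((hS.mem_toFinset.mp hx) N hN le_rfl).ge, ((hS.mem_toFinset.mp hx) 1 le_rfl hN).le⟩
  calc _ ≤ ∑ x ∈ hS.toFinset, ‖chainArr q N x.entry (zext z)‖ := norm_sum_le _ _
    _ ≤ ∑ x ∈ hS.toFinset, K * r ^ rowSum N κ := sum_le_sum hterm
    _ = #hS.toFinset * (K * r ^ rowSum N κ) := by rw [sum_const, nsmul_eq_mul]
    _ ≤ (κ 1 - κ N + 1) ^ (N * N) * (K * r ^ rowSum N κ) := by gcongr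
    _ = _ := by ring

/-- The torus is moved to radius r; only the factor `pw` depends on κ, and the rest is bounded on
the compact torus. -/
theorem exists_bound_rowIntegral {N : ℕ} {α : Fin N → ℂ} {c r : ℝ} (hc0 : 0 ≤ c) (hc1 : c < 1)
    (hα : ∀ k, ‖α k‖ ≤ c) (hr : c < r) : ∃ K : ℝ, 0 < K ∧ ∀ κ : ℕ → ℤ,
      IsSignature N κ → κ N ≤ κ 1 →
        ‖rowIntegral q κ α‖ ≤ K * r ^ rowSum N κ * (κ 1 - κ N + 1) ^ (N * N) := by
  obtain ⟨K, hK, hb⟩ := exists_bound_pw hq0 hq N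
  have hr0 : 0 < r := hc0.trans_lt hr
  have hd : ∀ j k : Fin N, ‖(1 : Fin N → ℂ) j * α k‖ ≤ c := by simpa using fun _ => hα
  have hcont := continuous_comp_torusMap (N := N) (c := fun _ => c) (R := fun _ => r)
    (fun _ => hc0) (fun _ => hr) ((differentiableOn_cauchyProd (α := α) (d := 1) hq
      (fun _ => hc0) hd).mul (differentiableOn_pairProd hq 1 fun _ => hc0)).continuousOn
  obtain ⟨M, hM⟩ := isCompact_Icc.exists_bound_of_continuousOn
    (s := Set.Icc (0 : Fin N → ℝ) (fun _ => 2 * Real.pi)) hcont.continuousOn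
  set V : ℝ := volume.real (Set.Icc (0 : Fin N → ℝ) (fun _ => 2 * Real.pi))
  refine ⟨K * max M 1 * (V + 1), by positivity, fun κ hκ hle => ?_⟩
  rw [rowIntegral, torusAvg_eq (R' := fun _ => r) (c := fun _ => c) (fun _ => hc0) (fun _ => hc1)
    (fun _ => hr) (differentiableOn_rowIntegrand hq0 hq κ (fun _ => hc0) hd)]
  have hle' : (0 : ℝ) ≤ κ 1 - κ N + 1 := by
    have : (κ N : ℝ) ≤ κ 1 := by exact_mod_cast hle
    linarith
  refine (norm_setIntegral_le_of_norm_le_const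
    (C := K * r ^ rowSum N κ * (κ 1 - κ N + 1) ^ (N * N) * max M 1)
    isCompact_Icc.measure_lt_top fun θ hθ => ?_).trans ?_
  · rw [rowIntegrand, mul_assoc, norm_mul]
    gcongr
    · exact hb κ _ r hκ hle hr0 fun j => norm_torusMap (R := fun _ => r) (fun _ => hr0.le) θ j
    · exact (hM θ hθ).trans (le_max_left _ _)
  · calc _ ≤ K * r ^ rowSum N κ * (κ 1 - κ N + 1) ^ (N * N) * max M 1 * (V + 1) := by
          gcongr
          linarith
      _ = _ := by ring

end bounds

theorem sum_Icc_succ_bot {M : Type*} [AddCommMonoid M] (f : ℕ → M) (k : ℕ) :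
    ∑ i ∈ Icc 1 (k + 1), f i = f 1 + ∑ i ∈ Icc 1 k, f (i + 1) := by
  induction k with
  | zero => simp
  | succ k ih => rw [sum_Icc_succ_top (by omega), ih, sum_Icc_succ_top (by omega), add_assoc]

/-- The difference is the first entry of row k + 1 plus ∑ (x^(k+1)_{i+1} - x^(k)_i), whose terms are
nonpositive by interlacing. -/
theorem rowSum_sub_nonpos {N : ℕ} (x : GTCone N) (hx : x.entry N 1 ≤ 0) {k : ℕ} (hk : k < N) :
    rowSum (k + 1) (x.entry (k + 1)) - rowSum k (x.entry k) ≤ 0 := by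
  have h : rowSum (k + 1) (x.entry (k + 1)) =
      x.entry (k + 1) 1 + ∑ i ∈ Icc 1 k, x.entry (k + 1) (i + 1) := sum_Icc_succ_bot _ k
  have h1 := x.entry_le (k := k + 1) (j := 1) le_rfl (by omega) hk
  have h2 : ∑ i ∈ Icc 1 k, x.entry (k + 1) (i + 1) ≤ rowSum k (x.entry k) :=
    sum_le_sum fun i hi => (x.interlacing k i (mem_Icc.mp hi).1 (mem_Icc.mp hi).2 hk).1
  linarith

/-- All exponents of the a_k are nonpositive here, so each a_k may be replaced by the lower bound s,
after which the exponents telescope. -/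
theorem exists_bound_chainP {q : ℂ} (hq0 : q ≠ 0) (hq : ‖q‖ < 1) {N : ℕ} {a : Fin N → ℝ} {s : ℝ}
    (hs : 0 < s) (ha : ∀ j, s ≤ a j) : ∃ K : ℝ, 0 < K ∧ ∀ x : GTCone N, x.entry N 1 ≤ 0 →
      ‖chainP q x fun j => (a j : ℂ)‖ ≤ K * s ^ rowSum N (x.entry N) := by
  obtain ⟨K, hK, hb⟩ := exists_bound_chainArr hq0 hq N
  refine ⟨K, hK, fun x hx => ?_⟩
  rw [chainP_eq_chainArr]
  refine (hb _ _ (zext_ne_zero fun j => ?_)).trans ?_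
  · exact_mod_cast (hs.trans_le (ha j)).ne'
  · rw [← prod_zpow_rowSum_sub hs.ne']
    refine mul_le_mul_of_nonneg_left (prod_le_prod (fun _ _ => zpow_nonneg (norm_nonneg _) _)
      fun k hk => ?_) hK.le
    have hk := mem_range.mp hk
    have hn : ‖zext (fun j => (a j : ℂ)) k‖ = a ⟨k, hk⟩ := by
      rw [zext, dif_pos hk, Complex.norm_real, Real.norm_of_nonneg (hs.le.trans (ha _))]
    rw [hn]
    have hd := rowSum_sub_nonpos x hx hk
    obtain ⟨m, hm⟩ := Int.eq_ofNat_of_zero_le (neg_nonneg.mpr hd)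
    rw [← neg_neg (rowSum (k + 1) _ - _), hm, zpow_neg, zpow_neg, zpow_natCast, zpow_natCast]
    exact inv_anti₀ (pow_pos hs m) (pow_le_pow_left₀ hs.le (ha _) m)

/-- The prefactor of the row `lam`. -/
def rowWeight (q : ℂ) (N : ℕ) (lam : ℕ → ℤ) : ℂ :=
  ∏ i ∈ Icc 1 (N - 1), qTail q (lam i - lam (i + 1))

theorem exists_bound_rowWeight {q : ℂ} (hq0 : q ≠ 0) (hq : ‖q‖ < 1) (N : ℕ) :
    ∃ K : ℝ, 0 < K ∧ ∀ lam : ℕ → ℤ, ‖rowWeight q N lam‖ ≤ K := by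
  obtain ⟨K, hK, hb⟩ := exists_bound_qTail hq0 hq
  refine ⟨∏ i ∈ Icc 1 (N - 1), K, prod_pos fun _ _ => hK, fun lam => ?_⟩
  rw [rowWeight, norm_prod]
  exact prod_le_prod (fun _ _ => norm_nonneg _) fun _ _ => hb _

/-- A function on the cone supported on arrays with nonpositive entries and decaying exponentially
in the smallest entry is summable. -/
theorem summable_of_exponential_decay {N : ℕ} {f : GTCone N → ℂ} {C ρ : ℝ} {m : ℕ}
    (hC : 0 ≤ C) (hρ0 : 0 ≤ ρ) (hρ1 : ρ < 1) (hzero : ∀ x, 0 < x.entry N 1 → f x = 0)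
    (hf : ∀ x, x.entry N 1 ≤ 0 →
      ‖f x‖ ≤ C * ((-x.entry N N).toNat + 1) ^ m * ρ ^ (-x.entry N N).toNat) :
    Summable fun x => ‖f x‖ := by
  classical
  set g : ℕ → ℝ := fun n => C * ((n : ℝ) + 1) ^ (m + N * N) * ρ ^ n
  have hg : Summable g := by
    have h := (summable_nat_add_iff 1).mpr
      (summable_pow_mul_geometric_of_norm_lt_one (m + N * N) (r := ρ)
        (by rwa [Real.norm_of_nonneg hρ0]))
    rcases hρ0.eq_or_lt with rfl | hρ
    · refine summable_of_ne_finset_zero (s := {0}) fun n hn => ?_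
      simp [g, zero_pow (by simpa using hn : n ≠ 0)]
    · refine (h.mul_left (C * ρ⁻¹)).congr fun n => ?_
      simp only [g]
      push_cast
      rw [pow_succ]
      field_simp
  have hg0 : ∀ n, 0 ≤ g n := fun n => by positivity
  refine summable_of_sum_le (fun _ => norm_nonneg _) (c := ∑' n, g n) fun u => ?_
  have h1 : ∑ x ∈ u, ‖f x‖ = ∑ x ∈ u with x.entry N 1 ≤ 0, ‖f x‖ := by
    rw [sum_filter]
    refine sum_congr rfl fun x _ => ?_
    split_ifs with h
    · rfl
    · rw [hzero x (not_le.mp h), norm_zero]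
  rw [h1, ← sum_fiberwise_of_maps_to (t := (u.image fun x => (-x.entry N N).toNat))
    (g := fun x => (-x.entry N N).toNat)
    fun x hx => mem_image_of_mem _ (mem_filter.mp hx).1]
  refine (sum_le_sum fun n _ => ?_).trans (hg.sum_le_tsum _ fun n _ => hg0 n)
  set v := {x ∈ {x ∈ u | x.entry N 1 ≤ 0} | (-x.entry N N).toNat = n}
  have hv : ∀ x ∈ v, x.entry N 1 ≤ 0 ∧ (-x.entry N N).toNat = n := fun x hx => by
    simp only [v, mem_filter] at hx
    exact ⟨hx.1.2, hx.2⟩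
  have hcard : (#v : ℝ) ≤ (n + 1) ^ (N * N) := by
    have := GTCone.card_le (lo := -n) (hi := 0) (by omega) v fun x hx _ => by
      have := hv x hx
      omega
    simpa using this
  calc ∑ x ∈ v, ‖f x‖ ≤ ∑ x ∈ v, C * ((n : ℝ) + 1) ^ m * ρ ^ n := sum_le_sum fun x hx => by
        have := hf x (hv x hx).1
        rwa [(hv x hx).2] at this
    _ = #v * (C * ((n : ℝ) + 1) ^ m * ρ ^ n) := by rw [sum_const, nsmul_eq_mul]
    _ ≤ (n + 1) ^ (N * N) * (C * ((n : ℝ) + 1) ^ m * ρ ^ n) := by gcongr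
    _ = g n := by simp only [g]; ring

/-- The process at time `0` is absolutely summable, up to a constant factor. -/
theorem summable_initial {q : ℝ} (hq0 : 0 < q) (hq1 : q < 1) {N : ℕ} (hN : 1 ≤ N)
    {a α : Fin N → ℝ} (hα0 : ∀ i, 0 ≤ α i) (hα1 : ∀ i, α i < 1) (hαa : ∀ i j, α i < a j) :
    Summable fun x : GTCone N => ‖chainP (q : ℂ) x (fun j => (a j : ℂ)) *
      (rowWeight q N (x.entry N) * rowIntegral q (refl N (x.entry N)) fun j => (α j : ℂ))‖ := by
  have hqc0 : (q : ℂ) ≠ 0 := by exact_mod_cast hq0.ne'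
  have hqc : ‖(q : ℂ)‖ < 1 := by simpa [abs_of_pos hq0] using hq1
  have : Nonempty (Fin N) := ⟨⟨0, hN⟩⟩
  obtain ⟨i₀, hi₀⟩ := Finite.exists_max α
  obtain ⟨j₀, hj₀⟩ := Finite.exists_min a
  -- r > max α allows the contours to be moved to radius r, and r < min a makes r / min a the rate
  -- of decay.
  obtain ⟨r, hr1, hr2⟩ := exists_between (hαa i₀ j₀)
  have hr0 : 0 < r := (hα0 i₀).trans_lt hr1
  have hs0 : 0 < a j₀ := hr0.trans hr2
  have hα : ∀ k, ‖((α k : ℝ) : ℂ)‖ ≤ α i₀ := fun k => by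
    rw [Complex.norm_real, Real.norm_of_nonneg (hα0 k)]; exact hi₀ k
  obtain ⟨K₁, hK₁, hb₁⟩ := exists_bound_chainP (N := N) hqc0 hqc hs0 hj₀
  obtain ⟨K₂, hK₂, hb₂⟩ := exists_bound_rowWeight hqc0 hqc N
  obtain ⟨K₃, hK₃, hb₃⟩ := exists_bound_rowIntegral hqc0 hqc (hα0 i₀) (hα1 i₀) hα hr1
  have hsig : ∀ x : GTCone N, IsSignature N (x.entry N) := fun x => x.signature N hN le_rfl
  have htop : ∀ x : GTCone N, refl N (x.entry N) N = -x.entry N 1 := fun x => by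
    rw [refl_apply _ hN le_rfl]; simp
  have hbot : ∀ x : GTCone N, refl N (x.entry N) 1 = -x.entry N N := fun x => by
    rw [refl_apply _ le_rfl hN]; simp
  refine summable_of_exponential_decay (C := K₁ * (K₂ * K₃)) (ρ := r / a j₀) (m := N * N)
    (by positivity) (by positivity) ((div_lt_one hs0).mpr hr2) (fun x hx => ?_) fun x hx => ?_
  · rw [rowIntegral_eq_zero hq0 hq1 hN (hα0 i₀) (hα1 i₀) hα (hsig x).refl
      (by rw [htop]; omega), mul_zero, mul_zero]
  · have hle : x.entry N N ≤ x.entry N 1 := hsig x 1 N le_rfl hN le_rfl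
    have h3 := hb₃ _ (hsig x).refl (by rw [htop, hbot]; omega)
    rw [htop, hbot, rowSum_refl] at h3
    set n := (-x.entry N N).toNat
    have hn : -x.entry N N = n := by omega
    have hn' : (-x.entry N N : ℝ) = n := by exact_mod_cast hn
    set S := rowSum N (x.entry N)
    have hS : S ≤ -n := by
      have : S ≤ x.entry N N := by
        have h0 : ∀ i ∈ Icc 1 N, 0 ≤ -x.entry N i := fun i hi => by
          have := x.entry_le (mem_Icc.mp hi).1 (mem_Icc.mp hi).2 le_rfl
          omega
        have := single_le_sum h0 (mem_Icc.mpr ⟨hN, le_rfl⟩)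
        simp only [sum_neg_distrib] at this
        change -x.entry N N ≤ -S at this
        omega
      omega
    have hx' : (x.entry N 1 : ℝ) ≤ 0 := by exact_mod_cast hx
    have hle' : (x.entry N N : ℝ) ≤ x.entry N 1 := by exact_mod_cast hle
    rw [norm_mul, norm_mul]
    calc _ ≤ (K₁ * a j₀ ^ S) * (K₂ * (K₃ * r ^ (-S) *
          (((-x.entry N N : ℤ) : ℝ) - ((-x.entry N 1 : ℤ) : ℝ) + 1) ^ (N * N))) := by
          gcongr
          · exact hb₁ x hx
          · exact hb₂ _
      _ ≤ (K₁ * a j₀ ^ S) * (K₂ * (K₃ * r ^ (-S) * ((n : ℝ) + 1) ^ (N * N))) := by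
          gcongr
          · push_cast
            linarith
          · push_cast
            linarith
      _ = K₁ * (K₂ * K₃) * ((n : ℝ) + 1) ^ (N * N) * (r / a j₀) ^ (-S) := by
          rw [div_zpow, zpow_neg (a j₀), div_inv_eq_mul]
          ring
      _ ≤ _ := by
          gcongr
          rw [← zpow_natCast]
          exact zpow_le_zpow_right_of_le_one₀ (by positivity) ((div_lt_one hs0).mpr hr2).le
            (by omega)

end QWhittaker
end
-- Rates, admissible moves and the autonomous edge.
noncomputable section
namespace QWhittaker
open Finset

section rates
variable {q : ℝ} (hq0 : 0 < q) (hq1 : q < 1) {N : ℕ} (x : GTCone N) {j k : ℕ} (hj : 1 ≤ j)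
  (hjk : j ≤ k) (hk : k ≤ N)
include hq0 hq1 hj hjk hk

theorem rate_blocking_nonneg :
    0 ≤ (if j = 1 then (1 : ℝ) else 1 - q ^ (x.entry (k - 1) (j - 1) - x.entry k j)) ∧
      (if j = 1 then (1 : ℝ) else 1 - q ^ (x.entry (k - 1) (j - 1) - x.entry k j)) ≤ 1 := by
  split_ifs with h
  · exact ⟨zero_le_one, le_rfl⟩
  · have hint := (x.interlacing (k - 1) (j - 1) (by omega) (by omega) (by omega)).1
    rw [show k - 1 + 1 = k by omega, show j - 1 + 1 = j by omega] at hint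
    exact ⟨sub_nonneg.mpr (zpow_le_one₀ hq0 hq1.le (by omega)),
      sub_le_self _ (zpow_nonneg hq0.le _)⟩

theorem rate_pushing_nonneg :
    0 ≤ (if j = k then (1 : ℝ) else (1 - q ^ (x.entry k j - x.entry k (j + 1) + 1)) /
        (1 - q ^ (x.entry k j - x.entry (k - 1) j + 1))) ∧
      (if j = k then (1 : ℝ) else (1 - q ^ (x.entry k j - x.entry k (j + 1) + 1)) /
        (1 - q ^ (x.entry k j - x.entry (k - 1) j + 1))) ≤ (1 - q)⁻¹ := by
  have hq : 0 < 1 - q := sub_pos.mpr hq1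
  split_ifs with h
  · exact ⟨zero_le_one, (one_le_inv₀ hq).mpr (by linarith)⟩
  · have hint := (x.interlacing (k - 1) j hj (by omega) (by omega)).2
    rw [show k - 1 + 1 = k by omega] at hint
    have hsig := x.signature k (by omega) hk j (j + 1) hj (by omega) (by omega)
    have hnum : 0 ≤ 1 - q ^ (x.entry k j - x.entry k (j + 1) + 1) :=
      sub_nonneg.mpr (zpow_le_one₀ hq0 hq1.le (by omega))
    have hden : 1 - q ≤ 1 - q ^ (x.entry k j - x.entry (k - 1) j + 1) := by
      refine sub_le_sub_left ?_ _
      calc q ^ (x.entry k j - x.entry (k - 1) j + 1) ≤ q ^ (1 : ℤ) :=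
            zpow_le_zpow_right_of_le_one₀ hq0 hq1.le (by omega)
        _ = q := zpow_one q
    refine ⟨div_nonneg hnum (hq.le.trans hden), ?_⟩
    rw [inv_eq_one_div]
    exact div_le_div₀ zero_le_one (sub_le_self _ (zpow_nonneg hq0.le _)) hq hden

theorem rate_nonneg {ak : ℝ} (ha : 0 ≤ ak) : 0 ≤ rate q ak x j k :=
  mul_nonneg (mul_nonneg ha (rate_blocking_nonneg hq0 hq1 x hj hjk hk).1)
    (rate_pushing_nonneg hq0 hq1 x hj hjk hk).1

theorem rate_le {ak : ℝ} (ha : 0 ≤ ak) : rate q ak x j k ≤ ak * (1 - q)⁻¹ := by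
  have h1 := rate_blocking_nonneg hq0 hq1 x hj hjk hk
  have h2 := rate_pushing_nonneg hq0 hq1 x hj hjk hk
  exact mul_le_mul (mul_le_of_le_one_right ha h1.2) h2.2 h2.1 ha

end rates

/-- Columns are nondecreasing in the upper index, so the particles sharing a position form an
interval of rows, and counting them locates its end. -/
theorem eq_iff_le_add_shareAbove {N : ℕ} (x : GTCone N) {j k b : ℕ} (hj : 1 ≤ j) (hjk : j ≤ k)
    (hkb : k ≤ b) (hb : b ≤ N) : x.entry b j = x.entry k j ↔ b ≤ k + shareAbove x j k := by
  have hmono : ∀ c d, k ≤ c → c ≤ d → d ≤ N → x.entry d j = x.entry k j →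
      x.entry c j = x.entry k j := fun c d h1 h2 h3 h =>
    le_antisymm ((x.le_entry_succ hj (hjk.trans h1) h2 h3).trans h.le)
      (x.le_entry_succ hj hjk h1 (h2.trans h3))
  constructor
  · intro h
    have hsub : Ioc k b ⊆ {c ∈ Ioc k N | x.entry c j = x.entry k j} := fun c hc => by
      have := mem_Ioc.mp hc
      exact mem_filter.mpr ⟨mem_Ioc.mpr ⟨this.1, by omega⟩, hmono c b (by omega) this.2 hb h⟩
    have := card_le_card hsub
    rw [Nat.card_Ioc] at this
    unfold shareAbove
    omega
  · intro h
    by_contra hne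
    have hsub : {c ∈ Ioc k N | x.entry c j = x.entry k j} ⊆ Ioo k b := fun c hc => by
      obtain ⟨h1, h2⟩ := mem_filter.mp hc
      have := mem_Ioc.mp h1
      refine mem_Ioo.mpr ⟨this.1, ?_⟩
      by_contra hcb
      exact hne (hmono b c hkb (by omega) this.2 h2)
    have hc := card_le_card hsub
    rw [Nat.card_Ioo] at hc
    unfold shareAbove at h
    rcases hkb.eq_or_lt with rfl | hlt
    · exact hne rfl
    · omega

theorem add_shareAbove_le {N : ℕ} (x : GTCone N) (j : ℕ) {k : ℕ} (hk : k ≤ N) :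
    k + shareAbove x j k ≤ N := by
  have := card_filter_le (Ioc k N) fun b => x.entry b j = x.entry k j
  rw [Nat.card_Ioc] at this
  unfold shareAbove
  omega

/-- An interlacing triangular array has nonincreasing rows. -/
def GTCone.ofInterlacing {N : ℕ} (A : ℕ → ℕ → ℤ)
    (outside : ∀ k j, ¬ (1 ≤ j ∧ j ≤ k ∧ k ≤ N) → A k j = 0)
    (interlacing : ∀ m l, 1 ≤ l → l ≤ m → m + 1 ≤ N →
      A (m + 1) (l + 1) ≤ A m l ∧ A m l ≤ A (m + 1) l) : GTCone N where
  entry := A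
  outside := outside
  signature k hk1 hk2 := isSignature_of_succ_le fun i hi hik => by
    have := interlacing (k - 1) i hi (by omega) (by omega)
    rw [show k - 1 + 1 = k by omega] at this
    exact this.1.trans this.2
  interlacing := interlacing

/-- A nonzero rate means a nonzero blocking factor, so the particle (j - 1, k - 1) is strictly to
the right; column j - 1 does not decrease upwards, which leaves room for the whole pushed string.
Above its last row, column j is strictly larger, so that inequality also survives. -/
theorem exists_pushed {q ak : ℝ} {N : ℕ} (x : GTCone N) {j k : ℕ} (hj : 1 ≤ j) (hjk : j ≤ k)
    (hk : k ≤ N) (hr : rate q ak x j k ≠ 0) : ∃ y : GTCone N, y.entry = pushArray x j k := by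
  have hshare := fun b (h1 : k ≤ b) (h2 : b ≤ N) =>
    eq_iff_le_add_shareAbove x (b := b) hj hjk h1 h2
  have hle := add_shareAbove_le x j hk
  have hblock : ∀ b, k ≤ b + 1 → b + 1 ≤ k + shareAbove x j k → 2 ≤ j →
      x.entry (b + 1) j + 1 ≤ x.entry b (j - 1) := by
    intro b h1 h2 h3
    rw [(hshare (b + 1) h1 (by omega)).mpr h2]
    have h4 : x.entry k j ≠ x.entry (k - 1) (j - 1) := fun h => hr (by
      unfold rate
      rw [if_neg (by omega), h, sub_self, zpow_zero, sub_self, mul_zero, zero_mul])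
    have h5 := (x.interlacing (k - 1) (j - 1) (by omega) (by omega) (by omega)).1
    rw [show k - 1 + 1 = k by omega, show j - 1 + 1 = j by omega] at h5
    have h6 := x.le_entry_succ (k := k - 1) (l := b) (j := j - 1) (by omega) (by omega) (by omega)
      (by omega)
    omega
  refine ⟨GTCone.ofInterlacing (pushArray x j k) (fun b c h => ?_) fun m l h1 h2 h3 => ?_, rfl⟩
  · unfold pushArray
    rw [if_neg (by omega), x.outside b c h]
  · have hint := x.interlacing m l h1 h2 h3
    unfold pushArray
    constructor
    · by_cases hc : k ≤ m + 1 ∧ m + 1 ≤ k + shareAbove x j k ∧ l + 1 = j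
      · have := hblock m hc.1 hc.2.1 (by omega)
        rw [if_pos hc, hc.2.2, if_neg (by omega), show l = j - 1 by omega]
        exact this
      · rw [if_neg hc]
        split_ifs <;> omega
    · by_cases hc : k ≤ m ∧ m ≤ k + shareAbove x j k ∧ l = j
      · rw [if_pos hc]
        split_ifs with hd
        · omega
        · have e1 := (hshare m hc.1 (by omega)).mpr hc.2.1
          have e2 := mt (hshare (m + 1) (by omega) h3).mp (by omega)
          rw [hc.2.2] at hint ⊢
          omega
      · rw [if_neg hc]
        split_ifs <;> omega

theorem ite_entry_eq {N : ℕ} {y₀ : GTCone N} {A : ℕ → ℕ → ℤ} (h : y₀.entry = A) (y : GTCone N)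
    [Decidable (y.entry = A)] [Decidable (y = y₀)] :
    (if y.entry = A then (1 : ℝ) else 0) = if y = y₀ then 1 else 0 := by
  have : y.entry = A ↔ y = y₀ := ⟨fun e => GTCone.ext (e.trans h.symm), fun e => by rw [e, h]⟩
  simp only [this]

theorem generator_nonneg {q : ℝ} (hq0 : 0 < q) (hq1 : q < 1) {N : ℕ} {a : Fin N → ℝ}
    (ha : ∀ i, 0 ≤ a i) {x y : GTCone N} (hxy : x ≠ y) : 0 ≤ generator q a x y := by
  refine sum_nonneg fun k _ => sum_nonneg fun j hj => ?_
  have := mem_Icc.mp hj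
  rw [if_neg hxy.symm, sub_zero]
  refine mul_nonneg (rate_nonneg hq0 hq1 x this.1 this.2 (by omega) (ha k)) ?_
  split_ifs <;> norm_num

/-- A move with nonzero rate has its target in the cone, so its gain and loss cancel; a pushed array
outside the cone has rate 0. -/
theorem hasSum_generator {q : ℝ} {N : ℕ} (a : Fin N → ℝ) (x : GTCone N) :
    HasSum (fun y => generator q a x y) 0 := by
  classical
  rw [show (0 : ℝ) = ∑ k : Fin N, ∑ j ∈ Icc 1 ((k : ℕ) + 1), 0 by simp]
  refine hasSum_sum fun k _ => hasSum_sum fun j hj => ?_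
  have hj' := mem_Icc.mp hj
  by_cases hr : rate q (a k) x j (k + 1) = 0
  · simp only [hr, zero_mul]
    exact hasSum_zero
  · obtain ⟨y₀, hy₀⟩ := exists_pushed x hj'.1 hj'.2 (by omega) hr
    simp only [ite_entry_eq hy₀]
    have h := ((hasSum_ite_eq y₀ (1 : ℝ)).sub (hasSum_ite_eq x (1 : ℝ))).mul_left
      (rate q (a k) x j (k + 1))
    simpa using h

theorem hasSum_fiber_ite {N : ℕ} (Y : Config N) (y₀ : GTCone N)
    [∀ y, Decidable (y = y₀)] [Decidable (edge y₀ = Y)] :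
    HasSum (fun y : {y : GTCone N // edge y = Y} => if y.1 = y₀ then (1 : ℝ) else 0)
      (if edge y₀ = Y then 1 else 0) := by
  split_ifs with h
  · have := hasSum_single (f := fun y : {y : GTCone N // edge y = Y} =>
      if y.1 = y₀ then (1 : ℝ) else 0) ⟨y₀, h⟩ fun y hy => if_neg fun e => hy (Subtype.ext e)
    simpa using this
  · have hz : (fun y : {y : GTCone N // edge y = Y} => if y.1 = y₀ then (1 : ℝ) else 0) =
        fun _ => 0 := funext fun y => if_neg fun e => h (by rw [← e]; exact y.2)
    rw [hz]
    exact hasSum_zero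

theorem rate_diagonal {q : ℝ} {N : ℕ} (a : Fin N → ℝ) (x : GTCone N) (k : Fin N) :
    rate q (a k) x (k + 1) (k + 1) = tasepRate q a (edge x) k := by
  unfold rate tasepRate
  rw [if_pos rfl, mul_one]
  congr 1
  by_cases h : (k : ℕ) = 0
  · rw [if_pos (by omega), dif_pos h]
  · rw [if_neg (by omega), dif_neg h]
    congr 2
    have e : (k : ℕ) - 1 + 1 = k := by omega
    simp only [edge, e, Nat.add_sub_cancel]
    push_cast [Nat.cast_sub (show 1 ≤ (k : ℕ) by omega)]
    ring

/-- A pushed string stays in one column, which meets the edge only in its lowest entry; the string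
contains that entry only if it starts there. -/
theorem edge_of_entry_eq_pushArray {N : ℕ} {x y : GTCone N} {j : ℕ} {k : Fin N}
    (hjk : j ≤ k + 1) (hy : y.entry = pushArray x j (k + 1)) :
    (edge y).1 = if j = k + 1 then Function.update (edge x).1 k ((edge x).1 k + 1)
      else (edge x).1 := by
  funext i
  have e : (edge y).1 i = pushArray x j (k + 1) (i + 1) (i + 1) - ((i : ℤ) + 1) := by
    rw [← hy]; rfl
  rw [e]
  unfold pushArray
  split_ifs with h1 h2 h2
  · have hik : i = k := Fin.ext (by omega)
    subst hik
    rw [Function.update_self]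
    simp only [edge]
    ring
  · omega
  · have hik : i ≠ k := fun hik => h1 ⟨by omega, by rw [hik]; omega, by omega⟩
    rw [Function.update_of_ne hik]
    rfl
  · rfl

theorem config_eq_iff {N : ℕ} (X Y : Config N) : X = Y ↔ Y.1 = X.1 :=
  ⟨fun h => h ▸ rfl, fun h => Subtype.ext h.symm⟩

open Classical in
theorem hasSum_generator_term_fiber {q : ℝ} {N : ℕ} (a : Fin N → ℝ) (x : GTCone N) (Y : Config N)
    (k : Fin N) {j : ℕ} (hj : 1 ≤ j) (hjk : j ≤ k + 1) :
    HasSum (fun y : {y : GTCone N // edge y = Y} => rate q (a k) x j (k + 1) *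
        ((if y.1.entry = pushArray x j (k + 1) then 1 else 0) - (if y.1 = x then 1 else 0)))
      (if j = k + 1 then tasepRate q a (edge x) k *
        ((if Y.1 = Function.update (edge x).1 k ((edge x).1 k + 1) then 1 else 0) -
          (if Y = edge x then 1 else 0)) else 0) := by
  by_cases hr : rate q (a k) x j (k + 1) = 0
  · have : (if j = k + 1 then tasepRate q a (edge x) k *
        ((if Y.1 = Function.update (edge x).1 k ((edge x).1 k + 1) then (1 : ℝ) else 0) -
          (if Y = edge x then 1 else 0)) else 0) = 0 := by
      by_cases h : j = k + 1
      · rw [if_pos h, ← rate_diagonal]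
        subst h
        rw [hr, zero_mul]
      · rw [if_neg h]
    rw [this]
    simp only [hr, zero_mul]
    exact hasSum_zero
  · obtain ⟨y₀, hy₀⟩ := exists_pushed x hj hjk (by omega) hr
    simp only [ite_entry_eq hy₀]
    have h := ((hasSum_fiber_ite Y y₀).sub (hasSum_fiber_ite Y x)).mul_left
      (rate q (a k) x j (k + 1))
    have hedge := edge_of_entry_eq_pushArray hjk hy₀
    by_cases hjk' : j = k + 1
    · rw [if_pos hjk'] at hedge ⊢
      rw [← rate_diagonal, ← hedge]
      simp only [← config_eq_iff, eq_comm (a := Y) (b := edge x)]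
      subst hjk'
      exact h
    · rw [if_neg hjk'] at hedge ⊢
      have : edge y₀ = edge x := Subtype.ext hedge
      rwa [this, sub_self, mul_zero] at h

/-- The edge of the dynamics is autonomous. -/
theorem hasSum_generator_fiber {q : ℝ} {N : ℕ} (a : Fin N → ℝ) (x : GTCone N) (Y : Config N) :
    HasSum (fun y : {y : GTCone N // edge y = Y} => generator q a x y.1)
      (tasepGenerator q a (edge x) Y) := by
  classical
  unfold generator tasepGenerator
  refine hasSum_sum fun k _ => ?_
  have h := hasSum_sum fun j (hj : j ∈ Icc 1 ((k : ℕ) + 1)) =>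
    hasSum_generator_term_fiber (q := q) a x Y k (mem_Icc.mp hj).1 (mem_Icc.mp hj).2
  rw [sum_ite_eq' _ ((k : ℕ) + 1), if_pos (by simp)] at h
  exact h

end QWhittaker
end
-- Local relations between two neighbouring rows.
noncomputable section
namespace QWhittaker
open Finset

/-- The rate in terms of rows `k` and `k - 1`, as a complex number. -/
def rateRow (q a : ℂ) (k j : ℕ) (lam mu : ℕ → ℤ) : ℂ :=
  a * (if j = 1 then 1 else 1 - q ^ (mu (j - 1) - lam j)) *
    (if j = k then 1 else
      (1 - q ^ (lam j - lam (j + 1) + 1)) / (1 - q ^ (lam j - mu j + 1)))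

theorem ofReal_rate (q ak : ℝ) {N : ℕ} (x : GTCone N) (j k : ℕ) :
    ((rate q ak x j k : ℝ) : ℂ) = rateRow q ak k j (x.entry k) (x.entry (k - 1)) := by
  unfold rate rateRow
  split_ifs <;> push_cast <;> rfl

/-- The rate at which `s j` is entered from `s j - 1` in the last row. -/
def raiseCoeff (q : ℂ) (j : ℕ) (s : ℕ → ℤ) : ℂ :=
  if j = 1 then 1 else 1 - q ^ (s (j - 1) - s j + 1)

section bonds
variable {q : ℂ} (hq0 : q ≠ 0) (hq : ‖q‖ < 1)
include hq0 hq

theorem bond_lower_right (x y m : ℤ) (hxy : y ≤ x) :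
    (1 - q ^ (m - y + 1)) * bond q x (y - 1) m = (1 - q ^ (x - y + 1)) * bond q x y m := by
  have h1 := qPoch_succ hq0 hq (n := x - y) (by omega)
  rw [bond, bond, show x - (y - 1) = x - y + 1 by ring, show m - (y - 1) = m - y + 1 by ring, h1,
    qInv_eq_mul hq0 hq (m - y)]
  ring

theorem bond_lower_left (x y m : ℤ) (hxy : y < x) (hm : m < x) :
    (1 - q ^ (x - y)) / (1 - q ^ (x - m)) * bond q (x - 1) y m = bond q x y m := by
  have h1 := qPoch_succ hq0 hq (n := x - 1 - y) (by omega)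
  have h2 := qInv_eq_mul hq0 hq (x - 1 - m)
  have h3 : 1 - q ^ (x - m) ≠ 0 := one_sub_zpow_ne_zero hq (by omega)
  rw [show x - 1 - m + 1 = x - m by ring] at h2
  rw [show x - 1 - y + 1 = x - y by ring] at h1
  rw [bond, bond, h1, h2]
  field_simp

theorem bond_lower_both (x y : ℤ) (hxy : y < x) : bond q (x - 1) y (x - 1) = bond q x y x := by
  rw [bond, bond, sub_self, sub_self]
  have h : ∀ n : ℤ, 0 ≤ n → qPoch q q n * qInv q n = 1 := fun n hn =>
    mul_inv_cancel₀ (qPoch_ne_zero hq0 hq hn)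
  rw [mul_right_comm, h _ (by omega), mul_right_comm, h _ (by omega)]

theorem bond_lower_mid (x y m : ℤ) (hm : m ≤ x) :
    bond q x y (m - 1) = (1 - q ^ (m - y)) / (1 - q ^ (x - m + 1)) * bond q x y m := by
  have h1 := qInv_eq_mul hq0 hq (m - 1 - y)
  have h2 := qInv_eq_mul hq0 hq (x - m)
  have h3 : 1 - q ^ (x - m + 1) ≠ 0 := one_sub_zpow_ne_zero hq (by omega)
  rw [show m - 1 - y + 1 = m - y by ring] at h1
  rw [bond, bond, h1, h2, show x - (m - 1) = x - m + 1 by ring]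
  field_simp

end bonds

theorem prod_Icc_split_neighbours (f : ℕ → ℂ) {j n : ℕ} (hj : 1 ≤ j) (hjn : j ≤ n + 1) :
    ∏ i ∈ Icc 1 n, f i = (∏ i ∈ Icc 1 n with i ≠ j ∧ i + 1 ≠ j, f i) *
      ((if j = 1 then 1 else f (j - 1)) * if j = n + 1 then 1 else f j) := by
  have h1 : ∏ i ∈ Icc 1 n, (if i + 1 = j then f i else 1) = if j = 1 then 1 else f (j - 1) := by
    rw [prod_congr rfl fun i _ => if_congr (show i + 1 = j ↔ i = j - 1 by omega) rfl rfl,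
      prod_ite_eq' _ (j - 1)]
    by_cases h : j = 1
    · rw [if_pos h, if_neg (by simp [h])]
    · rw [if_neg h, if_pos (mem_Icc.mpr (by omega))]
  have h2 : ∏ i ∈ Icc 1 n, (if i = j then f i else 1) = if j = n + 1 then 1 else f j := by
    rw [prod_ite_eq' _ j]
    by_cases h : j = n + 1
    · rw [if_pos h, if_neg (by simp [h])]
    · rw [if_neg h, if_pos (mem_Icc.mpr (by omega))]
  rw [← h1, ← h2, prod_filter, ← prod_mul_distrib, ← prod_mul_distrib]
  refine prod_congr rfl fun i _ => ?_
  split_ifs <;> first | omega | simp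

theorem sub_ind_self (s : ℕ → ℤ) (j : ℕ) : (s - ind {j}) j = s j - 1 := by simp [ind]

theorem sub_ind_of_ne (s : ℕ → ℤ) {i j : ℕ} (h : i ≠ j) : (s - ind {j}) i = s i := by
  simp [ind, h]

theorem rowSum_sub_ind_singleton {n j : ℕ} (hj : 1 ≤ j) (hjn : j ≤ n) (s : ℕ → ℤ) :
    rowSum n (s - ind {j}) = rowSum n s - 1 := by
  rw [rowSum_sub, rowSum_ind (by simp [hj, hjn])]
  simp

section local_relations
variable {q : ℂ} (hq0 : q ≠ 0) (hq : ‖q‖ < 1)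
include hq0 hq

/-- Entering `lam` by moving its particle `j`, either alone or pushed from the row below. -/
theorem raise_row {n j : ℕ} {lam mu : ℕ → ℤ} {a : ℂ} (ha : a ≠ 0) (hj : 1 ≤ j)
    (hjn : j ≤ n + 1)
    (hint : ∀ i, 1 ≤ i → i ≤ n → lam (i + 1) ≤ mu i ∧ mu i ≤ lam i)
    (hstrict : j ≤ n → lam (j + 1) < lam j) :
    rateRow q a (n + 1) j (lam - ind {j}) mu * skewP q (n + 1) (lam - ind {j}) mu a +
      (if j ≤ n ∧ mu j = lam j then
        raiseCoeff q j mu * skewP q (n + 1) (lam - ind {j}) (mu - ind {j}) a else 0) =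
      raiseCoeff q j lam * skewP q (n + 1) lam mu a := by
  have hE : a ^ (rowSum (n + 1) lam - rowSum n mu) =
      a * a ^ (rowSum (n + 1) lam - 1 - rowSum n mu) := by
    rw [← zpow_one_add₀ ha]; congr 1; ring
  have hP : ∀ lam' mu' : ℕ → ℤ, (∀ i, i ≠ j → lam' i = lam i) → (∀ i, i ≠ j → mu' i = mu i) →
      ∏ i ∈ Icc 1 n with i ≠ j ∧ i + 1 ≠ j, bond q (lam' i) (lam' (i + 1)) (mu' i) =
      ∏ i ∈ Icc 1 n with i ≠ j ∧ i + 1 ≠ j, bond q (lam i) (lam (i + 1)) (mu i) := by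
    intro lam' mu' h1 h2
    refine prod_congr rfl fun i hi => ?_
    have := (mem_filter.mp hi).2
    rw [h1 i this.1, h1 (i + 1) this.2, h2 i this.1]
  have hright : (if j = 1 then 1 else 1 - q ^ (mu (j - 1) - (lam j - 1))) *
      (if j = 1 then 1 else bond q (lam (j - 1)) (lam j - 1) (mu (j - 1))) =
      raiseCoeff q j lam * if j = 1 then 1 else bond q (lam (j - 1)) (lam j) (mu (j - 1)) := by
    unfold raiseCoeff
    by_cases h : j = 1
    · simp only [if_pos h]
    · simp only [if_neg h]
      have := hint (j - 1) (by omega) (by omega)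
      rw [show j - 1 + 1 = j by omega] at this
      rw [← bond_lower_right hq0 hq _ _ _ (this.1.trans this.2)]
      congr 3
      ring
  rw [skewP_eq q _ lam mu ha, skewP_eq q _ (lam - ind {j}) mu ha, show n + 1 - 1 = n from rfl,
    prod_Icc_split_neighbours _ hj hjn, prod_Icc_split_neighbours _ hj hjn,
    hP _ mu (fun i hi => sub_ind_of_ne lam hi) fun _ _ => rfl,
    rowSum_sub_ind_singleton hj hjn, hE]
  have hl1 : j ≠ 1 → (lam - ind {j}) (j - 1) = lam (j - 1) := fun h => sub_ind_of_ne _ (by omega)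
  have hl2 : (lam - ind {j}) (j + 1) = lam (j + 1) := sub_ind_of_ne _ (by omega)
  have hjj : j ≠ 1 → j - 1 + 1 = j := fun h => by omega
  have hbR : (if j = 1 then 1 else bond q ((lam - ind {j}) (j - 1)) ((lam - ind {j}) (j - 1 + 1))
      (mu (j - 1))) = if j = 1 then 1 else bond q (lam (j - 1)) (lam j - 1) (mu (j - 1)) := by
    by_cases h : j = 1
    · simp only [if_pos h]
    · rw [if_neg h, if_neg h, hl1 h, hjj h, sub_ind_self]
  have hbO : (if j = 1 then 1 else bond q (lam (j - 1)) (lam (j - 1 + 1)) (mu (j - 1))) =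
      if j = 1 then 1 else bond q (lam (j - 1)) (lam j) (mu (j - 1)) := by
    by_cases h : j = 1
    · simp only [if_pos h]
    · rw [if_neg h, if_neg h, hjj h]
  rw [hbR, hbO, rateRow, sub_ind_self, hl2]
  by_cases hcase : j ≤ n ∧ mu j = lam j
  · have hjn' : j ≠ n + 1 := by omega
    have hbM : (if j = 1 then 1 else bond q ((lam - ind {j}) (j - 1))
        ((lam - ind {j}) (j - 1 + 1)) ((mu - ind {j}) (j - 1))) =
        if j = 1 then 1 else bond q (lam (j - 1)) (lam j - 1) (mu (j - 1)) := by
      by_cases h : j = 1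
      · simp only [if_pos h]
      · rw [if_neg h, if_neg h, hl1 h, hjj h, sub_ind_self, sub_ind_of_ne mu (by omega)]
    have hmu : raiseCoeff q j mu = if j = 1 then 1 else 1 - q ^ (mu (j - 1) - (lam j - 1)) := by
      unfold raiseCoeff
      rw [hcase.2]
      congr 3
      ring
    -- A lone move into `lam` would start with its particle j left of μ_j. Its rate has denominator
    -- 1 - q^0 and is 0 by the convention for division, so only the pushed term remains.
    rw [if_pos hcase, if_neg hjn', if_neg hjn', if_neg hjn', hcase.2,
      show lam j - 1 - lam j + 1 = 0 by ring, zpow_zero, sub_self, div_zero, mul_zero, zero_mul,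
      zero_add, skewP_eq q _ _ _ ha, show n + 1 - 1 = n from rfl,
      prod_Icc_split_neighbours _ hj hjn,
      hP _ _ (fun i hi => sub_ind_of_ne lam hi) fun i hi => sub_ind_of_ne mu hi, hbM,
      if_neg hjn', sub_ind_self, sub_ind_self, hl2, hcase.2,
      bond_lower_both hq0 hq _ _ (hstrict hcase.1),
      rowSum_sub_ind_singleton hj hjn, rowSum_sub_ind_singleton hj hcase.1, hmu,
      show rowSum (n + 1) lam - 1 - (rowSum n mu - 1) = 1 + (rowSum (n + 1) lam - 1 - rowSum n mu)
        by ring, zpow_one_add₀ ha]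
    linear_combination (a * a ^ (rowSum (n + 1) lam - 1 - rowSum n mu) *
      (∏ i ∈ Icc 1 n with i ≠ j ∧ i + 1 ≠ j, bond q (lam i) (lam (i + 1)) (mu i)) *
      bond q (lam j) (lam (j + 1)) (lam j)) * hright
  · have hleft : (if j = n + 1 then 1 else (1 - q ^ (lam j - 1 - lam (j + 1) + 1)) /
        (1 - q ^ (lam j - 1 - mu j + 1))) *
        (if j = n + 1 then 1 else bond q (lam j - 1) (lam (j + 1)) (mu j)) =
        if j = n + 1 then 1 else bond q (lam j) (lam (j + 1)) (mu j) := by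
      by_cases h : j = n + 1
      · simp only [if_pos h, mul_one]
      · have hj' : j ≤ n := by omega
        have hlt : mu j < lam j := lt_of_le_of_ne (hint j hj hj').2 fun e => hcase ⟨hj', e⟩
        simp only [if_neg h]
        rw [← bond_lower_left hq0 hq _ _ _ (hstrict hj') hlt,
          show lam j - 1 - lam (j + 1) + 1 = lam j - lam (j + 1) by ring,
          show lam j - 1 - mu j + 1 = lam j - mu j by ring]
    rw [if_neg hcase, add_zero]
    set P := ∏ i ∈ Icc 1 n with i ≠ j ∧ i + 1 ≠ j, bond q (lam i) (lam (i + 1)) (mu i)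
    set E := a ^ (rowSum (n + 1) lam - 1 - rowSum n mu)
    calc _ = a * E * P * ((if j = 1 then 1 else 1 - q ^ (mu (j - 1) - (lam j - 1))) *
          (if j = 1 then 1 else bond q (lam (j - 1)) (lam j - 1) (mu (j - 1)))) *
          ((if j = n + 1 then 1 else (1 - q ^ (lam j - 1 - lam (j + 1) + 1)) /
          (1 - q ^ (lam j - 1 - mu j + 1))) *
          (if j = n + 1 then 1 else bond q (lam j - 1) (lam (j + 1)) (mu j))) := by ring
      _ = _ := by rw [hleft, hright]; ring

theorem skewP_lower_sub {n i : ℕ} {lam mu : ℕ → ℤ} {a : ℂ} (ha : a ≠ 0) (hi : 1 ≤ i)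
    (hin : i ≤ n) (hle : mu i ≤ lam i) :
    skewP q (n + 1) lam (mu - ind {i}) a =
      a * ((1 - q ^ (mu i - lam (i + 1))) / (1 - q ^ (lam i - mu i + 1))) *
        skewP q (n + 1) lam mu a := by
  have hmem : i ∈ Icc 1 n := mem_Icc.mpr ⟨hi, hin⟩
  rw [skewP_eq q _ _ _ ha, skewP_eq q _ _ _ ha, show n + 1 - 1 = n from rfl,
    ← mul_prod_erase _ _ hmem, ← mul_prod_erase _ (fun i => bond q (lam i) (lam (i + 1)) (mu i)) hmem,
    sub_ind_self, bond_lower_mid hq0 hq _ _ _ hle, rowSum_sub_ind_singleton hi hin,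
    show rowSum (n + 1) lam - (rowSum n mu - 1) = 1 + (rowSum (n + 1) lam - rowSum n mu) by ring,
    zpow_one_add₀ ha, prod_congr rfl fun k hk => by rw [sub_ind_of_ne mu (ne_of_mem_erase hk)]]
  ring

/-- With D_j = q^(μ_{j-1} - λ_j) and D_1 = 0, the rate of particle j ≤ n is a(D_{j+1} - D_j) plus
the coefficient by which lowering μ_j changes the skew function. The differences telescope against
the last rate a(1 - D_{n+1}). This exchanges arrivals that stop in row n for the exit rate of row n
+ 1. -/
theorem sum_rateRow_mul_skewP {n : ℕ} {lam mu : ℕ → ℤ} {a : ℂ} (ha : a ≠ 0)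
    (hle : ∀ i, 1 ≤ i → i ≤ n → mu i ≤ lam i) :
    (∑ j ∈ Icc 1 (n + 1), rateRow q a (n + 1) j lam mu) * skewP q (n + 1) lam mu a =
      a * skewP q (n + 1) lam mu a +
        ∑ i ∈ Icc 1 n, raiseCoeff q i mu * skewP q (n + 1) lam (mu - ind {i}) a := by
  set D : ℕ → ℂ := fun j => if j = 1 then 0 else q ^ (mu (j - 1) - lam j)
  have hterm : ∀ j ∈ Icc 1 n, rateRow q a (n + 1) j lam mu = a * (D (j + 1) - D j) +
      raiseCoeff q j mu *
        (a * ((1 - q ^ (mu j - lam (j + 1))) / (1 - q ^ (lam j - mu j + 1)))) := by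
    intro j hj
    obtain ⟨h1, h2⟩ := mem_Icc.mp hj
    have hden : 1 - q ^ (lam j - mu j + 1) ≠ 0 :=
      one_sub_zpow_ne_zero hq (by have := hle j h1 h2; omega)
    simp only [rateRow, raiseCoeff, D]
    rw [if_neg (show j ≠ n + 1 by omega), if_neg (show j + 1 ≠ 1 by omega), Nat.add_sub_cancel,
      show lam j - lam (j + 1) + 1 = (lam j - mu j + 1) + (mu j - lam (j + 1)) by ring,
      zpow_add₀ hq0 (lam j - mu j + 1)]
    by_cases h : j = 1
    · simp only [if_pos h]
      generalize q ^ (lam j - mu j + 1) = x at hden ⊢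
      field_simp
      ring
    · simp only [if_neg h]
      rw [show mu (j - 1) - mu j + 1 = (mu (j - 1) - lam j) + (lam j - mu j + 1) by ring,
        zpow_add₀ hq0 (mu (j - 1) - lam j)]
      generalize q ^ (lam j - mu j + 1) = x at hden ⊢
      field_simp
      ring
  have htel : ∀ m, ∑ j ∈ Icc 1 m, (D (j + 1) - D j) = D (m + 1) := by
    intro m
    induction m with
    | zero => simp [D]
    | succ m ih => rw [sum_Icc_succ_top (by omega), ih]; ring
  have hlast : rateRow q a (n + 1) (n + 1) lam mu = a * (1 - D (n + 1)) := by
    simp only [rateRow, D]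
    split_ifs <;> simp
  have hsub : ∀ i ∈ Icc 1 n, raiseCoeff q i mu * skewP q (n + 1) lam (mu - ind {i}) a =
      raiseCoeff q i mu * (a * ((1 - q ^ (mu i - lam (i + 1))) / (1 - q ^ (lam i - mu i + 1)))) *
        skewP q (n + 1) lam mu a := fun i hi => by
    rw [skewP_lower_sub hq0 hq ha (mem_Icc.mp hi).1 (mem_Icc.mp hi).2
      (hle i (mem_Icc.mp hi).1 (mem_Icc.mp hi).2), mul_assoc (raiseCoeff q i mu)]
  rw [sum_Icc_succ_top (by omega), hlast, sum_congr rfl hterm, sum_add_distrib, ← mul_sum, htel,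
    sum_congr rfl hsub, ← sum_mul]
  ring

end local_relations

end QWhittaker
end
-- Predecessors of an array and the intertwining relation.
noncomputable section
namespace QWhittaker
open Finset

/-- The array `y` with the entries `(j, k), …, (j, b)` lowered by one. -/
def lowered (y : ℕ → ℕ → ℤ) (j k b : ℕ) (c : ℕ) : ℕ → ℤ :=
  if k ≤ c ∧ c ≤ b then y c - ind {j} else y c

/-- The entries `(j, k), …, (j, b)` coincide. -/
def ColConst (y : ℕ → ℕ → ℤ) (j k b : ℕ) : Prop := ∀ c, k ≤ c → c ≤ b → y c j = y k j

theorem lowered_apply (y : ℕ → ℕ → ℤ) (j k b c i : ℕ) :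
    lowered y j k b c i = if k ≤ c ∧ c ≤ b ∧ i = j then y c i - 1 else y c i := by
  unfold lowered
  by_cases h : k ≤ c ∧ c ≤ b
  · by_cases hi : i = j
    · rw [if_pos h, if_pos ⟨h.1, h.2, hi⟩, hi, sub_ind_self]
    · rw [if_pos h, if_neg fun h' => hi h'.2.2, sub_ind_of_ne _ hi]
  · rw [if_neg h, if_neg fun h' => h ⟨h'.1, h'.2.1⟩]

/-- A predecessor of y is determined by the first and last rows moved. The push cannot run past b:
in row b + 1 the predecessor agrees with y, whose entry there is at least y^(b)_j, hence larger than
the lowered one. -/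
theorem eq_pushArray_iff {N : ℕ} (x y : GTCone N) {j k : ℕ} (hj : 1 ≤ j) (hjk : j ≤ k)
    (hk : k ≤ N) {b : ℕ} (hkb : k ≤ b) (hb : b ≤ N) :
    ColConst y.entry j k b ∧ x.entry = lowered y.entry j k b ↔
      y.entry = pushArray x j k ∧ b = k + shareAbove x j k := by
  have hshare := fun b (h1 : k ≤ b) (h2 : b ≤ N) =>
    eq_iff_le_add_shareAbove x (b := b) hj hjk h1 h2
  have hle := add_shareAbove_le x j hk
  constructor
  · rintro ⟨hc, hx⟩
    have hxc : ∀ c, k ≤ c → c ≤ b → x.entry c j = y.entry k j - 1 := fun c h1 h2 => by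
      rw [hx, lowered_apply, if_pos ⟨h1, h2, rfl⟩, hc c h1 h2]
    have hbb : b = k + shareAbove x j k := by
      have h1 : b ≤ k + shareAbove x j k := (hshare b hkb hb).mp (by
        rw [hxc b hkb le_rfl, hxc k le_rfl hkb])
      by_contra hne
      have h2 := (hshare (b + 1) (by omega) (by omega)).mpr (by omega)
      rw [hxc k le_rfl hkb, hx, lowered_apply, if_neg (by omega)] at h2
      have h3 := y.le_entry_succ (k := b) (l := b + 1) hj (by omega) (by omega) (by omega)
      rw [hc b hkb le_rfl] at h3
      omega
    refine ⟨?_, hbb⟩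
    funext c i
    unfold pushArray
    rw [← hbb, hx, lowered_apply]
    split_ifs <;> simp
  · rintro ⟨hy, rfl⟩
    constructor
    · intro c h1 h2
      rw [hy]
      unfold pushArray
      rw [if_pos ⟨h1, h2, rfl⟩, if_pos ⟨le_rfl, by omega, rfl⟩,
        (hshare c h1 (by omega)).mpr h2]
    · funext c i
      rw [lowered_apply, hy]
      unfold pushArray
      split_ifs <;> simp

open Classical in
theorem ite_eq_pushArray {N : ℕ} (x y : GTCone N) {j k : ℕ} (hj : 1 ≤ j) (hjk : j ≤ k)
    (hk : k ≤ N) : (if y.entry = pushArray x j k then (1 : ℂ) else 0) =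
      ∑ b ∈ Icc k N, if ColConst y.entry j k b then
        (if x.entry = lowered y.entry j k b then 1 else 0) else 0 := by
  have h : ∀ b ∈ Icc k N, (if ColConst y.entry j k b then
        (if x.entry = lowered y.entry j k b then (1 : ℂ) else 0) else 0) =
      if b = k + shareAbove x j k then (if y.entry = pushArray x j k then 1 else 0) else 0 := by
    intro b hb
    have := eq_pushArray_iff x y hj hjk hk (mem_Icc.mp hb).1 (mem_Icc.mp hb).2
    rw [← ite_and, ← ite_and]
    exact if_congr (this.trans and_comm) rfl rfl
  rw [sum_congr rfl h, sum_ite_eq' _ (k + shareAbove x j k),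
    if_pos (mem_Icc.mpr ⟨by omega, add_shareAbove_le x j hk⟩)]

open Classical in
theorem hasSum_entry_eq {N : ℕ} {F : (ℕ → ℕ → ℤ) → ℂ} {A : ℕ → ℕ → ℤ}
    (hF : F A ≠ 0 → ∃ x : GTCone N, x.entry = A) :
    HasSum (fun x : GTCone N => F x.entry * if x.entry = A then 1 else 0) (F A) := by
  by_cases h : ∃ x : GTCone N, x.entry = A
  · obtain ⟨x₀, rfl⟩ := h
    have := hasSum_single (f := fun x : GTCone N => F x.entry *
      if x.entry = x₀.entry then 1 else 0) x₀ fun x hx => by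
        rw [if_neg fun e => hx (GTCone.ext e), mul_zero]
    simpa using this
  · rw [not_not.mp (mt hF h)]
    have hz : (fun x : GTCone N => F x.entry * if x.entry = A then 1 else 0) = fun _ => 0 :=
      funext fun x => by rw [if_neg fun e => h ⟨x, e⟩, mul_zero]
    rw [hz]
    exact hasSum_zero

open Classical in
-- Only finitely many arrays can move to y. Lowered arrays outside the cone may be kept in the sum
-- because F vanishes on them.
theorem hasSum_predecessors {N : ℕ} (y : GTCone N) {j k : ℕ} (hj : 1 ≤ j) (hjk : j ≤ k)
    (hk : k ≤ N) {F : (ℕ → ℕ → ℤ) → ℂ}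
    (hF : ∀ A : ℕ → ℕ → ℤ, (∀ k j, ¬ (1 ≤ j ∧ j ≤ k ∧ k ≤ N) → A k j = 0) → F A ≠ 0 →
      ∃ x : GTCone N, x.entry = A) :
    HasSum (fun x : GTCone N => F x.entry * if y.entry = pushArray x j k then 1 else 0)
      (∑ b ∈ Icc k N, if ColConst y.entry j k b then F (lowered y.entry j k b) else 0) := by
  simp only [ite_eq_pushArray _ y hj hjk hk, mul_sum]
  refine hasSum_sum fun b hb => ?_
  have hb' := mem_Icc.mp hb
  split_ifs with hc
  · refine hasSum_entry_eq (hF _ fun c i h => ?_)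
    rw [lowered_apply, if_neg (by omega), y.outside c i h]
  · simp only [mul_zero]
    exact hasSum_zero

section chains
variable {q : ℂ} (hq0 : q ≠ 0) (hq : ‖q‖ < 1)

theorem chainArr_congr (q : ℂ) {n : ℕ} {A B : ℕ → ℕ → ℤ} (w : ℕ → ℂ) (h : ∀ c ≤ n, A c = B c) :
    chainArr q n A w = chainArr q n B w :=
  prod_congr rfl fun k hk => by
    have := mem_range.mp hk
    rw [h k (by omega), h (k + 1) (by omega)]

theorem chainArr_succ (q : ℂ) (n : ℕ) (A : ℕ → ℕ → ℤ) (w : ℕ → ℂ) :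
    chainArr q (n + 1) A w = chainArr q n A w * skewP q (n + 1) (A (n + 1)) (A n) (w n) :=
  prod_range_succ _ _

theorem chainArr_eq_mul_tail (q : ℂ) {b N : ℕ} (hb : b + 1 ≤ N) (A : ℕ → ℕ → ℤ) (w : ℕ → ℂ) :
    chainArr q N A w = chainArr q b A w * skewP q (b + 1) (A (b + 1)) (A b) (w b) *
      ∏ k ∈ Ico (b + 1) N, skewP q (k + 1) (A (k + 1)) (A k) (w k) := by
  rw [← chainArr_succ, chainArr, chainArr, prod_range_mul_prod_Ico _ hb]

include hq0 hq in
theorem interlacing_of_skewP_ne_zero {n : ℕ} {lam mu : ℕ → ℤ} {a : ℂ} (ha : a ≠ 0)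
    (h : skewP q (n + 1) lam mu a ≠ 0) {i : ℕ} (h1 : 1 ≤ i) (h2 : i ≤ n) :
    lam (i + 1) ≤ mu i ∧ mu i ≤ lam i := by
  rw [skewP_eq q _ _ _ ha] at h
  exact bond_ne_zero hq0 hq
    (prod_ne_zero_iff.mp (right_ne_zero_of_mul h) i (mem_Icc.mpr ⟨h1, h2⟩))

include hq0 hq in
theorem exists_of_chainArr_ne_zero {N : ℕ} {A : ℕ → ℕ → ℤ} {w : ℕ → ℂ} (hw : ∀ k, w k ≠ 0)
    (hout : ∀ k j, ¬ (1 ≤ j ∧ j ≤ k ∧ k ≤ N) → A k j = 0) (h : chainArr q N A w ≠ 0) :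
    ∃ x : GTCone N, x.entry = A :=
  ⟨GTCone.ofInterlacing A hout fun m _ h1 h2 h3 =>
    interlacing_of_skewP_ne_zero hq0 hq (hw m)
      (prod_ne_zero_iff.mp h m (mem_range.mpr (by omega))) h1 h2, rfl⟩

theorem lowered_of_mem {y : ℕ → ℕ → ℤ} {j k b c : ℕ} (h1 : k ≤ c) (h2 : c ≤ b) :
    lowered y j k b c = y c - ind {j} := if_pos ⟨h1, h2⟩

theorem lowered_of_lt {y : ℕ → ℕ → ℤ} {j k b c : ℕ} (h : c < k ∨ b < c) :
    lowered y j k b c = y c := if_neg (by omega)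

open Classical in
/-- The total weight with which the rows `≤ b` of `y` are entered by a move of the particles
`(j, ·)` that reaches row `b`. -/
def enterWeight (q : ℂ) (w : ℕ → ℂ) (y : ℕ → ℕ → ℤ) (b j : ℕ) : ℂ :=
  ∑ k ∈ Icc j b, if ColConst y j k b then
    rateRow q (w (k - 1)) k j (y k - ind {j}) (y (k - 1)) * chainArr q b (lowered y j k b) w else 0

include hq0 hq in
-- Induction on b through `raise_row`: a move begun in row b is the lone term, and all moves begun
-- below are collected by the induction hypothesis into the pushed term.
theorem enterWeight_eq {N : ℕ} (y : GTCone N) {w : ℕ → ℂ} (hw : ∀ k, w k ≠ 0) {j b : ℕ}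
    (hj : 1 ≤ j) (hjb : j ≤ b) (hb : b ≤ N)
    (hstrict : j < b → y.entry b (j + 1) < y.entry b j) :
    enterWeight q w y.entry b j = raiseCoeff q j (y.entry b) * chainArr q b y.entry w := by
  classical
  induction b with
  | zero => omega
  | succ n ih =>
    have hint : ∀ i, 1 ≤ i → i ≤ n → y.entry (n + 1) (i + 1) ≤ y.entry n i ∧
        y.entry n i ≤ y.entry (n + 1) i := fun i h1 h2 => y.interlacing n i h1 h2 hb
    have hlow : ∑ k ∈ Icc j n, (if ColConst y.entry j k (n + 1) then
          rateRow q (w (k - 1)) k j (y.entry k - ind {j}) (y.entry (k - 1)) *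
            chainArr q (n + 1) (lowered y.entry j k (n + 1)) w else 0) =
        (if j ≤ n ∧ y.entry n j = y.entry (n + 1) j then enterWeight q w y.entry n j *
          skewP q (n + 1) (y.entry (n + 1) - ind {j}) (y.entry n - ind {j}) (w n) else 0) := by
      by_cases hc : j ≤ n ∧ y.entry n j = y.entry (n + 1) j
      · rw [if_pos hc, enterWeight, sum_mul]
        refine sum_congr rfl fun k hk => ?_
        obtain ⟨h1, h2⟩ := mem_Icc.mp hk
        have hiff : ColConst y.entry j k (n + 1) ↔ ColConst y.entry j k n := by
          constructor
          · exact fun h c h3 h4 => h c h3 (by omega)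
          · intro h c h3 h4
            rcases h4.lt_or_eq with h5 | rfl
            · exact h c h3 (by omega)
            · rw [← hc.2, h n h2 le_rfl]
        by_cases hcc : ColConst y.entry j k n
        · rw [if_pos hcc, if_pos (hiff.mpr hcc), chainArr_succ,
            lowered_of_mem (by omega) le_rfl, lowered_of_mem h2 (by omega), mul_assoc]
          congr 2
          exact chainArr_congr q w fun c hcn => by
            unfold lowered
            simp only [show (k ≤ c ∧ c ≤ n + 1) ↔ (k ≤ c ∧ c ≤ n) by omega]
        · rw [if_neg hcc, if_neg (mt hiff.mp hcc), zero_mul]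
      · rw [if_neg hc]
        refine sum_eq_zero fun k hk => if_neg fun h => hc ?_
        obtain ⟨h1, h2⟩ := mem_Icc.mp hk
        exact ⟨by omega, by rw [h n h2 (by omega), h (n + 1) (by omega) le_rfl]⟩
    have htop : (if ColConst y.entry j (n + 1) (n + 1) then
        rateRow q (w n) (n + 1) j (y.entry (n + 1) - ind {j}) (y.entry n) *
          chainArr q (n + 1) (lowered y.entry j (n + 1) (n + 1)) w else 0) =
        rateRow q (w n) (n + 1) j (y.entry (n + 1) - ind {j}) (y.entry n) *
          (chainArr q n y.entry w *
            skewP q (n + 1) (y.entry (n + 1) - ind {j}) (y.entry n) (w n)) := by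
      have hcc : ColConst y.entry j (n + 1) (n + 1) := fun c h1 h2 => by rw [le_antisymm h2 h1]
      rw [if_pos hcc, chainArr_succ,
        lowered_of_mem le_rfl le_rfl, lowered_of_lt (by omega)]
      congr 2
      exact chainArr_congr q w fun c hcn => lowered_of_lt (by omega)
    rw [enterWeight, sum_Icc_succ_top hjb, hlow, show n + 1 - 1 = n from rfl, htop, chainArr_succ]
    have hrow := raise_row hq0 hq (lam := y.entry (n + 1)) (mu := y.entry n) (hw n) hj hjb hint
      fun h => hstrict (by omega)
    by_cases hc : j ≤ n ∧ y.entry n j = y.entry (n + 1) j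
    · rw [if_pos hc] at hrow ⊢
      rw [ih hc.1 (by omega) fun h => by
        have := hint (j + 1) (by omega) (by omega)
        have := hstrict (by omega)
        omega]
      linear_combination chainArr q n y.entry w * hrow
    · rw [if_neg hc] at hrow ⊢
      linear_combination chainArr q n y.entry w * hrow

end chains

theorem sum_range_eq_sum_Icc {M : Type*} [AddCommMonoid M] (f : ℕ → M) (n : ℕ) :
    ∑ k ∈ range n, f (k + 1) = ∑ k ∈ Icc 1 n, f k := by
  induction n with
  | zero => simp
  | succ n ih => rw [sum_range_succ, ih, sum_Icc_succ_top (by omega)]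

section intertwining
variable {q : ℂ} (hq0 : q ≠ 0) (hq : ‖q‖ < 1) {N : ℕ} (y : GTCone N) {w : ℕ → ℂ}
  (hw : ∀ k, w k ≠ 0) {g : (ℕ → ℤ) → ℂ} (hg : ∀ s, ¬ IsSignature N s → g s = 0)
include hq0 hq hw

/-- The total rate out of row `k`. -/
def rowRate (q : ℂ) {N : ℕ} (y : GTCone N) (w : ℕ → ℂ) (k : ℕ) : ℂ :=
  ∑ j ∈ Icc 1 k, rateRow q (w (k - 1)) k j (y.entry k) (y.entry (k - 1))

open Classical in
/-- The contribution of the moves reaching exactly row `b`. -/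
theorem sum_enter_of_lt (c : ℂ) {b : ℕ} (hb : b + 1 ≤ N) :
    ∑ j ∈ Icc 1 b, ∑ k ∈ Icc j b, (if ColConst y.entry j k b then
      chainArr q N (lowered y.entry j k b) w * c *
        rateRow q (w (k - 1)) k j (y.entry k - ind {j}) (y.entry (k - 1)) else 0) =
      chainArr q N y.entry w * c * (rowRate q y w (b + 1) - w b) := by
  set tail := ∏ k ∈ Ico (b + 1) N, skewP q (k + 1) (y.entry (k + 1)) (y.entry k) (w k)
  have h1 : ∀ j ∈ Icc 1 b, ∑ k ∈ Icc j b, (if ColConst y.entry j k b then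
      chainArr q N (lowered y.entry j k b) w * c *
        rateRow q (w (k - 1)) k j (y.entry k - ind {j}) (y.entry (k - 1)) else 0) =
      raiseCoeff q j (y.entry b) * skewP q (b + 1) (y.entry (b + 1)) (y.entry b - ind {j}) (w b) *
        (chainArr q b y.entry w * tail * c) := by
    intro j hj
    obtain ⟨hj1, hj2⟩ := mem_Icc.mp hj
    have h2 : ∑ k ∈ Icc j b, (if ColConst y.entry j k b then
        chainArr q N (lowered y.entry j k b) w * c *
          rateRow q (w (k - 1)) k j (y.entry k - ind {j}) (y.entry (k - 1)) else 0) =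
        enterWeight q w y.entry b j *
          (skewP q (b + 1) (y.entry (b + 1)) (y.entry b - ind {j}) (w b) * tail * c) := by
      rw [enterWeight, sum_mul]
      refine sum_congr rfl fun k hk => ?_
      obtain ⟨hk1, hk2⟩ := mem_Icc.mp hk
      have ht : ∏ k' ∈ Ico (b + 1) N, skewP q (k' + 1) (lowered y.entry j k b (k' + 1))
          (lowered y.entry j k b k') (w k') = tail := prod_congr rfl fun k' hk' => by
        have := mem_Ico.mp hk'
        rw [lowered_of_lt (by omega), lowered_of_lt (by omega)]
      split_ifs
      · rw [chainArr_eq_mul_tail q hb, ht, lowered_of_lt (by omega), lowered_of_mem hk2 le_rfl]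
        ring
      · rw [zero_mul]
    rw [h2]
    -- If entries j and j + 1 of row b coincide, lowering the former breaks interlacing with row b +
    -- 1, and both sides vanish.
    by_cases hs : j < b → y.entry b (j + 1) < y.entry b j
    · rw [enterWeight_eq hq0 hq y hw hj1 hj2 (by omega) hs]
      ring
    · have hz : skewP q (b + 1) (y.entry (b + 1)) (y.entry b - ind {j}) (w b) = 0 := by
        by_contra hne
        refine hs fun hjb => ?_
        have h3 := (interlacing_of_skewP_ne_zero hq0 hq (hw b) hne hj1 hj2).1
        rw [sub_ind_self] at h3
        have h4 := (y.interlacing b (j + 1) (by omega) (by omega) hb).2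
        omega
      rw [hz]
      ring
  rw [sum_congr rfl h1, ← sum_mul]
  have hB := sum_rateRow_mul_skewP hq0 hq (lam := y.entry (b + 1)) (mu := y.entry b) (hw b)
    fun i h1 h2 => (y.interlacing b i h1 h2 hb).2
  rw [chainArr_eq_mul_tail q hb, rowRate, show b + 1 - 1 = b from rfl]
  linear_combination -(chainArr q b y.entry w * tail * c) * hB

open Classical in
include hg in
/-- The contribution of the moves reaching the last row. -/
theorem sum_enter_top : ∑ j ∈ Icc 1 N, ∑ k ∈ Icc j N, (if ColConst y.entry j k N then
      chainArr q N (lowered y.entry j k N) w * g (y.entry N - ind {j}) *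
        rateRow q (w (k - 1)) k j (y.entry k - ind {j}) (y.entry (k - 1)) else 0) =
      chainArr q N y.entry w *
        ∑ j ∈ Icc 1 N, raiseCoeff q j (y.entry N) * g (y.entry N - ind {j}) := by
  rw [mul_sum]
  refine sum_congr rfl fun j hj => ?_
  obtain ⟨hj1, hj2⟩ := mem_Icc.mp hj
  have h2 : ∑ k ∈ Icc j N, (if ColConst y.entry j k N then
      chainArr q N (lowered y.entry j k N) w * g (y.entry N - ind {j}) *
        rateRow q (w (k - 1)) k j (y.entry k - ind {j}) (y.entry (k - 1)) else 0) =
      enterWeight q w y.entry N j * g (y.entry N - ind {j}) := by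
    rw [enterWeight, sum_mul]
    refine sum_congr rfl fun k _ => ?_
    split_ifs <;> ring
  rw [h2]
  by_cases hs : j < N → y.entry N (j + 1) < y.entry N j
  · rw [enterWeight_eq hq0 hq y hw hj1 hj2 le_rfl hs]
    ring
  · have hz : g (y.entry N - ind {j}) = 0 := hg _ fun h => hs fun hjN => by
      have := h.succ_le hj1 (by omega)
      rw [sub_ind_self, sub_ind_of_ne _ (by omega)] at this
      omega
    rw [hz]
    ring

omit hq0 hq hw in
theorem rowRate_one : rowRate q y w 1 = w 0 := by
  simp [rowRate, rateRow]

open Classical in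
include hg in
/-- The total weight entering `y`. -/
theorem sum_enter (hN : 1 ≤ N) : ∑ k ∈ Icc 1 N, ∑ j ∈ Icc 1 k, ∑ b ∈ Icc k N,
    (if ColConst y.entry j k b then chainArr q N (lowered y.entry j k b) w *
      g (lowered y.entry j k b N) *
        rateRow q (w (k - 1)) k j (lowered y.entry j k b k) (lowered y.entry j k b (k - 1)) else 0) =
      chainArr q N y.entry w *
        (∑ j ∈ Icc 1 N, raiseCoeff q j (y.entry N) * g (y.entry N - ind {j}) +
          g (y.entry N) * (∑ k ∈ Icc 1 N, rowRate q y w k - ∑ k ∈ range N, w k)) := by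
  -- The moves are regrouped by the last row b that they reach.
  have hswap : ∀ T : ℕ → ℕ → ℕ → ℂ, ∑ k ∈ Icc 1 N, ∑ j ∈ Icc 1 k, ∑ b ∈ Icc k N, T k j b =
      ∑ b ∈ Icc 1 N, ∑ j ∈ Icc 1 b, ∑ k ∈ Icc j b, T k j b := by
    intro T
    rw [sum_congr rfl fun k _ => sum_comm,
      sum_comm' (s' := fun b => Icc 1 b) (t' := Icc 1 N) fun k b => by
        simp only [mem_Icc]; omega]
    refine sum_congr rfl fun b _ => sum_comm' fun k j => ?_
    simp only [mem_Icc]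
    omega
  obtain ⟨n, rfl⟩ : ∃ n, N = n + 1 := ⟨N - 1, by omega⟩
  rw [hswap, sum_Icc_succ_top (by omega)]
  have htop := sum_enter_top hq0 hq y hw hg
  have hlow := fun b (hb : b + 1 ≤ n + 1) =>
    sum_enter_of_lt hq0 hq y hw (g (y.entry (n + 1))) (b := b) hb
  have e1 : ∀ b ∈ Icc 1 n, ∑ j ∈ Icc 1 b, ∑ k ∈ Icc j b, (if ColConst y.entry j k b then
      chainArr q (n + 1) (lowered y.entry j k b) w * g (lowered y.entry j k b (n + 1)) *
        rateRow q (w (k - 1)) k j (lowered y.entry j k b k) (lowered y.entry j k b (k - 1))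
        else 0) = chainArr q (n + 1) y.entry w * g (y.entry (n + 1)) *
          (rowRate q y w (b + 1) - w b) := by
    intro b hb
    have hb' := mem_Icc.mp hb
    rw [← hlow b (by omega)]
    refine sum_congr rfl fun j hj => sum_congr rfl fun k hk => ?_
    have hj' := mem_Icc.mp hj
    have hk' := mem_Icc.mp hk
    rw [lowered_of_lt (c := n + 1) (by omega), lowered_of_mem le_rfl hk'.2,
      lowered_of_lt (c := k - 1) (by omega)]
  have e2 : ∑ j ∈ Icc 1 (n + 1), ∑ k ∈ Icc j (n + 1), (if ColConst y.entry j k (n + 1) then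
      chainArr q (n + 1) (lowered y.entry j k (n + 1)) w *
        g (lowered y.entry j k (n + 1) (n + 1)) *
        rateRow q (w (k - 1)) k j (lowered y.entry j k (n + 1) k)
          (lowered y.entry j k (n + 1) (k - 1)) else 0) =
      chainArr q (n + 1) y.entry w *
        ∑ j ∈ Icc 1 (n + 1), raiseCoeff q j (y.entry (n + 1)) *
          g (y.entry (n + 1) - ind {j}) := by
    rw [← htop]
    refine sum_congr rfl fun j hj => sum_congr rfl fun k hk => ?_
    have hj' := mem_Icc.mp hj
    have hk' := mem_Icc.mp hk
    rw [lowered_of_mem (c := n + 1) hk'.2 le_rfl, lowered_of_mem le_rfl hk'.2,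
      lowered_of_lt (c := k - 1) (by omega)]
  have e3 : ∑ k ∈ range (n + 1), w k = w 0 + ∑ b ∈ Icc 1 n, w b := by
    rw [sum_range_succ', add_comm]
    congr 1
    exact sum_range_eq_sum_Icc w n
  -- Rows b < N give the exit rates of rows 2, …, N only; row 1 can be added to both sums because
  -- its exit rate equals its parameter.
  rw [e2, sum_congr rfl e1, ← mul_sum, sum_sub_distrib, sum_Icc_succ_bot (rowRate q y w), e3,
    rowRate_one]
  ring

end intertwining

/-- The intertwining relation: the weights `chainP` turn the generator into a difference operator
acting on functions of the last row. -/
theorem hasSum_chainP_mul_generator {q : ℝ} (hq0 : 0 < q) (hq1 : q < 1) {N : ℕ} (hN : 1 ≤ N)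
    {a : Fin N → ℝ} (ha : ∀ i, 0 < a i) (y : GTCone N) {g : (ℕ → ℤ) → ℂ}
    (hg : ∀ s, ¬ IsSignature N s → g s = 0) :
    HasSum (fun x : GTCone N => chainP (q : ℂ) x (fun j => (a j : ℂ)) * g (x.entry N) *
        (generator q a x y : ℂ))
      (chainP (q : ℂ) y (fun j => (a j : ℂ)) *
        (∑ j ∈ Icc 1 N, raiseCoeff (q : ℂ) j (y.entry N) * g (y.entry N - ind {j}) -
          (∑ i, (a i : ℂ)) * g (y.entry N))) := by
  classical
  have hqc0 : (q : ℂ) ≠ 0 := by exact_mod_cast hq0.ne'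
  have hqc : ‖(q : ℂ)‖ < 1 := by simpa [abs_of_pos hq0] using hq1
  set w : ℕ → ℂ := zext fun j => (a j : ℂ)
  have hw : ∀ k, w k ≠ 0 := zext_ne_zero fun j => by exact_mod_cast (ha j).ne'
  have hwa : ∀ k : Fin N, w k = a k := fun k => zext_apply _ k
  have hterm : ∀ (k : Fin N), ∀ j ∈ Icc 1 ((k : ℕ) + 1),
      HasSum (fun x : GTCone N => chainP (q : ℂ) x (fun j => (a j : ℂ)) * g (x.entry N) *
        ((rate q (a k) x j (k + 1) * ((if y.entry = pushArray x j (k + 1) then 1 else 0) -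
          (if y = x then 1 else 0)) : ℝ) : ℂ))
      (∑ b ∈ Icc ((k : ℕ) + 1) N, (if ColConst y.entry j (k + 1) b then
        chainArr q N (lowered y.entry j (k + 1) b) w * g (lowered y.entry j (k + 1) b N) *
        rateRow q (w ((k : ℕ) + 1 - 1)) (k + 1) j (lowered y.entry j (k + 1) b (k + 1))
          (lowered y.entry j (k + 1) b ((k : ℕ) + 1 - 1)) else 0) -
        chainArr q N y.entry w * g (y.entry N) *
          rateRow q (w ((k : ℕ) + 1 - 1)) (k + 1) j (y.entry (k + 1))
            (y.entry ((k : ℕ) + 1 - 1))) := by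
    intro k j hj
    obtain ⟨hj1, hj2⟩ := mem_Icc.mp hj
    set F : (ℕ → ℕ → ℤ) → ℂ := fun A => chainArr q N A w * g (A N) *
      rateRow q (w ((k : ℕ) + 1 - 1)) (k + 1) j (A (k + 1)) (A ((k : ℕ) + 1 - 1)) with hF
    have h1 := hasSum_predecessors y hj1 hj2 (by omega) (F := F) fun A hA hne =>
      exists_of_chainArr_ne_zero hqc0 hqc hw hA
        (left_ne_zero_of_mul (left_ne_zero_of_mul hne))
    have h2 := hasSum_entry_eq (N := N) (F := F) (A := y.entry) fun _ => ⟨y, rfl⟩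
    have hfun : (fun x : GTCone N => chainP (q : ℂ) x (fun j => (a j : ℂ)) * g (x.entry N) *
        ((rate q (a k) x j (k + 1) * ((if y.entry = pushArray x j (k + 1) then 1 else 0) -
          (if y = x then 1 else 0)) : ℝ) : ℂ)) = fun x =>
        F x.entry * (if y.entry = pushArray x j (k + 1) then 1 else 0) -
          F x.entry * (if x.entry = y.entry then 1 else 0) := by
      funext x
      have hxy : y = x ↔ x.entry = y.entry := ⟨fun e => by rw [e], fun e => (GTCone.ext e).symm⟩
      rw [Complex.ofReal_mul, ofReal_rate, chainP_eq_chainArr, hF, Complex.ofReal_sub,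
        show zext (fun j => (a j : ℂ)) = w from rfl]
      simp only [hxy, Nat.add_sub_cancel, hwa]
      split_ifs <;> push_cast <;> ring
    rw [hfun]
    exact h1.sub h2
  have hsum := hasSum_sum fun (k : Fin N) (_ : k ∈ univ) => hasSum_sum fun j hj => hterm k j hj
  have hval := sum_range_eq_sum_Icc (fun κ => ∑ j ∈ Icc 1 κ,
    (∑ b ∈ Icc κ N, (if ColConst y.entry j κ b then
        chainArr q N (lowered y.entry j κ b) w * g (lowered y.entry j κ b N) *
        rateRow q (w (κ - 1)) κ j (lowered y.entry j κ b κ)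
          (lowered y.entry j κ b (κ - 1)) else 0) -
        chainArr q N y.entry w * g (y.entry N) *
          rateRow q (w (κ - 1)) κ j (y.entry κ) (y.entry (κ - 1)))) N
  rw [← Fin.sum_univ_eq_sum_range] at hval
  rw [hval] at hsum
  convert hsum using 1
  · funext x
    rw [generator]
    push_cast
    simp only [mul_sum]
  · simp only [sum_sub_distrib]
    -- The exit rates gained here cancel those on the diagonal of the generator, leaving -∑ a_i.
    rw [sum_enter hqc0 hqc y hw hg hN, chainP_eq_chainArr, ← Fin.sum_univ_eq_sum_range]
    simp only [hwa, rowRate, ← mul_sum]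
    ring

end QWhittaker
end
-- The generator acting on torus integrals, and the process as such an integral.
noncomputable section
namespace QWhittaker
open Finset MeasureTheory

/-- The torus integral of the row `κ` against the function `f`. -/
def rowMoment (q : ℂ) {N : ℕ} (κ : ℕ → ℤ) (α : Fin N → ℂ) (f : (Fin N → ℂ) → ℂ) : ℂ :=
  torusAvg (fun _ => 1) fun z => rowIntegrand q κ α 1 z * f z

/-- The signed measure on the cone attached to the function `f` on the torus. -/
def coneWeight (q : ℂ) {N : ℕ} (a α : Fin N → ℂ) (f : (Fin N → ℂ) → ℂ) (x : GTCone N) : ℂ :=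
  chainP q x a * (rowWeight q N (x.entry N) * rowMoment q (refl N (x.entry N)) α f)

theorem rowWeight_of_not_isSignature {q : ℂ} (hq0 : q ≠ 0) (hq : ‖q‖ < 1) {N : ℕ} {s : ℕ → ℤ}
    (hs : ¬ IsSignature N s) : rowWeight q N s = 0 := by
  by_contra hne
  refine hs (isSignature_of_succ_le fun i h1 h2 => ?_)
  by_contra hlt
  exact prod_ne_zero_iff.mp hne i (mem_Icc.mpr ⟨h1, by omega⟩)
    (qTail_of_neg hq0 hq (by omega))

/-- Lowering part j changes two tails: that of the gap before j absorbs the entering coefficient,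
that of the gap after j releases the Pieri coefficient. -/
theorem raiseCoeff_mul_rowWeight {q : ℂ} (hq0 : q ≠ 0) (hq : ‖q‖ < 1) {N j : ℕ} (hj : 1 ≤ j)
    (hjN : j ≤ N) (s : ℕ → ℤ) :
    raiseCoeff q j s * rowWeight q N (s - ind {j}) =
      rowWeight q N s * if j = N then 1 else 1 - q ^ (s j - s (j + 1)) := by
  obtain ⟨n, rfl⟩ : ∃ n, N = n + 1 := ⟨N - 1, by omega⟩
  have hP : ∏ i ∈ Icc 1 n with i ≠ j ∧ i + 1 ≠ j,
      qTail q ((s - ind {j}) i - (s - ind {j}) (i + 1)) =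
      ∏ i ∈ Icc 1 n with i ≠ j ∧ i + 1 ≠ j, qTail q (s i - s (i + 1)) :=
    prod_congr rfl fun i hi => by
      have := (mem_filter.mp hi).2
      rw [sub_ind_of_ne s this.1, sub_ind_of_ne s this.2]
  have h1 : raiseCoeff q j s * (if j = 1 then 1 else
      qTail q ((s - ind {j}) (j - 1) - (s - ind {j}) (j - 1 + 1))) =
      if j = 1 then 1 else qTail q (s (j - 1) - s (j - 1 + 1)) := by
    unfold raiseCoeff
    by_cases h : j = 1
    · simp only [if_pos h, mul_one]
    · simp only [if_neg h]
      rw [show j - 1 + 1 = j by omega, sub_ind_self, sub_ind_of_ne s (by omega),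
        qTail_eq_mul hq0 hq (s (j - 1) - s j)]
      congr 2
      ring
  have h2 : (if j = n + 1 then 1 else qTail q ((s - ind {j}) j - (s - ind {j}) (j + 1))) =
      (if j = n + 1 then 1 else qTail q (s j - s (j + 1))) *
        if j = n + 1 then 1 else 1 - q ^ (s j - s (j + 1)) := by
    by_cases h : j = n + 1
    · simp only [if_pos h, mul_one]
    · simp only [if_neg h]
      rw [sub_ind_self, sub_ind_of_ne s (by omega), qTail_eq_mul hq0 hq, mul_comm]
      congr 2 <;> ring_nf
  rw [rowWeight, rowWeight, show n + 1 - 1 = n from rfl, prod_Icc_split_neighbours _ hj hjN,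
    prod_Icc_split_neighbours _ hj hjN, hP, h2, ← h1]
  ring

section moments
variable {q : ℂ} (hq0 : q ≠ 0) (hq : ‖q‖ < 1) {N : ℕ} {α : Fin N → ℂ}
  {c : ℝ} (hc0 : 0 ≤ c) (hc1 : c < 1) (hα : ∀ k, ‖α k‖ ≤ c)
  {f : (Fin N → ℂ) → ℂ} (hf : Continuous f)
include hq0 hq hc0 hc1 hα hf

theorem continuous_rowIntegrand_mul (κ : ℕ → ℤ) : Continuous fun θ : Fin N → ℝ =>
    rowIntegrand q κ α 1 (torusMap 0 (fun _ => 1) θ) * f (torusMap 0 (fun _ => 1) θ) :=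
  continuous_comp_torusMap (c := fun _ => c) (fun _ => hc0) (fun _ => hc1)
    (G := fun z => rowIntegrand q κ α 1 z * f z)
    ((differentiableOn_rowIntegrand hq0 hq κ (fun _ => hc0)
      (by simpa using fun _ => hα)).continuousOn.mul hf.continuousOn)

theorem integrableOn_rowIntegrand_mul (κ : ℕ → ℤ) : IntegrableOn (fun θ : Fin N → ℝ =>
    rowIntegrand q κ α 1 (torusMap 0 (fun _ => 1) θ) * f (torusMap 0 (fun _ => 1) θ))
      (Set.Icc (0 : Fin N → ℝ) (fun _ => 2 * Real.pi)) :=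
  (continuous_rowIntegrand_mul hq0 hq hc0 hc1 hα hf κ).continuousOn.integrableOn_compact
    isCompact_Icc

/-- Reflection of the row turns P(z) into P(1/z), for which the first-order Pieri rule multiplies by
∑ z_i under the integral. -/
theorem sum_raiseCoeff_mul_rowMoment {s : ℕ → ℤ} (hs : IsSignature N s) :
    ∑ j ∈ Icc 1 N, raiseCoeff q j s *
      (rowWeight q N (s - ind {j}) * rowMoment q (refl N (s - ind {j})) α f) =
      rowWeight q N s * rowMoment q (refl N s) α fun z => (∑ i, z i) * f z := by
  have hpt : ∀ z : Fin N → ℂ, (∀ j, z j ≠ 0) →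
      ∑ j ∈ Icc 1 N, (if j = N then 1 else 1 - q ^ (s j - s (j + 1))) *
        (rowIntegrand q (refl N (s - ind {j})) α 1 z * f z) =
      rowIntegrand q (refl N s) α 1 z * ((∑ i, z i) * f z) := by
    intro z hz
    have hz' := zext_ne_zero hz
    have hp := pw_pieri_one hq0 hq N hs fun j => inv_ne_zero (hz' j)
    simp only [inv_inv] at hp
    rw [← Fin.sum_univ_eq_sum_range] at hp
    simp only [zext_apply] at hp
    simp only [rowIntegrand, pw_refl q N _ hz']
    rw [show ∀ A B C D E : ℂ, A * B * C * (D * E) = (D * A) * (B * C * E) by intros; ring, hp,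
      sum_mul]
    exact sum_congr rfl fun j _ => by ring
  have hint := torusAvg_sum (Icc 1 N) (R := fun _ => 1)
    (G := fun j z => (if j = N then 1 else 1 - q ^ (s j - s (j + 1))) *
      (rowIntegrand q (refl N (s - ind {j})) α 1 z * f z)) fun j _ =>
      (integrableOn_rowIntegrand_mul hq0 hq hc0 hc1 hα hf _).const_mul _
  have e1 : ∀ j, torusAvg (fun _ => 1) (fun z : Fin N → ℂ =>
      (if j = N then 1 else 1 - q ^ (s j - s (j + 1))) *
        (rowIntegrand q (refl N (s - ind {j})) α 1 z * f z)) =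
      (if j = N then 1 else 1 - q ^ (s j - s (j + 1))) *
        rowMoment q (refl N (s - ind {j})) α f := fun j => integral_const_mul _ _
  rw [rowMoment, ← torusAvg_congr fun z hz _ => hpt z fun j =>
    norm_pos_iff.mp (by rw [hz j]; exact one_pos), hint, mul_sum]
  refine sum_congr rfl fun j hj => ?_
  rw [e1, ← mul_assoc, raiseCoeff_mul_rowWeight hq0 hq (mem_Icc.mp hj).1 (mem_Icc.mp hj).2]
  ring

theorem rowMoment_sub_const_mul {g : (Fin N → ℂ) → ℂ} (hg : Continuous g) (b : ℂ) (κ : ℕ → ℤ) :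
    rowMoment q κ α (fun z => (g z - b) * f z) =
      rowMoment q κ α (fun z => g z * f z) - b * rowMoment q κ α f := by
  have h1 := integrableOn_rowIntegrand_mul hq0 hq hc0 hc1 hα (hg.mul hf) κ
  have h2 := (integrableOn_rowIntegrand_mul hq0 hq hc0 hc1 hα hf κ).const_mul b
  have h := integral_sub h1 h2
  rw [integral_const_mul] at h
  rw [rowMoment, torusAvg, rowMoment, torusAvg, rowMoment, torusAvg]
  refine Eq.trans ?_ h
  congr 1
  funext θ
  simp only [Pi.mul_apply]
  ring

/-- Expansion of an exponential under the torus integral. -/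
theorem hasSum_rowMoment_exp {g : (Fin N → ℂ) → ℂ} (hg : Continuous g) (κ : ℕ → ℤ) (t : ℝ) :
    HasSum (fun n : ℕ => ((t : ℂ) ^ n / n.factorial) * rowMoment q κ α fun z => g z ^ n * f z)
      (rowMoment q κ α fun z => Complex.exp (t * g z) * f z) := by
  set T := Set.Icc (0 : Fin N → ℝ) (fun _ => 2 * Real.pi)
  have hcont := fun n : ℕ => continuous_rowIntegrand_mul hq0 hq hc0 hc1 hα
    ((hg.pow n).mul hf) κ
  obtain ⟨M₁, hM₁⟩ := (isCompact_Icc (a := (0 : Fin N → ℝ))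
    (b := fun _ => 2 * Real.pi)).exists_bound_of_continuousOn
    (continuous_rowIntegrand_mul hq0 hq hc0 hc1 hα hf κ).continuousOn
  obtain ⟨M₂, hM₂⟩ := (isCompact_Icc (a := (0 : Fin N → ℝ))
    (b := fun _ => 2 * Real.pi)).exists_bound_of_continuousOn
    (hg.comp (continuous_torusMap fun _ => 1)).continuousOn
  set F : ℕ → (Fin N → ℝ) → ℂ := fun n θ => ((t : ℂ) ^ n / n.factorial) *
    (rowIntegrand q κ α 1 (torusMap 0 (fun _ => 1) θ) *
      (g (torusMap 0 (fun _ => 1) θ) ^ n * f (torusMap 0 (fun _ => 1) θ)))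
  have hFint : ∀ n, IntegrableOn (F n) T := fun n =>
    (integrableOn_rowIntegrand_mul hq0 hq hc0 hc1 hα ((hg.pow n).mul hf) κ).const_mul _
  have hFnorm : ∀ n, ∀ θ ∈ T, ‖F n θ‖ ≤ (|t| * M₂) ^ n / n.factorial * M₁ := by
    intro n θ hθ
    have h1 := hM₁ θ hθ
    have h2 : ‖g (torusMap 0 (fun _ => 1) θ)‖ ≤ M₂ := hM₂ θ hθ
    have h0 : ‖F n θ‖ = |t| ^ n / n.factorial * ‖g (torusMap 0 (fun _ => 1) θ)‖ ^ n *
        ‖rowIntegrand q κ α 1 (torusMap 0 (fun _ => 1) θ) * f (torusMap 0 (fun _ => 1) θ)‖ := by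
      simp only [F, norm_mul, norm_div, norm_pow, Complex.norm_real, Real.norm_eq_abs,
        RCLike.norm_natCast]
      ring
    have h3 : 0 ≤ M₂ := (norm_nonneg _).trans h2
    rw [h0, mul_pow, mul_div_right_comm]
    gcongr
  have hsum : Summable fun n => ∫ θ in T, ‖F n θ‖ := by
    refine Summable.of_nonneg_of_le (fun n => integral_nonneg fun _ => norm_nonneg _)
      (fun n => ?_) (((Real.summable_pow_div_factorial (|t| * M₂)).mul_right M₁).mul_right
        (volume.real T))
    have := norm_setIntegral_le_of_norm_le_const (f := fun θ => ‖F n θ‖) (s := T) (μ := volume)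
      isCompact_Icc.measure_lt_top fun θ hθ => by
        rw [norm_norm]; exact hFnorm n θ hθ
    exact (le_abs_self _).trans this
  have h := hasSum_integral_of_summable_integral_norm hFint hsum
  have e1 : ∀ n, ∫ θ in T, F n θ = ((t : ℂ) ^ n / n.factorial) *
      rowMoment q κ α fun z => g z ^ n * f z := fun n => integral_const_mul _ _
  have e2 : ∫ θ in T, ∑' n, F n θ = rowMoment q κ α fun z => Complex.exp (t * g z) * f z := by
    rw [rowMoment, torusAvg]
    congr 1
    funext θ
    have hexp := (NormedSpace.expSeries_div_hasSum_exp
      ((t : ℂ) * g (torusMap 0 (fun _ => 1) θ)))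
    rw [← Complex.exp_eq_exp_ℂ] at hexp
    have := (hexp.mul_right (f (torusMap 0 (fun _ => 1) θ))).mul_left
      (rowIntegrand q κ α 1 (torusMap 0 (fun _ => 1) θ))
    rw [← this.tsum_eq]
    refine tsum_congr fun n => ?_
    simp only [F, mul_pow]
    ring
  simp only [e1] at h
  rwa [e2] at h

end moments

section weights
variable {q : ℝ} (hq0 : 0 < q) (hq1 : q < 1) {N : ℕ} (hN : 1 ≤ N) {a : Fin N → ℝ}
  (ha : ∀ i, 0 < a i) {α : Fin N → ℂ} {c : ℝ} (hc0 : 0 ≤ c) (hc1 : c < 1)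
  (hα : ∀ k, ‖α k‖ ≤ c) {f : (Fin N → ℂ) → ℂ} (hf : Continuous f)
include hq0 hq1 hc0 hc1 hα hf

include hN ha in
/-- The generator acts on the signed measures `coneWeight` by multiplication. -/
theorem hasSum_coneWeight_mul_generator (y : GTCone N) :
    HasSum (fun x : GTCone N => coneWeight q (fun j => (a j : ℂ)) α f x * (generator q a x y : ℂ))
      (coneWeight q (fun j => (a j : ℂ)) α (fun z => (∑ i, z i - ∑ i, (a i : ℂ)) * f z) y) := by
  have hqc0 : (q : ℂ) ≠ 0 := by exact_mod_cast hq0.ne'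
  have hqc : ‖(q : ℂ)‖ < 1 := by simpa [abs_of_pos hq0] using hq1
  have h := hasSum_chainP_mul_generator hq0 hq1 hN ha y
    (g := fun s => rowWeight q N s * rowMoment q (refl N s) α f) fun s hs => by
      rw [rowWeight_of_not_isSignature hqc0 hqc hs, zero_mul]
  rw [sum_raiseCoeff_mul_rowMoment hqc0 hqc hc0 hc1 hα hf (y.signature N hN le_rfl)] at h
  unfold coneWeight
  rw [rowMoment_sub_const_mul hqc0 hqc hc0 hc1 hα hf (by fun_prop)]
  convert h using 1
  ring

theorem hasSum_coneWeight_exp (a : Fin N → ℂ) {g : (Fin N → ℂ) → ℂ} (hg : Continuous g)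
    (x : GTCone N) (t : ℝ) :
    HasSum (fun n : ℕ => ((t : ℂ) ^ n / n.factorial) *
        coneWeight q a α (fun z => g z ^ n * f z) x)
      (coneWeight q a α (fun z => Complex.exp (t * g z) * f z) x) := by
  have hqc0 : (q : ℂ) ≠ 0 := by exact_mod_cast hq0.ne'
  have hqc : ‖(q : ℂ)‖ < 1 := by simpa [abs_of_pos hq0] using hq1
  have h := (hasSum_rowMoment_exp hqc0 hqc hc0 hc1 hα hf hg (refl N (x.entry N)) t).mul_left
    (chainP (q : ℂ) x a * rowWeight q N (x.entry N))
  have e : ∀ n : ℕ, (t : ℂ) ^ n / n.factorial * coneWeight q a α (fun z => g z ^ n * f z) x =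
      chainP (q : ℂ) x a * rowWeight q N (x.entry N) * ((t : ℂ) ^ n / n.factorial *
        rowMoment q (refl N (x.entry N)) α fun z => g z ^ n * f z) := fun n => by
    rw [coneWeight]; ring
  simp only [e]
  rw [coneWeight, ← mul_assoc]
  exact h

end weights

theorem sklyanin_eq (q : ℂ) {N : ℕ} (z : Fin N → ℂ) :
    sklyanin q z = 1 / ((2 * (Real.pi : ℂ) * Complex.I) ^ N * (N.factorial : ℂ)) *
      pairProd q 1 z := by
  rw [sklyanin, pairProd]
  simp only [Pi.one_apply, one_mul]
  rw [← prod_prod_Ioi_mul_eq_prod_prod_off_diag fun j i => qPochInf q (z j / z i)]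
  simp only [mul_comm]

/-- The normalization relating `process` and `coneWeight`. -/
def processConst (q : ℂ) {N : ℕ} (a α : Fin N → ℂ) : ℂ :=
  Complex.I ^ N / ((2 * (Real.pi : ℂ) * Complex.I) ^ N * (N.factorial : ℂ)) / cauchyProd q α 1 a

/-- In angular coordinates dz_i / z_i is i dθ_i, which leaves the constant i^N. The time-dependent
part of Π(a;α,t) is absorbed into the function on the torus. -/
theorem process_eq {q : ℝ} (hq0 : 0 < q) (hq1 : q < 1) {N : ℕ} (hN : 1 ≤ N) (a α : Fin N → ℝ)
    (t : ℝ) (x : GTCone N) :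
    process q a α t x = processConst q (fun j => (a j : ℂ)) (fun j => (α j : ℂ)) *
      coneWeight q (fun j => (a j : ℂ)) (fun j => (α j : ℂ))
        (fun z => Complex.exp (t * (∑ i, z i - ∑ i, (a i : ℂ)))) x := by
  have hqc0 : (q : ℂ) ≠ 0 := by exact_mod_cast hq0.ne'
  have hqc : ‖(q : ℂ)‖ < 1 := by simpa [abs_of_pos hq0] using hq1
  have hPi : ∀ z : Fin N → ℂ, bigPi q z α t =
      cauchyProd q (fun j => (α j : ℂ)) 1 z * Complex.exp (t * ∑ i, z i) := by
    intro z
    rw [bigPi, cauchyProd, mul_sum, Complex.exp_sum]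
    simp only [Pi.one_apply, one_mul, mul_comm (t : ℂ)]
  have hQ : whittakerQ q N (x.entry N) α t = rowWeight q N (x.entry N) *
      (Complex.I ^ N / ((2 * (Real.pi : ℂ) * Complex.I) ^ N * (N.factorial : ℂ)) *
        rowMoment q (refl N (x.entry N)) (fun j => (α j : ℂ))
          fun z => Complex.exp (t * ∑ i, z i)) := by
    rw [whittakerQ, rowWeight, torusIntegral, rowMoment, torusAvg]
    refine congrArg₂ (· * ·) rfl ?_
    rw [← integral_const_mul]
    congr 1
    funext θ
    set z := torusMap (0 : Fin N → ℂ) (fun _ => 1) θ with hz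
    have hz0 : ∀ j, z j ≠ 0 := fun j => norm_pos_iff.mp (by
      rw [hz, norm_torusMap (R := fun _ => 1) (by simp)]; exact one_pos)
    have hprod : ∏ i, (((1 : ℝ) : ℂ) * Complex.exp (θ i * Complex.I) * Complex.I) =
        (∏ i, z i) * Complex.I ^ N := by
      rw [prod_mul_distrib, prod_const, card_univ, Fintype.card_fin]
      simp [hz, torusMap]
    have hz' : torusMap (fun _ : Fin N => (0 : ℂ)) (fun _ => 1) θ = z := rfl
    rw [hprod, hz', smul_eq_mul, whittakerP_inv hqc0 hqc N (x.signature N hN le_rfl) hz0, hPi,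
      sklyanin_eq, prod_inv_distrib, rowIntegrand, pw_refl _ _ _ (zext_ne_zero hz0)]
    have : ∏ i, z i ≠ 0 := prod_ne_zero_iff.mpr fun i _ => hz0 i
    field_simp
  have hexp : (fun z : Fin N → ℂ => Complex.exp (t * (∑ i, z i - ∑ i, (a i : ℂ)))) =
      fun z => Complex.exp (t * ∑ i, z i) * (Complex.exp (t * ∑ i, (a i : ℂ)))⁻¹ := by
    funext z
    rw [← Complex.exp_neg, ← Complex.exp_add]
    congr 1
    ring
  have hmom : ∀ κ : ℕ → ℤ, rowMoment q κ (fun j => (α j : ℂ))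
      (fun z => Complex.exp (t * ∑ i, z i) * (Complex.exp (t * ∑ i, (a i : ℂ)))⁻¹) =
      rowMoment q κ (fun j => (α j : ℂ)) (fun z => Complex.exp (t * ∑ i, z i)) *
        (Complex.exp (t * ∑ i, (a i : ℂ)))⁻¹ := by
    intro κ
    rw [rowMoment, rowMoment, torusAvg, torusAvg, ← integral_mul_const]
    simp only [mul_assoc]
  rw [process, hQ, hPi, hexp, coneWeight, hmom, processConst, div_eq_mul_inv, mul_inv]
  ring

end QWhittaker
end
-- Exponential series in ℓ¹, and kernels with bounded absolute row sums.
noncomputable section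
namespace QWhittaker
open Finset

theorem summable_pow_div_factorial_mul_pow (T K D : ℝ) :
    Summable fun n : ℕ => T ^ n / n.factorial * (D * K ^ n) := by
  refine ((Real.summable_pow_div_factorial (T * K)).mul_left D).congr fun n => ?_
  rw [mul_pow]
  ring

theorem norm_pow_div_factorial_mul (t : ℝ) (n : ℕ) (c : ℂ) :
    ‖(t : ℂ) ^ n / n.factorial * c‖ = |t| ^ n / n.factorial * ‖c‖ := by
  simp only [norm_mul, norm_div, norm_pow, Complex.norm_real, Real.norm_eq_abs,
    RCLike.norm_natCast]

/-- Differentiation of an exponential generating function. -/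
theorem hasDerivAt_exponential_series {c : ℕ → ℂ} {D K : ℝ} (hc : ∀ n, ‖c n‖ ≤ D * K ^ n)
    (t : ℝ) :
    HasDerivAt (fun s : ℝ => ∑' n : ℕ, (s : ℂ) ^ n / n.factorial * c n)
      (∑' n : ℕ, (t : ℂ) ^ n / n.factorial * c (n + 1)) t := by
  set T : ℝ := |t| + 1
  have hT : 0 < T := by positivity
  have hbound : ∀ n : ℕ, ∀ s ∈ Metric.ball (0 : ℝ) T,
      ‖((n : ℂ) * (s : ℂ) ^ (n - 1)) / n.factorial * c n‖ ≤
        (fun n : ℕ => (n : ℝ) * T ^ (n - 1) / n.factorial * (D * K ^ n)) n := by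
    intro n s hs
    have hs' : |s| ≤ T := by
      rw [Metric.mem_ball, dist_zero_right, Real.norm_eq_abs] at hs
      exact hs.le
    simp only [norm_mul, norm_div, norm_pow, Complex.norm_real, Real.norm_eq_abs,
      RCLike.norm_natCast]
    gcongr
    exact hc n
  have hshift : ∀ n : ℕ, ((n + 1 : ℕ) : ℝ) / (n + 1).factorial = 1 / n.factorial := fun n => by
    rw [Nat.factorial_succ]
    push_cast
    field_simp
  have hshift' : ∀ n : ℕ, ((n + 1 : ℕ) : ℂ) / (n + 1).factorial = 1 / n.factorial := fun n => by
    rw [Nat.factorial_succ]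
    push_cast
    have : ((n : ℂ) + 1) ≠ 0 := by exact_mod_cast n.succ_ne_zero
    field_simp
  have hu : Summable fun n : ℕ => (n : ℝ) * T ^ (n - 1) / n.factorial * (D * K ^ n) := by
    rw [← summable_nat_add_iff 1]
    refine (summable_pow_div_factorial_mul_pow T K (D * K)).congr fun n => ?_
    rw [Nat.add_sub_cancel, mul_div_right_comm, hshift n, pow_succ]
    ring
  have h := hasDerivAt_tsum_of_isPreconnected (𝕜 := ℝ) (F := ℂ)
    (g := fun n s => (s : ℂ) ^ n / n.factorial * c n) (y₀ := 0) (y := t) hu Metric.isOpen_ball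
    (convex_ball (0 : ℝ) T).isPreconnected (fun n s _ => ?_) hbound
    (Metric.mem_ball_self hT) ?_ (by
      rw [Metric.mem_ball, dist_zero_right, Real.norm_eq_abs]; simp only [T]; linarith)
  · have hs : Summable fun n : ℕ => ((n : ℂ) * (t : ℂ) ^ (n - 1)) / n.factorial * c n :=
      Summable.of_norm_bounded hu fun n => hbound n t (by
        rw [Metric.mem_ball, dist_zero_right, Real.norm_eq_abs]; simp only [T]; linarith)
    rw [hs.tsum_eq_zero_add] at h
    refine h.congr_deriv ?_
    simp only [Nat.cast_zero, zero_mul, zero_div, zero_add, Nat.add_sub_cancel]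
    refine tsum_congr fun n => ?_
    rw [mul_div_right_comm, hshift' n]
    ring
  · have h1 : HasDerivAt (fun s : ℝ => (s : ℂ) ^ n) ((n : ℂ) * (s : ℂ) ^ (n - 1)) s := by
      simpa using (hasDerivAt_id s).ofReal_comp.fun_pow n
    exact (h1.div_const _).mul_const _
  · refine summable_of_ne_finset_zero (s := {0}) fun n hn => ?_
    simp [zero_pow (by simpa using hn : n ≠ 0)]

section series
variable {X : Type*} {p : ℕ → X → ℂ} {D K : ℝ}
  (hp : ∀ n, Summable (fun x => ‖p n x‖) ∧ ∑' x, ‖p n x‖ ≤ D * K ^ n)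
include hp

theorem summable_series_prod (t : ℝ) :
    Summable fun nx : ℕ × X => (t : ℂ) ^ nx.1 / nx.1.factorial * p nx.1 nx.2 := by
  refine Summable.of_norm ((summable_prod_of_nonneg fun _ => norm_nonneg _).mpr ⟨fun n => ?_, ?_⟩)
  · simp only [norm_pow_div_factorial_mul]
    exact (hp n).1.mul_left _
  · simp only [norm_pow_div_factorial_mul, tsum_mul_left]
    refine Summable.of_nonneg_of_le (fun n => ?_) (fun n => ?_)
      (summable_pow_div_factorial_mul_pow |t| K D)
    · exact mul_nonneg (by positivity) (tsum_nonneg fun _ => norm_nonneg _)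
    · exact mul_le_mul_of_nonneg_left (hp n).2 (by positivity)

theorem summable_series (t : ℝ) :
    Summable fun x => ∑' n : ℕ, (t : ℂ) ^ n / n.factorial * p n x :=
  (summable_series_prod hp t).prod_symm.prod

theorem norm_le_of_tsum_le (n : ℕ) (x : X) : ‖p n x‖ ≤ D * K ^ n :=
  ((hp n).1.le_tsum x fun _ _ => norm_nonneg _).trans (hp n).2

/-- Sums over a subset of an exponential generating function may be differentiated termwise. -/
theorem hasDerivAt_tsum_series (Y : Set X) (t : ℝ) :
    HasDerivAt (fun s : ℝ => ∑' x : Y, ∑' n : ℕ, (s : ℂ) ^ n / n.factorial * p n x)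
      (∑' x : Y, ∑' n : ℕ, (t : ℂ) ^ n / n.factorial * p (n + 1) x) t := by
  have hY : ∀ n, Summable (fun x : Y => ‖p n x‖) ∧ ∑' x : Y, ‖p n x‖ ≤ D * K ^ n := fun n =>
    ⟨(hp n).1.subtype Y, (Summable.tsum_subtype_le (fun x => ‖p n x‖) Y (fun _ => norm_nonneg _) (hp n).1).trans
      (hp n).2⟩
  have hswap : ∀ s : ℝ, ∑' x : Y, ∑' n : ℕ, (s : ℂ) ^ n / n.factorial * p n x =
      ∑' n : ℕ, (s : ℂ) ^ n / n.factorial * ∑' x : Y, p n x := fun s => by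
    rw [Summable.tsum_comm (f := fun (n : ℕ) (x : Y) => (s : ℂ) ^ n / n.factorial * p n x)
      (summable_series_prod (p := fun n (x : Y) => p n x) hY s)]
    simp only [tsum_mul_left]
  have hY' : ∀ n, Summable (fun x : Y => ‖p (n + 1) x‖) ∧
      ∑' x : Y, ‖p (n + 1) x‖ ≤ (D * K) * K ^ n := fun n =>
    ⟨(hY (n + 1)).1, (hY (n + 1)).2.trans_eq (by rw [pow_succ]; ring)⟩
  have hswap' : ∑' x : Y, ∑' n : ℕ, (t : ℂ) ^ n / n.factorial * p (n + 1) x =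
      ∑' n : ℕ, (t : ℂ) ^ n / n.factorial * ∑' x : Y, p (n + 1) x := by
    rw [Summable.tsum_comm (f := fun (n : ℕ) (x : Y) => (t : ℂ) ^ n / n.factorial * p (n + 1) x)
      (summable_series_prod (p := fun n (x : Y) => p (n + 1) x) hY' t)]
    simp only [tsum_mul_left]
  simp only [hswap, hswap']
  exact hasDerivAt_exponential_series (c := fun n => ∑' x : Y, p n x)
    (fun n => (norm_tsum_le_tsum_norm (hY n).1).trans (hY n).2) t

end series

section kernels
variable {X : Type*} {L : X → X → ℝ} {K : ℝ}
  (hL : ∀ x, Summable (fun y => |L x y|) ∧ ∑' y, |L x y| ≤ K)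
  {p p' : X → ℂ} (hp : Summable fun x => ‖p x‖)
  (hstep : ∀ y, HasSum (fun x => p x * (L x y : ℂ)) (p' y))
include hL hp

theorem summable_kernel_prod : Summable fun xy : X × X => ‖p xy.1 * (L xy.1 xy.2 : ℂ)‖ := by
  simp only [norm_mul, Complex.norm_real, Real.norm_eq_abs]
  refine (summable_prod_of_nonneg fun xy => ?_).mpr ⟨fun x => (hL x).1.mul_left ‖p x‖, ?_⟩
  · exact mul_nonneg (norm_nonneg _) (abs_nonneg _)
  · simp only [tsum_mul_left]
    exact Summable.of_nonneg_of_le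
      (fun x => mul_nonneg (norm_nonneg _) (tsum_nonneg fun _ => abs_nonneg _))
      (fun x => mul_le_mul_of_nonneg_left (hL x).2 (norm_nonneg _)) (hp.mul_right K)

include hstep

/-- Absolute row sums bounded by K make the kernel an operator of norm at most K on ℓ¹, by Tonelli.
-/
theorem summable_kernel_step :
    Summable (fun y => ‖p' y‖) ∧ ∑' y, ‖p' y‖ ≤ (∑' x, ‖p x‖) * K := by
  have hprod := summable_kernel_prod hL hp
  have hsw := hprod.prod_symm
  have hcol : ∀ y, Summable fun x => ‖p x * (L x y : ℂ)‖ := by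
    intro y
    have := hsw.prod_factor y
    simpa only [Prod.fst_swap, Prod.snd_swap, Prod.swap_prod_mk] using this
  have hle : ∀ y, ‖p' y‖ ≤ ∑' x, ‖p x * (L x y : ℂ)‖ := fun y => by
    rw [← (hstep y).tsum_eq]
    exact norm_tsum_le_tsum_norm (hcol y)
  have hs : Summable fun y => ∑' x, ‖p x * (L x y : ℂ)‖ := hsw.prod
  have h1 : Summable fun y => ‖p' y‖ := Summable.of_nonneg_of_le (fun _ => norm_nonneg _) hle hs
  refine ⟨h1, (h1.tsum_le_tsum hle hs).trans ?_⟩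
  rw [Summable.tsum_comm (f := fun x y => ‖p x * (L x y : ℂ)‖) hprod]
  have hrow : ∀ x, ∑' y, ‖p x * (L x y : ℂ)‖ = ‖p x‖ * ∑' y, |L x y| := fun x => by
    rw [← tsum_mul_left]
    simp only [norm_mul, Complex.norm_real, Real.norm_eq_abs]
  simp only [hrow]
  rw [← tsum_mul_right]
  refine Summable.tsum_le_tsum (fun x => mul_le_mul_of_nonneg_left (hL x).2 (norm_nonneg _)) ?_
    (hp.mul_right K)
  simpa only [hrow] using hprod.prod

/-- Lumping: a kernel which is autonomous under `e` acts on the image measures. -/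
theorem hasSum_lumped {Z : Type*} (e : X → Z) {M : Z → Z → ℝ}
    (hM : ∀ x Y, HasSum (fun y : {y // e y = Y} => L x y.1) (M (e x) Y)) (Y : Z) :
    HasSum (fun W : Z => (∑' x : {x // e x = W}, p x.1) * (M W Y : ℂ))
      (∑' y : {y // e y = Y}, p' y.1) := by
  have hprod := (summable_kernel_prod hL hp).of_norm
  have hres : Summable fun xy : X × {y // e y = Y} => p xy.1 * (L xy.1 xy.2 : ℂ) :=
    hprod.comp_injective (i := fun xy : X × {y // e y = Y} => (xy.1, xy.2.1))
      fun u v h => by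
        simp only [Prod.mk.injEq] at h
        exact Prod.ext h.1 (Subtype.ext h.2)
  have hrow : ∀ x, ∑' y : {y // e y = Y}, p x * (L x y : ℂ) = p x * (M (e x) Y : ℂ) := fun x => by
    rw [tsum_mul_left, ← Complex.ofReal_tsum, (hM x Y).tsum_eq]
  have hcol : ∀ y : {y // e y = Y}, ∑' x, p x * (L x y : ℂ) = p' y := fun y => (hstep y).tsum_eq
  have htot : HasSum (fun x => p x * (M (e x) Y : ℂ)) (∑' y : {y // e y = Y}, p' y.1) := by
    have h1 := hres.prod
    simp only [hrow] at h1
    have h2 := Summable.tsum_comm (f := fun (x : X) (y : {y // e y = Y}) => p x * (L x y : ℂ)) hres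
    simp only [hrow, hcol] at h2
    rw [h2]
    exact h1.hasSum
  have hsig := (Equiv.sigmaFiberEquiv e).hasSum_iff.mpr htot
  -- Each fibre of e contributes its total mass times M, since the kernel's fibre sums depend on x
  -- only through e x.
  refine hsig.sigma fun W => ?_
  have hW : ∀ x : {x // e x = W}, p x.1 * (M (e x.1) Y : ℂ) = p x.1 * (M W Y : ℂ) := fun x => by
    rw [x.2]
  have hs : Summable fun x : {x // e x = W} => p x.1 := hp.of_norm.subtype {x | e x = W}
  have h3 := hs.hasSum.mul_right (M W Y : ℂ)
  have e3 : (fun x : {x // e x = W} => p x.1 * (M (e x.1) Y : ℂ)) =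
      fun x => p x.1 * (M W Y : ℂ) := funext hW
  change HasSum (fun x : {x // e x = W} => p x.1 * (M (e x.1) Y : ℂ)) _
  rw [e3]
  exact h3

end kernels

end QWhittaker
end
-- Assembly: boundedness of the generator and both forward equations.
noncomputable section
namespace QWhittaker
open Finset

section generator_bounds
variable {q : ℝ} (hq0 : 0 < q) (hq1 : q < 1) {N : ℕ} {a : Fin N → ℝ} (ha : ∀ i, 0 ≤ a i)
include hq0 hq1 ha

theorem abs_generator_self_le (x : GTCone N) :
    |generator q a x x| ≤ ∑ k : Fin N, ∑ _j ∈ Icc 1 ((k : ℕ) + 1), a k * (1 - q)⁻¹ := by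
  refine (abs_sum_le_sum_abs _ _).trans (sum_le_sum fun k _ =>
    (abs_sum_le_sum_abs _ _).trans (sum_le_sum fun j hj => ?_))
  have hj' := mem_Icc.mp hj
  rw [if_pos rfl, abs_mul, abs_of_nonneg (rate_nonneg hq0 hq1 x hj'.1 hj'.2 (by omega) (ha k))]
  refine (mul_le_of_le_one_right (rate_nonneg hq0 hq1 x hj'.1 hj'.2 (by omega) (ha k)) ?_).trans
    (rate_le hq0 hq1 x hj'.1 hj'.2 (by omega) (ha k))
  split_ifs <;> norm_num

/-- Off-diagonal entries are nonnegative and rows sum to zero, so the absolute row sum is |L(x,x)| -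
L(x,x), which the bound on the rates controls uniformly. -/
theorem summable_abs_generator (x : GTCone N) :
    Summable (fun y => |generator q a x y|) ∧ ∑' y, |generator q a x y| ≤
      2 * ∑ k : Fin N, ∑ _j ∈ Icc 1 ((k : ℕ) + 1), a k * (1 - q)⁻¹ := by
  classical
  have e : ∀ y, |generator q a x y| = generator q a x y +
      if y = x then |generator q a x x| - generator q a x x else 0 := by
    intro y
    split_ifs with h
    · rw [h]; ring
    · rw [abs_of_nonneg (generator_nonneg hq0 hq1 ha fun h' => h h'.symm), add_zero]
  have h := (hasSum_generator (q := q) a x).add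
    (hasSum_ite_eq x (|generator q a x x| - generator q a x x))
  simp only [← e] at h
  refine ⟨h.summable, ?_⟩
  rw [h.tsum_eq]
  have h1 := abs_generator_self_le hq0 hq1 ha x
  have h2 := neg_abs_le (generator q a x x)
  linarith

end generator_bounds

section process
variable {q : ℝ} (hq0 : 0 < q) (hq1 : q < 1) {N : ℕ} (hN : 1 ≤ N) {a α : Fin N → ℝ}
  (hα0 : ∀ i, 0 ≤ α i) (hα1 : ∀ i, α i < 1) (hαa : ∀ i j, α i < a j)

/-- The derivatives at time `0` of the process, up to a constant factor. -/
def timeMoment (q : ℝ) {N : ℕ} (a α : Fin N → ℝ) (n : ℕ) : GTCone N → ℂ :=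
  coneWeight q (fun j => (a j : ℂ)) (fun j => (α j : ℂ))
    fun z => (∑ i, z i - ∑ i, (a i : ℂ)) ^ n

include hN hα0 hα1 in
theorem exists_bound_parameters : ∃ c : ℝ, 0 ≤ c ∧ c < 1 ∧ ∀ k, ‖((α k : ℝ) : ℂ)‖ ≤ c := by
  have : Nonempty (Fin N) := ⟨⟨0, hN⟩⟩
  obtain ⟨i₀, hi₀⟩ := Finite.exists_max α
  refine ⟨α i₀, hα0 i₀, hα1 i₀, fun k => ?_⟩
  rw [Complex.norm_real, Real.norm_of_nonneg (hα0 k)]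
  exact hi₀ k

include hq0 hq1 hN hα0 hα1 in
theorem hasSum_process (t : ℝ) (x : GTCone N) :
    HasSum (fun n : ℕ => (t : ℂ) ^ n / n.factorial * timeMoment q a α n x)
      (coneWeight q (fun j => (a j : ℂ)) (fun j => (α j : ℂ))
        (fun z => Complex.exp (t * (∑ i, z i - ∑ i, (a i : ℂ)))) x) := by
  obtain ⟨c, hc0, hc1, hc⟩ := exists_bound_parameters hN hα0 hα1
  have h := hasSum_coneWeight_exp hq0 hq1 hc0 hc1 hc (f := fun _ => 1) continuous_const
    (fun j => (a j : ℂ)) (g := fun z => ∑ i, z i - ∑ i, (a i : ℂ)) (by fun_prop) x t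
  simp only [mul_one] at h
  exact h

include hq0 hq1 hN hα0 hα1 hαa

theorem hasSum_timeMoment_mul_generator (n : ℕ) (y : GTCone N) :
    HasSum (fun x => timeMoment q a α n x * (generator q a x y : ℂ))
      (timeMoment q a α (n + 1) y) := by
  obtain ⟨c, hc0, hc1, hc⟩ := exists_bound_parameters hN hα0 hα1
  have h := hasSum_coneWeight_mul_generator hq0 hq1 hN
    (fun j => (hα0 ⟨0, hN⟩).trans_lt (hαa ⟨0, hN⟩ j)) hc0 hc1 hc
    (f := fun z => (∑ i, z i - ∑ i, (a i : ℂ)) ^ n) (by fun_prop) y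
  unfold timeMoment
  simp only [pow_succ']
  exact h

/-- Each moment is L applied to the preceding one, so the ℓ¹ norm grows by at most K per step from
the summable initial measure. -/
theorem exists_bound_timeMoment : ∃ D K : ℝ, ∀ n, Summable (fun x => ‖timeMoment q a α n x‖) ∧
    ∑' x, ‖timeMoment q a α n x‖ ≤ D * K ^ n := by
  have ha : ∀ j, 0 ≤ a j := fun j => (hα0 ⟨0, hN⟩).trans (hαa ⟨0, hN⟩ j).le
  set K : ℝ := 2 * ∑ k : Fin N, ∑ _j ∈ Icc 1 ((k : ℕ) + 1), a k * (1 - q)⁻¹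
  have hK : 0 ≤ K := mul_nonneg zero_le_two (sum_nonneg fun k _ => sum_nonneg fun _ _ =>
    mul_nonneg (ha k) (inv_nonneg.mpr (by linarith)))
  refine ⟨∑' x, ‖timeMoment q a α 0 x‖, K, fun n => ?_⟩
  induction n with
  | zero =>
    refine ⟨?_, by simp⟩
    have h := summable_initial hq0 hq1 hN hα0 hα1 hαa
    unfold timeMoment coneWeight rowMoment
    unfold rowIntegral at h
    simpa only [pow_zero, mul_one] using h
  | succ n ih =>
    have h := summable_kernel_step (summable_abs_generator hq0 hq1 ha) ih.1
      (hasSum_timeMoment_mul_generator hq0 hq1 hN hα0 hα1 hαa n)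
    exact ⟨h.1, h.2.trans ((mul_le_mul_of_nonneg_right ih.2 hK).trans_eq (by
      rw [pow_succ, mul_assoc]))⟩

theorem hasSum_process_mul_generator (t : ℝ) (y : GTCone N) :
    HasSum (fun x => process q a α t x * (generator q a x y : ℂ))
      (processConst q (fun j => (a j : ℂ)) (fun j => (α j : ℂ)) *
        ∑' n : ℕ, (t : ℂ) ^ n / n.factorial * timeMoment q a α (n + 1) y) := by
  obtain ⟨c, hc0, hc1, hc⟩ := exists_bound_parameters hN hα0 hα1
  have h := (hasSum_coneWeight_mul_generator hq0 hq1 hN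
    (fun j => (hα0 ⟨0, hN⟩).trans_lt (hαa ⟨0, hN⟩ j)) hc0 hc1 hc
    (f := fun z => Complex.exp (t * (∑ i, z i - ∑ i, (a i : ℂ)))) (by fun_prop) y).mul_left
    (processConst q (fun j => (a j : ℂ)) (fun j => (α j : ℂ)))
  have h2 := hasSum_coneWeight_exp hq0 hq1 hc0 hc1 hc
    (f := fun z => ∑ i, z i - ∑ i, (a i : ℂ)) (by fun_prop)
    (fun j => (a j : ℂ)) (g := fun z => ∑ i, z i - ∑ i, (a i : ℂ)) (by fun_prop) y t
  simp only [← pow_succ, mul_comm (Complex.exp _)] at h2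
  unfold timeMoment
  rw [h2.tsum_eq]
  simp only [process_eq hq0 hq1 hN, mul_assoc]
  exact h

omit hαa in
theorem process_eq_tsum (t : ℝ) (x : GTCone N) :
    process q a α t x = processConst q (fun j => (a j : ℂ)) (fun j => (α j : ℂ)) *
      ∑' n : ℕ, (t : ℂ) ^ n / n.factorial * timeMoment q a α n x := by
  rw [process_eq hq0 hq1 hN, (hasSum_process hq0 hq1 hN hα0 hα1 t x).tsum_eq]

/-- The exponential series converges for every real t, so the derivative is two-sided even at 0. -/
theorem hasDerivAt_process (t : ℝ) (y : GTCone N) :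
    HasDerivAt (fun s : ℝ => process q a α s y)
      (∑' x, process q a α t x * (generator q a x y : ℂ)) t := by
  obtain ⟨D, K, hDK⟩ := exists_bound_timeMoment hq0 hq1 hN hα0 hα1 hαa
  rw [(hasSum_process_mul_generator hq0 hq1 hN hα0 hα1 hαa t y).tsum_eq]
  simp only [process_eq_tsum hq0 hq1 hN hα0 hα1]
  exact (hasDerivAt_exponential_series (c := fun n => timeMoment q a α n y)
    (fun n => norm_le_of_tsum_le hDK n y) t).const_mul _

theorem summable_process (t : ℝ) : Summable fun x => process q a α t x := by
  obtain ⟨D, K, hDK⟩ := exists_bound_timeMoment hq0 hq1 hN hα0 hα1 hαa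
  simp only [process_eq_tsum hq0 hq1 hN hα0 hα1]
  exact (summable_series hDK t).mul_left _

theorem hasSum_edgeMarginal_mul_tasepGenerator (t : ℝ) (Y : Config N) :
    HasSum (fun X => edgeMarginal q a α t X * (tasepGenerator q a X Y : ℂ))
      (processConst q (fun j => (a j : ℂ)) (fun j => (α j : ℂ)) *
        ∑' y : {y : GTCone N // edge y = Y},
          ∑' n : ℕ, (t : ℂ) ^ n / n.factorial * timeMoment q a α (n + 1) y) := by
  have ha : ∀ j, 0 ≤ a j := fun j => (hα0 ⟨0, hN⟩).trans (hαa ⟨0, hN⟩ j).le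
  have h := hasSum_lumped (summable_abs_generator hq0 hq1 ha)
    (summable_process hq0 hq1 hN hα0 hα1 hαa t).norm
    (hasSum_process_mul_generator hq0 hq1 hN hα0 hα1 hαa t) edge
    (hasSum_generator_fiber a) Y
  rw [tsum_mul_left] at h
  exact h

theorem hasDerivAt_edgeMarginal (t : ℝ) (Y : Config N) :
    HasDerivAt (fun s : ℝ => edgeMarginal q a α s Y)
      (∑' X, edgeMarginal q a α t X * (tasepGenerator q a X Y : ℂ)) t := by
  obtain ⟨D, K, hDK⟩ := exists_bound_timeMoment hq0 hq1 hN hα0 hα1 hαa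
  rw [(hasSum_edgeMarginal_mul_tasepGenerator hq0 hq1 hN hα0 hα1 hαa t Y).tsum_eq]
  unfold edgeMarginal
  simp only [process_eq_tsum hq0 hq1 hN hα0 hα1, tsum_mul_left]
  exact (hasDerivAt_tsum_series hDK {y | edge y = Y} t).const_mul _

end process

end QWhittaker
end
theorem mainTheorem3 (N : ℕ) (hN : 1 ≤ N) (q : ℝ) (hq0 : 0 < q) (hq1 : q < 1)
    (a α : Fin N → ℝ) (hα0 : ∀ i, 0 ≤ α i) (hα1 : ∀ i, α i < 1) (hαa : ∀ i j, α i < a j) :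
    -- `L` is the generator of a Markov chain on the cone
    (∀ x y : QWhittaker.GTCone N, x ≠ y → 0 ≤ QWhittaker.generator q a x y) ∧
    (∀ x : QWhittaker.GTCone N, HasSum (fun y => QWhittaker.generator q a x y) 0) ∧
    -- the forward equation for `P_t`
    (∀ t : ℝ, 0 ≤ t → ∀ y : QWhittaker.GTCone N,
      Summable (fun x : QWhittaker.GTCone N =>
        QWhittaker.process q a α t x * (QWhittaker.generator q a x y : ℂ)) ∧
      HasDerivWithinAt (fun s : ℝ => QWhittaker.process q a α s y)
        (∑' x : QWhittaker.GTCone N,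
          QWhittaker.process q a α t x * (QWhittaker.generator q a x y : ℂ))
        (Set.Ici 0) t) ∧
    -- the edge of the dynamics with generator `L` is autonomous, with the `q`-TASEP generator
    (∀ (x : QWhittaker.GTCone N) (Y : QWhittaker.Config N),
      HasSum (fun y : {y : QWhittaker.GTCone N // QWhittaker.edge y = Y} =>
          QWhittaker.generator q a x y.1)
        (QWhittaker.tasepGenerator q a (QWhittaker.edge x) Y)) ∧
    -- the edge marginal of `P_t` evolves by the forward equation of `q`-TASEP
    (∀ t : ℝ, 0 ≤ t →
      Summable (fun x : QWhittaker.GTCone N => QWhittaker.process q a α t x) ∧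
      ∀ Y : QWhittaker.Config N,
        Summable (fun X : QWhittaker.Config N =>
          QWhittaker.edgeMarginal q a α t X * (QWhittaker.tasepGenerator q a X Y : ℂ)) ∧
        HasDerivWithinAt (fun s : ℝ => QWhittaker.edgeMarginal q a α s Y)
          (∑' X : QWhittaker.Config N,
            QWhittaker.edgeMarginal q a α t X * (QWhittaker.tasepGenerator q a X Y : ℂ))
          (Set.Ici 0) t) := by
  have ha : ∀ j, 0 ≤ a j := fun j => (hα0 ⟨0, hN⟩).trans (hαa ⟨0, hN⟩ j).le
  refine ⟨fun x y hxy => QWhittaker.generator_nonneg hq0 hq1 ha hxy,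
    fun x => QWhittaker.hasSum_generator a x, fun t _ y => ⟨?_, ?_⟩,
    fun x Y => QWhittaker.hasSum_generator_fiber a x Y, fun t _ => ⟨?_, fun Y => ⟨?_, ?_⟩⟩⟩
  · exact (QWhittaker.hasSum_process_mul_generator hq0 hq1 hN hα0 hα1 hαa t y).summable
  · exact (QWhittaker.hasDerivAt_process hq0 hq1 hN hα0 hα1 hαa t y).hasDerivWithinAt
  · exact QWhittaker.summable_process hq0 hq1 hN hα0 hα1 hαa t
  · exact (QWhittaker.hasSum_edgeMarginal_mul_tasepGenerator hq0 hq1 hN hα0 hα1 hαa t Y).summable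
  · exact (QWhittaker.hasDerivAt_edgeMarginal hq0 hq1 hN hα0 hα1 hαa t Y).hasDerivWithinAt
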